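/- Let $Y,X^*,\xi$ be real random variables and $Z$ a discrete random variable on a common probability space, with $E|Y|<\infty$ and $E|\xi|<\infty$. For $\tau>0$ put $X=X^*+\tau\xi$ (the joint distribution of $(Y,X^*,\xi,Z)$ does not depend on $\tau$). Let $\rho(x)=E[Y|X^*=x]$, let $f_{X^*|Z}(\cdot|z)$ be the conditional density of $X^*$ given $Z=z$, let $f_{\xi|X^*}$ be the conditional density of $\xi$ given $X^*$, and let $v(x)=V[\tau\xi|X^*=x]$. Let $m\ge p$ be integers, and assume the following. 1. (Weakly classical error) $E[\xi|X^*]=0$. 2. (Exclusion) $E[Y|X^*,Z]=E[Y|X^*]$. 3. (Nondifferential error) $E[Y|X^*,Z,X]=E[Y|X^*,Z]$ for every $\tau>0$. 4. The conditional density of $\xi$ given $(X^*,Z)=(x,z)$ does not depend on $z$: $f_{\xi|X^*Z}(u|x,z)=f_{\xi|X^*}(u|x)$. 5. (Smoothness and dominance) There is a closed convex set $\mathcal X\subseteq\mathbb R$ that contains the support of $X^*$ and, for all sufficiently small $\tau>0$, the support of $X$, such that the functions $\rho$ and $f_{\xi|X^*}(u|\cdot)$ on $\mathcal X$ and $f_{X^*|Z}(\cdot|z)$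 on $\mathbb R$ are $m$ times differentiable, and they and their derivatives up to order $m$ are bounded, uniformly in $u$ and in the values $z$ of $Z$ that have positive probability; and $\int|u|^m\sup_{\tilde x\in\mathcal X}|\partial_x^\ell f_{\xi|X^*}(u|\tilde x)|\,du<\infty$ for $\ell=0,\dots,m$. 6. Either $p=3$, or $p=4$ and $E[\xi^3|X^*]=0$. Let $z_1,z_2$ be two values that $Z$ takes with positive probability, and let $x$ be a point with $f_{X^*|Z}(x|z_1)>0$, $f_{X^*|Z}(x|z_2)>0$ and $$\rho'(x)\,[s_{X^*|Z}(x|z_1)-s_{X^*|Z}(x|z_2)]\ne0,\qquad s_{X^*|Z}(x|z)=\frac{f'_{X^*|Z}(x|z)}{f_{X^*|Z}(x|z)},$$ where a prime denotes the derivative in $x$. For each $\tau$ let $q(x,z)=E[Y|X=x,Z=z]$, $q(x)=E[Y|X=x]$ and $s_{X|Z}(x|z)=f'_{X|Z}(x|z)/f_{X|Z}(x|z)$, and define $$\tilde v(x)=\frac{q(x,z_1)-q(x,z_2)}{q'(x)[s_{X|Z}(x|z_1)-s_{X|Z}(x|z_2)]},$$ $$\tilde\rho(x,z)=q(x,z)-\tilde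 v(x)\big[q'(x)s_{X|Z}(x|z)+\tfrac12q''(x)\big]-q'(x)\tilde v'(x).$$ For all sufficiently small $\tau>0$ there are versions of $f_{X|Z}(\cdot|z_j)$, $q(\cdot,z_j)$ $(j=1,2)$ and $q(\cdot)$ that are continuous near $x$. For any such versions and all sufficiently small $\tau>0$, these functions are $C^2$ near $x$, $f_{X|Z}(x|z_j)>0$, and the denominator of $\tilde v(x)$ is nonzero; and as $\tau\downarrow0$, $$\tilde v(x)=v(x)+O(\tau^p)\qquad\text{and}\qquad\tilde\rho(x,z_1)=\rho(x)+O(\tau^p).$$ -/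

import Mathlib

open MeasureTheory ProbabilityTheory Filter Topology Asymptotics
open scoped ENNReal

noncomputable section

namespace SmallME

/-- The σ-algebra generated by a random element `V`. -/
abbrev sigmaOf {Ω E : Type*} [MeasurableSpace E] (V : Ω → E) : MeasurableSpace Ω :=
  MeasurableSpace.comap V inferInstance

/-- On the set `D`, the function `h` is `m` times differentiable, and `h` and its derivatives
up to order `m` are bounded by `C` in absolute value. -/
def BoundedDerivsOn (m : ℕ) (D : Set ℝ) (C : ℝ) (h : ℝ → ℝ) : Prop :=
  (∀ l < m, DifferentiableOn ℝ (iteratedDerivWithin l h D) D) ∧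
    ∀ l ≤ m, ∀ x ∈ D, |iteratedDerivWithin l h D x| ≤ C

/-- `f` is a Lebesgue density of the conditional distribution of `V` given `Z = z`. -/
def IsCondDensity {Ω 𝒵 : Type*} [MeasurableSpace Ω] (μ : Measure Ω)
    (V : Ω → ℝ) (Z : Ω → 𝒵) (z : 𝒵) (f : ℝ → ℝ) : Prop :=
  Measurable f ∧ (∀ x, 0 ≤ f x) ∧
    (cond μ (Z ⁻¹' {z})).map V = volume.withDensity (fun x => ENNReal.ofReal (f x))

/-- The mismeasured covariate `X = X* + τ ξ`. -/
def mismeasured {Ω : Type*} (Xs ξ : Ω → ℝ) (τ : ℝ) : Ω → ℝ := fun ω => Xs ω + τ * ξ ω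

/-- The weakly classical measurement error model, with outcome `Y`, true covariate `Xs`,
standardized error `ξ`, discrete instrument `Z`, regression function `ρ = E[Y | X* = ·]`,
conditional densities `f z x = f_{X*|Z}(x|z)` and `g u x = f_{ξ|X*}(u|x)`, smoothness order `m`,
and a closed convex set `D` that contains the supports of `X*` and `X`. -/
structure WCMEModel {Ω 𝒵 : Type*} [MeasurableSpace Ω] [MeasurableSpace 𝒵]
    (μ : Measure Ω) [IsProbabilityMeasure μ]
    (Y Xs ξ : Ω → ℝ) (Z : Ω → 𝒵)
    (ρ : ℝ → ℝ) (f : 𝒵 → ℝ → ℝ) (g : ℝ → ℝ → ℝ) (m : ℕ) (D : Set ℝ) : Prop where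
  measurable_Xs : Measurable Xs
  measurable_ξ : Measurable ξ
  measurable_Z : Measurable Z
  integrable_Y : Integrable Y μ
  integrable_ξ : Integrable ξ μ
  /-- `ρ(x) = E[Y | X* = x]`. -/
  regression : μ[Y | sigmaOf Xs] =ᵐ[μ] fun ω => ρ (Xs ω)
  /-- `f z` is the conditional density of `X*` given `Z = z`, for every value `z` of `Z`. -/
  density_Xs : ∀ z, μ (Z ⁻¹' {z}) ≠ 0 → IsCondDensity μ Xs Z z (f z)
  measurable_g : Measurable (fun w : ℝ × ℝ => g w.1 w.2)
  /-- The conditional distribution of `ξ` given `(X*, Z) = (x, z)` has the density `g · x`,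
  which does not depend on `z`. -/
  density_ξ : ∀ᵐ w ∂(μ.map (fun ω => (Xs ω, Z ω))),
    (∀ u, 0 ≤ g u w.1) ∧
      condDistrib ξ (fun ω => (Xs ω, Z ω)) μ w =
        volume.withDensity (fun u => ENNReal.ofReal (g u w.1))
  /-- `E[ξ | X*] = 0`. -/
  mean_zero : μ[ξ | sigmaOf Xs] =ᵐ[μ] 0
  /-- `E[Y | X*, Z] = E[Y | X*]`. -/
  exclusion : μ[Y | sigmaOf (fun ω => (Xs ω, Z ω))] =ᵐ[μ] μ[Y | sigmaOf Xs]
  /-- `E[Y | X*, Z, X] = E[Y | X*, Z]`. -/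
  nondifferential : ∀ τ : ℝ, 0 < τ →
    μ[Y | sigmaOf (fun ω => (Xs ω, Z ω, mismeasured Xs ξ τ ω))]
      =ᵐ[μ] μ[Y | sigmaOf (fun ω => (Xs ω, Z ω))]
  closed_D : IsClosed D
  convex_D : Convex ℝ D
  support_Xs : (μ.map Xs).support ⊆ D
  support_X : ∀ᶠ τ in 𝓝[>] (0 : ℝ), (μ.map (mismeasured Xs ξ τ)).support ⊆ D
  smooth_ρ : ∃ C, BoundedDerivsOn m D C ρ
  smooth_f : ∃ C, ∀ z, μ (Z ⁻¹' {z}) ≠ 0 → BoundedDerivsOn m Set.univ C (f z)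
  smooth_g : ∃ C, ∀ u, BoundedDerivsOn m D C (g u)
  /-- `∫ |u|^m sup_{x ∈ D} |∂_x^l f_{ξ|X*}(u|x)| du < ∞`. -/
  dominance : ∀ l ≤ m, Integrable
    (fun u : ℝ => |u| ^ m * ⨆ x : D, |iteratedDerivWithin l (g u) D (x : ℝ)|) volume

/-- The score `h'(x) / h(x)` of a density `h`. -/
def score (h : ℝ → ℝ) (x : ℝ) : ℝ := deriv h x / h x

/-- The skedastic function `v(x) = V[τ ξ | X* = x]`, for the conditional density `g` of `ξ`
given `X*`. -/
def skedastic (g : ℝ → ℝ → ℝ) (τ x : ℝ) : ℝ :=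
  ∫ u, (τ * u - ∫ t, (τ * t) * g t x) ^ 2 * g u x

/-- `fX z`, `qXZ z` and `qX` are versions of the conditional density of `X` given `Z = z`, of
`E[Y | X = ·, Z = z]` and of `E[Y | X = ·]`, continuous near `x` for the two values `z₁`, `z₂` of
`Z`. Densities and regressions are determined only up to null sets; the continuity selects their
values near `x`. -/
structure IsVersionNear {Ω 𝒵 : Type*} [MeasurableSpace Ω] [MeasurableSpace 𝒵]
    (μ : Measure Ω) [IsProbabilityMeasure μ] (Y X : Ω → ℝ) (Z : Ω → 𝒵) (z₁ z₂ : 𝒵) (x : ℝ)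
    (fX qXZ : 𝒵 → ℝ → ℝ) (qX : ℝ → ℝ) : Prop where
  density : ∀ z, μ (Z ⁻¹' {z}) ≠ 0 → IsCondDensity μ X Z z (fX z)
  measurable_qXZ : ∀ z, Measurable (qXZ z)
  measurable_qX : Measurable qX
  regression_XZ : μ[Y | sigmaOf (fun ω => (X ω, Z ω))] =ᵐ[μ] fun ω => qXZ (Z ω) (X ω)
  regression_X : μ[Y | sigmaOf X] =ᵐ[μ] fun ω => qX (X ω)
  continuous_fX : ∀ z, z = z₁ ∨ z = z₂ → ∀ᶠ y in 𝓝 x, ContinuousAt (fX z) y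
  continuous_qXZ : ∀ z, z = z₁ ∨ z = z₂ → ∀ᶠ y in 𝓝 x, ContinuousAt (qXZ z) y
  continuous_qX : ∀ᶠ y in 𝓝 x, ContinuousAt qX y

/-- The denominator `q'(x) [s_{X|Z}(x|z₁) - s_{X|Z}(x|z₂)]`. -/
def relevance {𝒵 : Type*} (fX : 𝒵 → ℝ → ℝ) (qX : ℝ → ℝ) (z₁ z₂ : 𝒵) (x : ℝ) : ℝ :=
  deriv qX x * (score (fX z₁) x - score (fX z₂) x)

/-- `ṽ(x)`. -/
def vTilde {𝒵 : Type*} (fX qXZ : 𝒵 → ℝ → ℝ) (qX : ℝ → ℝ) (z₁ z₂ : 𝒵) (x : ℝ) : ℝ :=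
  (qXZ z₁ x - qXZ z₂ x) / relevance fX qX z₁ z₂ x

/-- `ρ̃(x, z)`. -/
def rhoTilde {𝒵 : Type*} (fX qXZ : 𝒵 → ℝ → ℝ) (qX : ℝ → ℝ) (z₁ z₂ : 𝒵) (x : ℝ) (z : 𝒵) : ℝ :=
  qXZ z x
    - vTilde fX qXZ qX z₁ z₂ x * (deriv qX x * score (fX z) x + 1 / 2 * iteratedDeriv 2 qX x)
    - deriv qX x * deriv (vTilde fX qXZ qX z₁ z₂) x

end SmallME

end

/-! Write f for the density of X* given Z = z and g(u|y) for that of ξ given X* = y. Then (ξ, X)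
given Z = z has density f(y - τu) g(u|y - τu), so f_{X|Z} and q(·,z) f_{X|Z} are the integrals over
u of f g and ρ f g at (u, y - τu). In the Taylor expansion of such integrals, each power of τ brings
one more power of u and one more derivative in y (`smearMoment_expansion`). E[ξ|X*] = 0 removes the
first moments at τ = 0, and E[ξ³|X*] = 0 removes the third ones when p = 4. Formally, with v = τ²σ²
and σ² = E[ξ²|X*], q(x,z) = ρ + v (ρ' s + ρ''/2) + v' ρ' + O(τ^p) (`near_regression`), where s is
the score of f, while q', q'' and s_{X|Z} equal ρ', ρ'' and s up to O(τ^(p-2)) (`near_quotient`,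
`near_smearMoment_zero`). Subtracting two values of z isolates v ρ' (s₁ - s₂), which gives ṽ; then
ρ̃ undoes the expansion, its correction terms being of size τ².

The delicate term is ṽ'. One derivative of ρ is spent on it, so with m = p the remainder of
∂q(x,z)/∂x is only O(τ^(p-1)). Up to O(τ^p) its bad part is f(x|z) times a factor free of z, so
after division by the density it cancels between z₁ and z₂ (`abs_integral_derivRem_sub_le`,
`near_regression_deriv`).

Two further points carry the proof. First, ρ and g are smooth only on D, but f and its derivatives
vanish off D, so the products are smooth on the whole line (`DensityTower.mul`). Second, a shear of
the plane identifies the laws of the observables with the integrals above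
(`ErrorLaw.setIntegral_eq`), and continuity turns almost everywhere equality into equality near x
(`WCMEModel.eventuallyEq_of_isVersionNear`). -/

noncomputable section

/-! ### Towers of derivatives: Taylor bounds and products that vanish off `D`. -/

namespace SmallME

/-- `a 0, a 1, …, a m` are successive derivatives on `D`, all bounded by `C` there. -/
structure DerivTower (m : ℕ) (D : Set ℝ) (C : ℝ) (a : ℕ → ℝ → ℝ) : Prop where
  hasDeriv : ∀ k < m, ∀ y ∈ D, HasDerivWithinAt (a k) (a (k + 1) y) D y
  bound : ∀ k ≤ m, ∀ y ∈ D, |a k y| ≤ C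

theorem BoundedDerivsOn.tower {m : ℕ} {D : Set ℝ} {C : ℝ} {h : ℝ → ℝ}
    (H : BoundedDerivsOn m D C h) : DerivTower m D C (fun k => iteratedDerivWithin k h D) where
  hasDeriv k hk y hy := by
    rw [iteratedDerivWithin_succ]
    exact (H.1 k hk y hy).hasDerivWithinAt
  bound := H.2

theorem DerivTower.shift {m : ℕ} {D : Set ℝ} {C : ℝ} {a : ℕ → ℝ → ℝ}
    (H : DerivTower (m + 1) D C a) : DerivTower m D C (fun k => a (k + 1)) where
  hasDeriv k hk y hy := H.hasDeriv (k + 1) (by omega) y hy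
  bound k hk y hy := H.bound (k + 1) (by omega) y hy

theorem DerivTower.mono {m n : ℕ} {D : Set ℝ} {C : ℝ} {a : ℕ → ℝ → ℝ}
    (H : DerivTower m D C a) (h : n ≤ m) : DerivTower n D C a where
  hasDeriv k hk y hy := H.hasDeriv k (by omega) y hy
  bound k hk y hy := H.bound k (by omega) y hy

theorem DerivTower.drop {m n j : ℕ} {D : Set ℝ} {C : ℝ} {a : ℕ → ℝ → ℝ}
    (H : DerivTower m D C a) (h : j + n ≤ m) : DerivTower n D C (fun k => a (j + k)) where
  hasDeriv k hk y hy := H.hasDeriv (j + k) (by omega) y hy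
  bound k hk y hy := H.bound (j + k) (by omega) y hy

theorem DerivTower.hasDerivAt {m : ℕ} {C : ℝ} {a : ℕ → ℝ → ℝ}
    (H : DerivTower m Set.univ C a) {k : ℕ} (hk : k < m) (y : ℝ) :
    HasDerivAt (a k) (a (k + 1) y) y :=
  hasDerivWithinAt_univ.1 (H.hasDeriv k hk y (Set.mem_univ _))

theorem DerivTower.continuousOn {m : ℕ} {D : Set ℝ} {C : ℝ} {a : ℕ → ℝ → ℝ}
    (H : DerivTower m D C a) {k : ℕ} (hk : k < m) : ContinuousOn (a k) D :=
  fun y hy => (H.hasDeriv k hk y hy).continuousWithinAt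

/-- The derivative of the remainder of a Taylor expansion is the remainder of the derivative. -/
theorem hasDerivAt_taylorSum (n : ℕ) (c : ℕ → ℝ) (x y : ℝ) :
    HasDerivAt (fun y => ∑ i ∈ Finset.range (n + 1), (y - x) ^ i / (i.factorial : ℝ) * c i)
      (∑ i ∈ Finset.range n, (y - x) ^ i / (i.factorial : ℝ) * c (i + 1)) y := by
  induction n with
  | zero => simpa using hasDerivAt_const y (c 0)
  | succ n ih =>
    simp_rw [Finset.sum_range_succ _ (n + 1)]
    rw [Finset.sum_range_succ _ n]
    refine ih.add ?_
    have h : HasDerivAt (fun y : ℝ => (y - x) ^ (n + 1)) (((n + 1 : ℕ) : ℝ) * (y - x) ^ n) y := by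
      have h0 := (hasDerivAt_pow (n + 1) (y - x)).comp y ((hasDerivAt_id y).sub_const x)
      rw [mul_one] at h0
      exact h0
    have h2 := (h.div_const ((n + 1).factorial : ℝ)).mul_const (c (n + 1))
    refine h2.congr_deriv ?_
    have : ((n.factorial : ℕ) : ℝ) ≠ 0 := by positivity
    rw [Nat.factorial_succ]
    push_cast
    have h3 : (n : ℝ) + 1 ≠ 0 := by positivity
    field_simp

/-- Induction on the order: the remainder has as derivative the remainder of the shifted tower, and
the mean value inequality on the segment from `x` to `y` supplies one more factor `|y - x|`. The
constant `C`, without the factorial, is enough for rates. -/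
theorem DerivTower.taylor {D : Set ℝ} (hD : Convex ℝ D) {n : ℕ} {C : ℝ} {a : ℕ → ℝ → ℝ}
    (H : DerivTower n D C a) {x y : ℝ} (hx : x ∈ D) (hy : y ∈ D) :
    |a 0 y - ∑ i ∈ Finset.range n, (y - x) ^ i / (i.factorial : ℝ) * a i x| ≤ C * |y - x| ^ n := by
  induction n generalizing a y with
  | zero => simpa using H.bound 0 le_rfl y hy
  | succ n ih =>
    have hC : 0 ≤ C := (abs_nonneg _).trans (H.bound 0 (Nat.zero_le _) x hx)
    set R : ℝ → ℝ := fun y =>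
      a 0 y - ∑ i ∈ Finset.range (n + 1), (y - x) ^ i / (i.factorial : ℝ) * a i x with hR
    have hseg : segment ℝ x y ⊆ D := hD.segment_subset hx hy
    have h1 : ∀ z ∈ segment ℝ x y, HasDerivWithinAt R
        (a 1 z - ∑ i ∈ Finset.range n, (z - x) ^ i / (i.factorial : ℝ) * a (i + 1) x)
        (segment ℝ x y) z := fun z hz =>
      ((H.hasDeriv 0 (by omega) z (hseg hz)).mono hseg).sub
        (hasDerivAt_taylorSum n (fun i => a i x) x z).hasDerivWithinAt
    have h2 : ∀ z ∈ segment ℝ x y,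
        ‖a 1 z - ∑ i ∈ Finset.range n, (z - x) ^ i / (i.factorial : ℝ) * a (i + 1) x‖
          ≤ C * |y - x| ^ n := by
      intro z hz
      refine (ih H.shift (hseg hz)).trans ?_
      have : |z - x| ≤ |y - x| := by
        rw [segment_eq_uIcc] at hz
        exact Set.abs_sub_left_of_mem_uIcc hz
      gcongr
    have h3 := (convex_segment x y).norm_image_sub_le_of_norm_hasDerivWithin_le h1 h2
      (left_mem_segment ℝ x y) (right_mem_segment ℝ x y)
    have h4 : R x = 0 := by
      simp only [hR]
      rw [Finset.sum_range_succ']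
      simp
    rw [h4, sub_zero] at h3
    rw [pow_succ, ← mul_assoc]
    exact h3

/-- The tower of derivatives of a product. -/
def mulTower : ℕ → (ℕ → ℝ → ℝ) → (ℕ → ℝ → ℝ) → ℝ → ℝ
  | 0, a, b => fun y => a 0 y * b 0 y
  | k + 1, a, b => fun y =>
      mulTower k (fun i => a (i + 1)) b y + mulTower k a (fun i => b (i + 1)) y

/-- The product rule is assumed for each pair of factors, instead of differentiability of the
factors: on the frontier of `D` the product is differentiable although the second factor need not
be. -/
theorem mulTower_hasDerivAt {k : ℕ} {a b : ℕ → ℝ → ℝ} {y : ℝ}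
    (H : ∀ i j, i + j ≤ k → HasDerivAt (fun y => a i y * b j y)
      (a (i + 1) y * b j y + a i y * b (j + 1) y) y) :
    HasDerivAt (mulTower k a b) (mulTower (k + 1) a b y) y := by
  induction k generalizing a b with
  | zero => exact H 0 0 le_rfl
  | succ k ih =>
    exact (ih fun i j hij => H (i + 1) j (by omega)).add (ih fun i j hij => H i (j + 1) (by omega))

theorem abs_mulTower_le {k : ℕ} {a b : ℕ → ℝ → ℝ} {y A B : ℝ}
    (ha : ∀ i ≤ k, |a i y| ≤ A) (hb : ∀ i ≤ k, |b i y| ≤ B) :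
    |mulTower k a b y| ≤ 2 ^ k * (A * B) := by
  induction k generalizing a b with
  | zero =>
    simp only [mulTower, abs_mul, pow_zero, one_mul]
    have hA := (abs_nonneg _).trans (ha 0 le_rfl)
    exact mul_le_mul (ha 0 le_rfl) (hb 0 le_rfl) (abs_nonneg _) hA
  | succ k ih =>
    have h1 := ih (a := fun i => a (i + 1)) (b := b) (fun i hi => ha _ (by omega))
      (fun i hi => hb _ (by omega))
    have h2 := ih (a := a) (b := fun i => b (i + 1)) (fun i hi => ha _ (by omega))
      (fun i hi => hb _ (by omega))
    calc _ ≤ _ := abs_add_le _ _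
      _ ≤ 2 ^ k * (A * B) + 2 ^ k * (A * B) := add_le_add h1 h2
      _ = _ := by ring

theorem mulTower_eq_zero {k : ℕ} {a b : ℕ → ℝ → ℝ} {y : ℝ} (ha : ∀ i ≤ k, a i y = 0) :
    mulTower k a b y = 0 := by
  induction k generalizing a b with
  | zero => simp [mulTower, ha 0 le_rfl]
  | succ k ih =>
    simp only [mulTower]
    rw [ih fun i hi => ha _ (by omega), ih fun i hi => ha _ (by omega), add_zero]

/-- A bounded tower of derivatives on `ℝ` whose members vanish off `D`. -/
structure DensityTower (m : ℕ) (D : Set ℝ) (C : ℝ) (a : ℕ → ℝ → ℝ) : Prop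
    extends DerivTower m Set.univ C a where
  eq_zero : ∀ k ≤ m, ∀ y ∉ D, a k y = 0

theorem accPt_compl_of_mem_frontier {D : Set ℝ} {b : ℝ} (hb : b ∈ frontier D)
    (hbD : b ∈ D) : AccPt b (𝓟 Dᶜ) := by
  have h : b ∈ closure Dᶜ := by
    rw [← frontier_compl] at hb
    exact frontier_subset_closure hb
  rw [accPt_iff_frequently]
  refine (mem_closure_iff_frequently.1 h).mono fun y hy => ⟨?_, hy⟩
  rintro rfl
  exact hy hbD

theorem eqOn_zero_tower_of_isOpen {m : ℕ} {U : Set ℝ} (hU : IsOpen U) {C : ℝ} {a : ℕ → ℝ → ℝ}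
    (H : DerivTower m Set.univ C a) (h0 : ∀ y ∈ U, a 0 y = 0) :
    ∀ k ≤ m, ∀ y ∈ U, a k y = 0 := by
  intro k
  induction k with
  | zero => exact fun _ => h0
  | succ k ih =>
    intro hk y hy
    have h1 := H.hasDerivAt (show k < m by omega) y
    have h2 : a k =ᶠ[𝓝 y] fun _ => 0 := by
      filter_upwards [hU.mem_nhds hy] with z hz using ih (by omega) z hz
    exact h1.unique ((hasDerivAt_const y (0 : ℝ)).congr_of_eventuallyEq h2)

theorem DerivTower.densityTower {m : ℕ} {D : Set ℝ} (hD : IsClosed D) {C : ℝ} {a : ℕ → ℝ → ℝ}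
    (H : DerivTower m Set.univ C a) (h0 : ∀ y ∉ D, a 0 y = 0) : DensityTower m D C a :=
  ⟨H, fun k hk y hy => eqOn_zero_tower_of_isOpen hD.isOpen_compl H h0 k hk y hy⟩

/-- The first equality is continuity. The second differentiates along `Dᶜ`, which accumulates at
`b`; continuity would not reach `a m`, the top of the tower. -/
theorem DensityTower.eq_zero_frontier {m : ℕ} {D : Set ℝ} {C : ℝ} {a : ℕ → ℝ → ℝ}
    (H : DensityTower m D C a) {b : ℝ} (hb : b ∈ frontier D) (hbD : b ∈ D) {k : ℕ} (hk : k < m) :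
    a k b = 0 ∧ a (k + 1) b = 0 := by
  have hacc := accPt_compl_of_mem_frontier hb hbD
  have hder := H.hasDerivAt hk b
  have h0 : a k b = 0 := by
    have hc : b ∈ closure Dᶜ := by
      rw [← frontier_compl] at hb
      exact frontier_subset_closure hb
    have : Dᶜ ⊆ {y | a k y = 0} := fun y hy => H.eq_zero k hk.le y hy
    have hcont : Continuous (a k) :=
      continuous_iff_continuousAt.2 fun y => (H.hasDerivAt hk y).continuousAt
    exact closure_minimal this (isClosed_eq hcont continuous_const) hc
  refine ⟨h0, ?_⟩
  have hu : UniqueDiffWithinAt ℝ Dᶜ b := uniqueDiffWithinAt_iff_accPt.2 hacc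
  have h1 : HasDerivWithinAt (a k) (a (k + 1) b) Dᶜ b := hder.hasDerivWithinAt
  have h2 : HasDerivWithinAt (a k) 0 Dᶜ b :=
    (hasDerivWithinAt_const b Dᶜ (0 : ℝ)).congr (fun y hy => H.eq_zero k hk.le y hy) h0
  exact hu.eq_deriv _ h1 h2

/-- At a frontier point `a i` and its derivative vanish, so `a i z` is `o(z - y)`; boundedness of `b
j` on `D` then gives the product derivative zero. In the interior this is the usual product rule,
and off `D` the product is locally zero. -/
theorem DensityTower.hasDerivAt_mul {m : ℕ} {D : Set ℝ} (hD : IsClosed D) {A B : ℝ}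
    {a b : ℕ → ℝ → ℝ} (Ha : DensityTower m D A a) (Hb : DerivTower m D B b) {i j : ℕ}
    (hi : i < m) (hj : j < m) (y : ℝ) :
    HasDerivAt (fun y => a i y * b j y) (a (i + 1) y * b j y + a i y * b (j + 1) y) y := by
  by_cases hyD : y ∈ D
  · by_cases hyf : y ∈ frontier D
    · obtain ⟨h0, h1⟩ := Ha.eq_zero_frontier hyf hyD hi
      have hd := Ha.hasDerivAt hi y
      rw [h1, hasDerivAt_iff_isLittleO] at hd
      rw [h0, h1, zero_mul, zero_mul, add_zero, hasDerivAt_iff_isLittleO]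
      simp only [h0, sub_zero, smul_zero, zero_mul] at hd ⊢
      have hB : 0 ≤ B := (abs_nonneg _).trans (Hb.bound j hj.le y hyD)
      refine IsBigO.trans_isLittleO ?_ hd
      refine IsBigO.of_bound B (Eventually.of_forall fun z => ?_)
      by_cases hz : z ∈ D
      · rw [norm_mul, mul_comm B]
        exact mul_le_mul_of_nonneg_left (Hb.bound j hj.le z hz) (norm_nonneg _)
      · rw [Ha.eq_zero i hi.le z hz]
        simp
    · have hint : D ∈ 𝓝 y := by
        rw [mem_interior_iff_mem_nhds.symm]
        by_contra h
        exact hyf ⟨subset_closure hyD, h⟩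
      exact (Ha.hasDerivAt hi y).mul ((Hb.hasDeriv j hj y hyD).hasDerivAt hint)
  · have h2 : (fun y => a i y * b j y) =ᶠ[𝓝 y] fun _ => 0 := by
      filter_upwards [hD.isOpen_compl.mem_nhds hyD] with z hz
      rw [Ha.eq_zero i hi.le z hz, zero_mul]
    rw [Ha.eq_zero i hi.le y hyD, Ha.eq_zero (i + 1) hi y hyD, zero_mul, zero_mul, add_zero]
    exact (hasDerivAt_const y (0 : ℝ)).congr_of_eventuallyEq h2

/-- Through this, functions smooth only on `D` (`ρ` and the error density) enter as smooth functions
on the line once multiplied by a density. -/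
theorem DensityTower.mul {m : ℕ} {D : Set ℝ} (hD : IsClosed D) {A B : ℝ}
    {a b : ℕ → ℝ → ℝ} (Ha : DensityTower m D A a) (Hb : DerivTower m D B b) (hA : 0 ≤ A)
    (hB : 0 ≤ B) :
    DensityTower m D (2 ^ m * (A * B)) (fun k => mulTower k a b) := by
  have hz : ∀ k ≤ m, ∀ y ∉ D, mulTower k a b y = 0 := fun k hk y hy =>
    mulTower_eq_zero fun i hi => Ha.eq_zero i (hi.trans hk) y hy
  refine ⟨⟨fun k hk y _ => ?_, fun k hk y _ => ?_⟩, hz⟩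
  · have h : ∀ i j, i + j ≤ k → HasDerivAt (fun y => a i y * b j y)
        (a (i + 1) y * b j y + a i y * b (j + 1) y) y := fun i j hij =>
      Ha.hasDerivAt_mul hD Hb (by omega) (by omega) y
    exact (mulTower_hasDerivAt h).hasDerivWithinAt
  · by_cases hy : y ∈ D
    · refine (abs_mulTower_le (fun i hi => Ha.bound i (hi.trans hk) y (Set.mem_univ _))
        (fun i hi => Hb.bound i (hi.trans hk) y hy)).trans ?_
      have : (2 : ℝ) ^ k ≤ 2 ^ m := pow_le_pow_right₀ (by norm_num) hk
      gcongr
    · rw [hz k hk y hy, abs_zero]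
      positivity

end SmallME
end

/-! ### Smeared moments and their expansion in `τ`. -/

noncomputable section

namespace SmallME

/-- A family of bounded towers on `D`, with envelope `G` having `m` absolute moments. -/
structure KernelTower (m : ℕ) (D : Set ℝ) (γ : ℕ → ℝ → ℝ → ℝ) (G : ℝ → ℝ) : Prop where
  tower : ∀ u, DerivTower m D (G u) (fun j => γ j u)
  nonneg : ∀ u, 0 ≤ G u
  integrable : ∀ k ≤ m, Integrable (fun u => |u| ^ k * G u) volume
  measurable : Measurable (fun w : ℝ × ℝ => γ 0 w.1 w.2)

/-- The `j`-th derivative in `y` of `φ y * γ u y`. -/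
def smear (φ : ℕ → ℝ → ℝ) (γ : ℕ → ℝ → ℝ → ℝ) (j : ℕ) (u y : ℝ) : ℝ :=
  mulTower j φ (fun i => γ i u) y

/-- Moments of the smeared density and of its derivatives. -/
def smearMoment (φ : ℕ → ℝ → ℝ) (γ : ℕ → ℝ → ℝ → ℝ) (k j : ℕ) (τ y : ℝ) : ℝ :=
  ∫ u, u ^ k * smear φ γ j u (y - τ * u)

variable {m : ℕ} {D : Set ℝ} {γ : ℕ → ℝ → ℝ → ℝ} {G : ℝ → ℝ} {φ : ℕ → ℝ → ℝ} {C : ℝ}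

theorem DensityTower.smear (hD : IsClosed D) (hγ : KernelTower m D γ G)
    (hφ : DensityTower m D C φ) (hC : 0 ≤ C) (u : ℝ) :
    DensityTower m D (2 ^ m * (C * G u)) (fun j => smear φ γ j u) :=
  hφ.mul hD (hγ.tower u) hC (hγ.nonneg u)

theorem DensityTower.measurable (hφ : DensityTower m D C φ) (hm : 0 < m) : Measurable (φ 0) :=
  (continuous_iff_continuousAt.2 fun y => (hφ.hasDerivAt hm y).continuousAt).measurable

/-- Each further derivative is the pointwise limit of difference quotients with step `1 / (n + 1)`,
which preserves joint measurability. -/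
theorem measurable_smear (hD : IsClosed D) (hγ : KernelTower m D γ G)
    (hφ : DensityTower m D C φ) (hC : 0 ≤ C) (hm : 0 < m) {j : ℕ} (hj : j ≤ m) :
    Measurable (fun w : ℝ × ℝ => SmallME.smear φ γ j w.1 w.2) := by
  induction j with
  | zero =>
    exact ((hφ.measurable hm).comp measurable_snd).mul hγ.measurable
  | succ j ih =>
    have ih := ih (by omega)
    refine measurable_of_tendsto_metrizable (f := fun (n : ℕ) (w : ℝ × ℝ) =>
      ((n : ℝ) + 1) * (SmallME.smear φ γ j w.1 (w.2 + 1 / ((n : ℝ) + 1)) -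
        SmallME.smear φ γ j w.1 w.2)) (fun n => ?_) ?_
    · refine ((ih.comp (measurable_fst.prodMk (measurable_snd.add_const _))).sub ih).const_mul _
    · rw [tendsto_pi_nhds]
      intro w
      have hd := (hφ.smear hD hγ hC w.1).hasDerivAt (show j < m by omega) w.2
      rw [hasDerivAt_iff_tendsto_slope_zero] at hd
      have h1 : Tendsto (fun n : ℕ => 1 / ((n : ℝ) + 1)) atTop (𝓝[≠] 0) := by
        refine tendsto_nhdsWithin_iff.2 ⟨tendsto_one_div_add_atTop_nhds_zero_nat, ?_⟩
        refine Eventually.of_forall fun n => ?_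
        have : (0 : ℝ) < 1 / ((n : ℝ) + 1) := by positivity
        exact this.ne'
      refine (hd.comp h1).congr fun n => ?_
      simp

theorem integrable_smear (hD : IsClosed D) (hγ : KernelTower m D γ G)
    (hφ : DensityTower m D C φ) (hC : 0 ≤ C) (hm : 0 < m) {j k : ℕ} (hj : j ≤ m) (hk : k ≤ m)
    (τ y : ℝ) : Integrable (fun u => u ^ k * SmallME.smear φ γ j u (y - τ * u)) := by
  refine ((hγ.integrable k hk).const_mul (2 ^ m * C)).mono' ?_ ?_
  · have h := (measurable_smear hD hγ hφ hC hm hj).comp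
      (measurable_id.prodMk ((measurable_id.const_mul τ).const_sub y))
    exact ((measurable_id.pow_const k).mul h).aestronglyMeasurable
  · refine Eventually.of_forall fun u => ?_
    rw [norm_mul, norm_pow, Real.norm_eq_abs, Real.norm_eq_abs]
    have := (hφ.smear hD hγ hC u).bound j hj (y - τ * u) (Set.mem_univ _)
    calc _ ≤ |u| ^ k * (2 ^ m * (C * G u)) := by gcongr
      _ = _ := by ring

/-- Differentiation under the integral, dominated by `2 ^ m * C * (|u| ^ k * G u)` uniformly in the
base point. -/
theorem hasDerivAt_smearMoment (hD : IsClosed D) (hγ : KernelTower m D γ G)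
    (hφ : DensityTower m D C φ) (hC : 0 ≤ C) {j k : ℕ} (hj : j < m) (hk : k ≤ m)
    (τ y : ℝ) :
    HasDerivAt (smearMoment φ γ k j τ) (smearMoment φ γ k (j + 1) τ y) y := by
  have hm : 0 < m := by omega
  refine (hasDerivAt_integral_of_dominated_loc_of_deriv_le (𝕜 := ℝ) (E := ℝ) (μ := volume)
    (s := Set.univ) (F := fun z u => u ^ k * SmallME.smear φ γ j u (z - τ * u))
    (F' := fun z u => u ^ k * SmallME.smear φ γ (j + 1) u (z - τ * u)) (x₀ := y)
    (bound := fun u => 2 ^ m * C * (|u| ^ k * G u)) univ_mem ?_ ?_ ?_ ?_ ?_ ?_).2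
  · exact Eventually.of_forall fun z =>
      (integrable_smear hD hγ hφ hC hm hj.le hk τ z).aestronglyMeasurable
  · exact integrable_smear hD hγ hφ hC hm hj.le hk τ y
  · exact (integrable_smear hD hγ hφ hC hm hj hk τ y).aestronglyMeasurable
  · refine Eventually.of_forall fun u z _ => ?_
    rw [norm_mul, norm_pow, Real.norm_eq_abs, Real.norm_eq_abs]
    have := (hφ.smear hD hγ hC u).bound (j + 1) hj (z - τ * u) (Set.mem_univ _)
    calc _ ≤ |u| ^ k * (2 ^ m * (C * G u)) := by gcongr
      _ = _ := by ring
  · exact (hγ.integrable k hk).const_mul _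
  · refine Eventually.of_forall fun u z _ => ?_
    have h := (hφ.smear hD hγ hC u).hasDerivAt hj (z - τ * u)
    exact (h.comp_sub_const z (τ * u)).const_mul (u ^ k)

/-- Differentiating the identity 0 = 0 in `y`: moment conditions on the error, known for all `y`,
pass to the derivatives that appear in the expansions. -/
theorem smearMoment_eq_zero (hD : IsClosed D) (hγ : KernelTower m D γ G)
    (hφ : DensityTower m D C φ) (hC : 0 ≤ C) {j k : ℕ} (hj : j ≤ m) (hk : k ≤ m)
    (h0 : ∀ y, smearMoment φ γ k 0 0 y = 0) (y : ℝ) : smearMoment φ γ k j 0 y = 0 := by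
  induction j generalizing y with
  | zero => exact h0 y
  | succ j ih =>
    have h1 := hasDerivAt_smearMoment hD hγ hφ hC (show j < m by omega) hk 0 y
    have h2 : smearMoment φ γ k j 0 = fun _ => 0 := funext fun z => ih (by omega) z
    rw [h2] at h1
    exact h1.unique (hasDerivAt_const y (0 : ℝ))

theorem smearMoment_zero_eq (hD : IsClosed D) (hγ : KernelTower m D γ G)
    (hφ : DensityTower m D C φ) (hC : 0 ≤ C) {j : ℕ} (hj : j ≤ m)
    (h0 : ∀ y, smearMoment φ γ 0 0 0 y = φ 0 y) (y : ℝ) : smearMoment φ γ 0 j 0 y = φ j y := by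
  induction j generalizing y with
  | zero => exact h0 y
  | succ j ih =>
    have h1 := hasDerivAt_smearMoment hD hγ hφ hC (show j < m by omega) (Nat.zero_le m) 0 y
    have h2 : smearMoment φ γ 0 j 0 = φ j := funext fun z => ih (by omega) z
    rw [h2] at h1
    exact h1.unique (hφ.hasDerivAt (show j < m by omega) y)

theorem smear_taylor (hD : IsClosed D) (hγ : KernelTower m D γ G)
    (hφ : DensityTower m D C φ) (hC : 0 ≤ C) {j n : ℕ} (hjn : j + n ≤ m) (u x y : ℝ) :
    |SmallME.smear φ γ j u y -
        ∑ i ∈ Finset.range n, (y - x) ^ i / (i.factorial : ℝ) * SmallME.smear φ γ (j + i) u x|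
      ≤ 2 ^ m * C * G u * |y - x| ^ n := by
  have h := ((hφ.smear hD hγ hC u).toDerivTower.drop hjn).taylor convex_univ
    (Set.mem_univ x) (Set.mem_univ y)
  rw [← mul_assoc] at h
  exact h

/-- The shift `-τ * u` contributes `(-τ) ^ i * u ^ i` to the `i`-th Taylor term, so the moment order
and the derivative order rise together. -/
theorem smearMoment_expansion (hD : IsClosed D) (hγ : KernelTower m D γ G)
    (hφ : DensityTower m D C φ) (hC : 0 ≤ C) (hm : 0 < m) {j k n : ℕ} (hj : j + n ≤ m)
    (hk : k + n ≤ m) (x τ : ℝ) :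
    |smearMoment φ γ k j τ x -
        ∑ i ∈ Finset.range n, (-τ) ^ i / (i.factorial : ℝ) * smearMoment φ γ (k + i) (j + i) 0 x|
      ≤ (2 ^ m * C * ∫ u, |u| ^ (k + n) * G u) * |τ| ^ n := by
  have hi : ∀ i ∈ Finset.range n, Integrable (fun u => (-τ) ^ i / (i.factorial : ℝ) *
      (u ^ (k + i) * SmallME.smear φ γ (j + i) u (x - 0 * u))) := fun i hi => by
    have := Finset.mem_range.1 hi
    exact (integrable_smear hD hγ hφ hC hm (by omega) (by omega) 0 x).const_mul _
  have e : smearMoment φ γ k j τ x -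
        ∑ i ∈ Finset.range n, (-τ) ^ i / (i.factorial : ℝ) * smearMoment φ γ (k + i) (j + i) 0 x
      = ∫ u, (u ^ k * SmallME.smear φ γ j u (x - τ * u) -
        ∑ i ∈ Finset.range n, (-τ) ^ i / (i.factorial : ℝ) *
          (u ^ (k + i) * SmallME.smear φ γ (j + i) u (x - 0 * u))) := by
    rw [integral_sub (integrable_smear hD hγ hφ hC hm (by omega) (by omega) τ x)
      (integrable_finsetSum _ hi), integral_finsetSum _ hi]
    simp_rw [integral_const_mul]
    rfl
  rw [e, ← Real.norm_eq_abs]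
  have hb : (2 ^ m * C * ∫ u, |u| ^ (k + n) * G u) * |τ| ^ n =
      ∫ u, 2 ^ m * C * |τ| ^ n * (|u| ^ (k + n) * G u) := by
    rw [integral_const_mul]; ring
  rw [hb]
  refine norm_integral_le_of_norm_le ((hγ.integrable (k + n) hk).const_mul _)
    (Eventually.of_forall fun u => ?_)
  have h := smear_taylor hD hγ hφ hC hj u x (x - τ * u)
  have e2 : (u ^ k * SmallME.smear φ γ j u (x - τ * u) -
        ∑ i ∈ Finset.range n, (-τ) ^ i / (i.factorial : ℝ) *
          (u ^ (k + i) * SmallME.smear φ γ (j + i) u (x - 0 * u))) =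
      u ^ k * (SmallME.smear φ γ j u (x - τ * u) - ∑ i ∈ Finset.range n,
        (x - τ * u - x) ^ i / (i.factorial : ℝ) * SmallME.smear φ γ (j + i) u x) := by
    rw [mul_sub, Finset.mul_sum]
    congr 1
    refine Finset.sum_congr rfl fun i _ => ?_
    rw [show x - τ * u - x = (-τ) * u by ring, mul_pow, pow_add]
    ring_nf
  rw [e2, norm_mul, norm_pow, Real.norm_eq_abs, Real.norm_eq_abs]
  calc _ ≤ |u| ^ k * (2 ^ m * C * G u * |x - τ * u - x| ^ n) := by gcongr
    _ = _ := by
      rw [show x - τ * u - x = -(τ * u) by ring, abs_neg, abs_mul, mul_pow, pow_add]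
      ring

end SmallME
end

/-! ### Calculus of `O(τ ^ r)` approximations, and orders of the smeared moments. -/

noncomputable section

namespace SmallME

/-- `a τ = c + O(τ ^ r)` as `τ ↓ 0`. -/
def Near (r : ℕ) (a : ℝ → ℝ) (c : ℝ) : Prop :=
  (fun τ => a τ - c) =O[𝓝[>] (0 : ℝ)] fun τ => τ ^ r

namespace Near

variable {r : ℕ} {a b : ℝ → ℝ} {c d : ℝ}

theorem const (r : ℕ) (c : ℝ) : Near r (fun _ => c) c := by
  simp [Near, isBigO_zero]

theorem congr (h : Near r a c) (hab : ∀ᶠ τ in 𝓝[>] (0 : ℝ), a τ = b τ) : Near r b c := by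
  refine IsBigO.congr' h ?_ EventuallyEq.rfl
  filter_upwards [hab] with τ hτ using by rw [hτ]

theorem add (ha : Near r a c) (hb : Near r b d) : Near r (fun τ => a τ + b τ) (c + d) :=
  (IsBigO.add ha hb).congr_left fun τ => by ring

theorem sub (ha : Near r a c) (hb : Near r b d) : Near r (fun τ => a τ - b τ) (c - d) :=
  (IsBigO.sub ha hb).congr_left fun τ => by ring

theorem pow_isBigO_one (r : ℕ) :
    (fun τ : ℝ => τ ^ r) =O[𝓝[>] (0 : ℝ)] (fun _ => (1 : ℝ)) := by
  have : Tendsto (fun τ : ℝ => τ ^ r) (𝓝[>] 0) (𝓝 (0 ^ r)) :=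
    ((continuous_pow r).tendsto 0).mono_left nhdsWithin_le_nhds
  exact this.isBigO_one ℝ

theorem isBigO_one (ha : Near r a c) : a =O[𝓝[>] (0 : ℝ)] (fun _ => (1 : ℝ)) := by
  have h := (ha.trans (pow_isBigO_one r)).add (isBigO_refl (fun _ : ℝ => c) _ |>.trans
    (isBigO_const_const c one_ne_zero _))
  exact h.congr_left fun τ => by ring

theorem mul (ha : Near r a c) (hb : Near r b d) : Near r (fun τ => a τ * b τ) (c * d) := by
  have h1 : (fun τ => a τ * (b τ - d)) =O[𝓝[>] (0 : ℝ)] fun τ => τ ^ r := by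
    simpa using ha.isBigO_one.mul hb
  have h2 : (fun τ => d * (a τ - c)) =O[𝓝[>] (0 : ℝ)] fun τ => τ ^ r := ha.const_mul_left d
  exact (h1.add h2).congr_left fun τ => by ring

theorem const_mul (e : ℝ) (ha : Near r a c) : Near r (fun τ => e * a τ) (e * c) :=
  (const r e).mul ha

theorem tendsto (hr : r ≠ 0) (ha : Near r a c) : Tendsto a (𝓝[>] 0) (𝓝 c) := by
  have h : Tendsto (fun τ : ℝ => τ ^ r) (𝓝[>] 0) (𝓝 0) := by
    have := ((continuous_pow r).tendsto (0 : ℝ)).mono_left (nhdsWithin_le_nhds (s := Set.Ioi 0))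
    rwa [zero_pow hr] at this
  have := (IsBigO.trans_tendsto ha h).add_const c
  simpa using this

theorem inv (hr : r ≠ 0) (ha : Near r a c) (hc : c ≠ 0) : Near r (fun τ => (a τ)⁻¹) c⁻¹ := by
  have ht := ha.tendsto hr
  have h1 : (fun τ => (a τ)⁻¹) =O[𝓝[>] (0 : ℝ)] (fun _ => (1 : ℝ)) := (ht.inv₀ hc).isBigO_one ℝ
  -- The difference of the inverses is `a⁻¹ * (-c⁻¹ * (a - c))`, a bounded factor times `O(τ ^ r)`.
  have h2 : (fun τ => (a τ)⁻¹ * (-c⁻¹ * (a τ - c))) =O[𝓝[>] (0 : ℝ)] fun τ => τ ^ r := by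
    simpa using h1.mul (ha.const_mul_left (-c⁻¹))
  refine h2.congr' ?_ EventuallyEq.rfl
  filter_upwards [ht.eventually_ne hc] with τ hτ
  field_simp
  ring

theorem div (hr : r ≠ 0) (ha : Near r a c) (hb : Near r b d) (hd : d ≠ 0) :
    Near r (fun τ => a τ / b τ) (c / d) := by
  simpa only [div_eq_mul_inv] using ha.mul (hb.inv hr hd)

theorem of_abs_le {K : ℝ} (h : ∀ᶠ τ in 𝓝[>] (0 : ℝ), |a τ - c| ≤ K * |τ| ^ r) : Near r a c := by
  refine IsBigO.of_bound K ?_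
  filter_upwards [h] with τ hτ
  rwa [norm_pow, Real.norm_eq_abs, Real.norm_eq_abs]

theorem of_const_eq (h : Near r a c) (hcd : c = d) : Near r a d := hcd ▸ h

end Near

variable {m : ℕ} {D : Set ℝ} {γ : ℕ → ℝ → ℝ → ℝ} {G : ℝ → ℝ} {φ : ℕ → ℝ → ℝ} {C : ℝ}

/-- Conditions on the moments of the error, weighted by the density `φ 0`. -/
structure ErrorMoments (p : ℕ) (φ : ℕ → ℝ → ℝ) (γ : ℕ → ℝ → ℝ → ℝ) : Prop where
  order : p = 3 ∨ p = 4
  zeroth : ∀ y, smearMoment φ γ 0 0 0 y = φ 0 y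
  first : ∀ y, smearMoment φ γ 1 0 0 y = 0
  third : p = 4 → ∀ y, smearMoment φ γ 3 0 0 y = 0

section Expansions

variable {p : ℕ} (hD : IsClosed D) (hγ : KernelTower m D γ G)
    (hφ : DensityTower m D C φ) (hC : 0 ≤ C) (hpm : p ≤ m) (hmom : ErrorMoments p φ γ) (x : ℝ)

include hD hγ hφ hC hpm hmom

/-- The order `p - 2` suffices, since the corrections in the estimands carry a factor `τ ^ 2`. For
`p = 4` the term linear in `τ` is a derivative of the vanishing first moment. -/
theorem near_smearMoment_zero {j : ℕ} (hj : j ≤ 2) :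
    Near (p - 2) (fun τ => smearMoment φ γ 0 j τ x) (φ j x) := by
  have hp := hmom.order
  have h1 := fun τ => smearMoment_expansion hD hγ hφ hC (by omega) (show j + (p - 2) ≤ m by omega)
    (show 0 + (p - 2) ≤ m by omega) x τ
  refine Near.of_abs_le (Eventually.of_forall fun τ => ?_) (K := 2 ^ m * C * ∫ u, |u| ^ (0 + (p - 2)) * G u)
  refine le_of_eq_of_le ?_ (h1 τ)
  have h0 : smearMoment φ γ 0 j 0 x = φ j x :=
    smearMoment_zero_eq hD hγ hφ hC (by omega) hmom.zeroth x
  have h2 : smearMoment φ γ 1 (j + 1) 0 x = 0 :=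
    smearMoment_eq_zero hD hγ hφ hC (by omega) (by omega) hmom.first x
  rcases hp with rfl | rfl
  · simp [h0]
  · simp [h0, h2, Finset.sum_range_succ]

/-- The first moment vanishes at `τ = 0`, so the leading term is `-τ` times a derivative of the
second moment. For `p = 4` the next coefficient is a derivative of the third moment, which vanishes
too. -/
theorem near_smearMoment_one {j : ℕ} (hj : j ≤ 1) :
    Near (p - 2) (fun τ => smearMoment φ γ 1 j τ x / τ) (-smearMoment φ γ 2 (j + 1) 0 x) := by
  have hp := hmom.order
  have h1 := fun τ => smearMoment_expansion hD hγ hφ hC (by omega) (show j + (p - 1) ≤ m by omega)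
    (show 1 + (p - 1) ≤ m by omega) x τ
  have h2 : smearMoment φ γ 1 j 0 x = 0 :=
    smearMoment_eq_zero hD hγ hφ hC (by omega) (by omega) hmom.first x
  have key : ∀ τ, |smearMoment φ γ 1 j τ x - (-τ) * smearMoment φ γ 2 (j + 1) 0 x|
      ≤ (2 ^ m * C * ∫ u, |u| ^ (1 + (p - 1)) * G u) * |τ| ^ (p - 1) := by
    intro τ
    refine le_of_eq_of_le ?_ (h1 τ)
    rcases hp with rfl | rfl
    · simp [h2, Finset.sum_range_succ]
    · have h3 : smearMoment φ γ 3 (j + 2) 0 x = 0 :=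
        smearMoment_eq_zero hD hγ hφ hC (by omega) (by omega) (hmom.third rfl) x
      simp [h2, h3, Finset.sum_range_succ]
  refine Near.of_abs_le (K := 2 ^ m * C * ∫ u, |u| ^ (1 + (p - 1)) * G u) ?_
  filter_upwards [self_mem_nhdsWithin] with τ hτ
  have hτ : 0 < τ := hτ
  have e : smearMoment φ γ 1 j τ x / τ - -smearMoment φ γ 2 (j + 1) 0 x =
      (smearMoment φ γ 1 j τ x - (-τ) * smearMoment φ γ 2 (j + 1) 0 x) / τ := by
    field_simp
  rw [e, abs_div, abs_of_pos hτ, div_le_iff₀ hτ, mul_assoc, ← pow_succ]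
  have := key τ
  rw [abs_of_pos hτ] at this
  rwa [show p - 1 = p - 2 + 1 by omega] at this ⊢

theorem near_smearMoment_two {j : ℕ} (hj : j ≤ 1) :
    Near (p - 2) (fun τ => smearMoment φ γ 2 j τ x) (smearMoment φ γ 2 j 0 x) := by
  have hp := hmom.order
  have h1 := fun τ => smearMoment_expansion hD hγ hφ hC (by omega) (show j + (p - 2) ≤ m by omega)
    (show 2 + (p - 2) ≤ m by omega) x τ
  refine Near.of_abs_le (Eventually.of_forall fun τ => ?_) (K := 2 ^ m * C * ∫ u, |u| ^ (2 + (p - 2)) * G u)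
  refine le_of_eq_of_le ?_ (h1 τ)
  rcases hp with rfl | rfl
  · simp
  · have h3 : smearMoment φ γ 3 (j + 1) 0 x = 0 :=
      smearMoment_eq_zero hD hγ hφ hC (by omega) (by omega) (hmom.third rfl) x
    simp [h3, Finset.sum_range_succ]

/-- For `p = 3` boundedness of the third moment is enough; for `p = 4` it vanishes at `τ = 0` and is
therefore `O(τ)`. -/
theorem near_smearMoment_three {j : ℕ} (hj : j ≤ 1) :
    Near (p - 2) (fun τ => τ * smearMoment φ γ 3 j τ x) 0 := by
  have hp := hmom.order
  have h1 := fun τ => smearMoment_expansion hD hγ hφ hC (by omega) (show j + (p - 3) ≤ m by omega)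
    (show 3 + (p - 3) ≤ m by omega) x τ
  have key : ∀ τ, |smearMoment φ γ 3 j τ x|
      ≤ (2 ^ m * C * ∫ u, |u| ^ (3 + (p - 3)) * G u) * |τ| ^ (p - 3) := by
    intro τ
    refine le_of_eq_of_le ?_ (h1 τ)
    rcases hp with rfl | rfl
    · simp
    · have h3 : smearMoment φ γ 3 j 0 x = 0 :=
        smearMoment_eq_zero hD hγ hφ hC (by omega) (by omega) (hmom.third rfl) x
      simp [h3]
  refine Near.of_abs_le (Eventually.of_forall fun τ => ?_)
    (K := 2 ^ m * C * ∫ u, |u| ^ (3 + (p - 3)) * G u)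
  rw [sub_zero, abs_mul]
  calc _ ≤ |τ| * _ := mul_le_mul_of_nonneg_left (key τ) (abs_nonneg _)
    _ = _ := by
      rw [show p - 2 = (p - 3) + 1 by omega, pow_succ]
      ring

end Expansions

/-- The derivatives of `φ * ρ`. -/
abbrev regTower (φ r : ℕ → ℝ → ℝ) (k : ℕ) : ℝ → ℝ := mulTower k φ r

theorem smear_regTower_zero (φ r : ℕ → ℝ → ℝ) (γ : ℕ → ℝ → ℝ → ℝ) (u y : ℝ) :
    smear (regTower φ r) γ 0 u y = r 0 y * smear φ γ 0 u y := by
  simp only [smear, mulTower]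
  ring

theorem smear_regTower_one (φ r : ℕ → ℝ → ℝ) (γ : ℕ → ℝ → ℝ → ℝ) (u y : ℝ) :
    smear (regTower φ r) γ 1 u y = r 1 y * smear φ γ 0 u y + r 0 y * smear φ γ 1 u y := by
  simp only [smear, mulTower]
  ring

/-- At `τ = 0` the factor `r 0 y` does not depend on `u` and leaves the integral. -/
theorem ErrorMoments.regTower {p : ℕ} {r : ℕ → ℝ → ℝ} (h : ErrorMoments p φ γ) :
    ErrorMoments p (regTower φ r) γ := by
  have e : ∀ k y, smearMoment (SmallME.regTower φ r) γ k 0 0 y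
      = r 0 y * smearMoment φ γ k 0 0 y := by
    intro k y
    simp only [smearMoment]
    rw [← integral_const_mul]
    refine integral_congr_ae (Eventually.of_forall fun u => ?_)
    simp only [zero_mul, sub_zero, smear_regTower_zero]
    ring
  refine ⟨h.order, fun y => ?_, fun y => ?_, fun hp y => ?_⟩
  · rw [e, h.zeroth]; simp only [mulTower]; ring
  · rw [e, h.first, mul_zero]
  · rw [e, h.third hp, mul_zero]

/-- Keeping the cubic term also for `p = 3` gives one formula for both orders. For `p = 3` that term
is itself of the size of the error, whence the factor 2. -/
theorem DerivTower.cubic_remainder {p : ℕ} {r : ℕ → ℝ → ℝ} {B : ℝ} (hDc : Convex ℝ D)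
    (hr : DerivTower m D B r) (hp : p = 3 ∨ p = 4) (hpm : p ≤ m) {x y : ℝ} (hx : x ∈ D)
    (hy : y ∈ D) :
    |r 0 y - (r 0 x + (y - x) * r 1 x + (y - x) ^ 2 / 2 * r 2 x + (y - x) ^ 3 / 6 * r 3 x)|
      ≤ 2 * B * |y - x| ^ p := by
  have h1 := (hr.mono hpm).taylor hDc hx hy
  have hB : 0 ≤ B := (abs_nonneg _).trans (hr.bound 0 (Nat.zero_le _) x hx)
  rcases hp with rfl | rfl
  · have h2 := hr.bound 3 hpm x hx
    simp [Finset.sum_range_succ, Nat.factorial] at h1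
    have h3 : |(y - x) ^ 3 / 6 * r 3 x| ≤ B * |y - x| ^ 3 := by
      rw [abs_mul, abs_div, abs_pow, show |(6 : ℝ)| = 6 by norm_num, mul_comm B]
      refine mul_le_mul ?_ h2 (abs_nonneg _) (by positivity)
      exact div_le_self (by positivity) (by norm_num)
    have h4 := abs_sub (r 0 y - (r 0 x + (y - x) * r 1 x + (y - x) ^ 2 / 2 * r 2 x))
      ((y - x) ^ 3 / 6 * r 3 x)
    rw [show 2 * B * |y - x| ^ 3 = B * |y - x| ^ 3 + B * |y - x| ^ 3 by ring]
    refine le_trans (le_of_eq ?_) (h4.trans (add_le_add h1 h3))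
    congr 1
    ring
  · simp [Finset.sum_range_succ, Nat.factorial] at h1
    refine h1.trans ?_
    have : 0 ≤ B * |y - x| ^ 4 := by positivity
    linarith

theorem DerivTower.quadratic_remainder {p : ℕ} {r : ℕ → ℝ → ℝ} {B : ℝ} (hDc : Convex ℝ D)
    (hr : DerivTower m D B r) (hp : p = 3 ∨ p = 4) (hpm : p ≤ m) {x y : ℝ} (hx : x ∈ D)
    (hy : y ∈ D) :
    |r 1 y - (r 1 x + (y - x) * r 2 x + (y - x) ^ 2 / 2 * r 3 x)| ≤ 2 * B * |y - x| ^ (p - 1) := by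
  have h1 := (hr.drop (n := p - 1) (j := 1) (by omega)).taylor hDc hx hy
  have hB : 0 ≤ B := (abs_nonneg _).trans (hr.bound 0 (Nat.zero_le _) x hx)
  rcases hp with rfl | rfl
  · have h2 := hr.bound 3 hpm x hx
    simp [Finset.sum_range_succ] at h1
    have h3 : |(y - x) ^ 2 / 2 * r 3 x| ≤ B * |y - x| ^ 2 := by
      rw [abs_mul, abs_div, abs_pow, show |(2 : ℝ)| = 2 by norm_num, mul_comm B]
      refine mul_le_mul ?_ h2 (abs_nonneg _) (by positivity)
      exact div_le_self (by positivity) (by norm_num)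
    have h4 := abs_sub (r 1 y - (r 1 x + (y - x) * r 2 x))
      ((y - x) ^ 2 / 2 * r 3 x)
    rw [show 2 * B * |y - x| ^ (3 - 1) = B * |y - x| ^ 2 + B * |y - x| ^ 2 by norm_num; ring]
    rw [sq_abs] at h3 ⊢
    refine le_trans (le_of_eq ?_) (h4.trans (add_le_add h1 h3))
    congr 1
    ring
  · simp [Finset.sum_range_succ] at h1
    refine h1.trans ?_
    have : 0 ≤ B * |y - x| ^ 3 := by positivity
    norm_num
    linarith

end SmallME
end

/-! ### Remainders of the weighted regression and of its derivative. -/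

noncomputable section

namespace SmallME

variable {m : ℕ} {D : Set ℝ} {γ : ℕ → ℝ → ℝ → ℝ} {G : ℝ → ℝ} {φ ψ : ℕ → ℝ → ℝ} {C C' : ℝ}

theorem KernelTower.abs_integral_le (hγ : KernelTower m D γ G) {w : ℝ → ℝ} {K : ℝ} {k : ℕ}
    (hk : k ≤ m) (h : ∀ u, |w u| ≤ K * (|u| ^ k * G u)) :
    |∫ u, w u| ≤ K * ∫ u, |u| ^ k * G u := by
  rw [← integral_const_mul, ← Real.norm_eq_abs]
  exact norm_integral_le_of_norm_le ((hγ.integrable k hk).const_mul K)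
    (Eventually.of_forall fun u => h u)

/-- The integrand of the remainder in the expansion of the weighted regression. -/
def regRem (φ r : ℕ → ℝ → ℝ) (γ : ℕ → ℝ → ℝ → ℝ) (x τ u : ℝ) : ℝ :=
  smear (regTower φ r) γ 0 u (x - τ * u) - r 0 x * smear φ γ 0 u (x - τ * u)
    - (-τ * r 1 x * (u * smear φ γ 0 u (x - τ * u))
      + τ ^ 2 / 2 * r 2 x * (u ^ 2 * smear φ γ 0 u (x - τ * u))
      - τ ^ 3 / 6 * r 3 x * (u ^ 3 * smear φ γ 0 u (x - τ * u)))

/-- The integrand of the remainder in the expansion of the derivative of the weighted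
regression. -/
def derivRem (φ r : ℕ → ℝ → ℝ) (γ : ℕ → ℝ → ℝ → ℝ) (x τ u : ℝ) : ℝ :=
  smear (regTower φ r) γ 1 u (x - τ * u) - r 1 x * smear φ γ 0 u (x - τ * u)
    - r 0 x * smear φ γ 1 u (x - τ * u)
    - (-τ * r 2 x * (u * smear φ γ 0 u (x - τ * u)) - τ * r 1 x * (u * smear φ γ 1 u (x - τ * u))
      + τ ^ 2 / 2 * r 3 x * (u ^ 2 * smear φ γ 0 u (x - τ * u))
      + τ ^ 2 / 2 * r 2 x * (u ^ 2 * smear φ γ 1 u (x - τ * u))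
      - τ ^ 3 / 6 * r 3 x * (u ^ 3 * smear φ γ 1 u (x - τ * u)))

section

variable {p : ℕ} {r : ℕ → ℝ → ℝ} {B : ℝ} (hD : IsClosed D) (hDc : Convex ℝ D)
  (hγ : KernelTower m D γ G) (hφ : DensityTower m D C φ) (hC : 0 ≤ C)
  (hr : DerivTower m D B r) (hB : 0 ≤ B) (hp : p = 3 ∨ p = 4) (hpm : p ≤ m) {x : ℝ} (hx : x ∈ D)

include hD hγ hφ hC hr hB hp hpm

theorem integral_regRem (x τ : ℝ) :
    ∫ u, regRem φ r γ x τ u =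
      smearMoment (regTower φ r) γ 0 0 τ x - r 0 x * smearMoment φ γ 0 0 τ x
        - (-τ * r 1 x * smearMoment φ γ 1 0 τ x + τ ^ 2 / 2 * r 2 x * smearMoment φ γ 2 0 τ x
          - τ ^ 3 / 6 * r 3 x * smearMoment φ γ 3 0 τ x) := by
  have hφr := hφ.mul hD hr hC hB
  have hC' : 0 ≤ 2 ^ m * (C * B) := by positivity
  have i0 := integrable_smear hD hγ hφr hC' (show 0 < m by omega) (show 0 ≤ m by omega)
    (show 0 ≤ m by omega) τ x
  have i := fun k (hk : k ≤ 3) => integrable_smear hD hγ hφ hC (show 0 < m by omega)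
    (show 0 ≤ m by omega) (show k ≤ m by omega) τ x
  simp only [pow_zero, one_mul] at i0
  have j0 := i 0 (by norm_num)
  have j1 := i 1 (by norm_num)
  have j2 := i 2 (by norm_num)
  have j3 := i 3 (by norm_num)
  simp only [pow_zero, one_mul, pow_one] at j0 j1
  simp only [regRem, smearMoment, pow_zero, one_mul, pow_one]
  have k1 := j1.const_mul (-τ * r 1 x)
  have k2 := k1.add (j2.const_mul (τ ^ 2 / 2 * r 2 x))
  have k3 := j3.const_mul (τ ^ 3 / 6 * r 3 x)
  have k4 := j0.const_mul (r 0 x)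
  refine (integral_sub (i0.sub k4) (k2.sub k3)).trans ?_
  refine congrArg₂ (· - ·) ((integral_sub i0 k4).trans (congrArg₂ (· - ·) rfl ?_))
    ((integral_sub k2 k3).trans (congrArg₂ (· - ·) ((integral_add k1
      (j2.const_mul _)).trans (congrArg₂ (· + ·) ?_ ?_)) ?_))
  all_goals simp only [integral_const_mul]

theorem integral_derivRem (x τ : ℝ) : Integrable (derivRem φ r γ x τ) ∧
    ∫ u, derivRem φ r γ x τ u =
      smearMoment (regTower φ r) γ 0 1 τ x - r 1 x * smearMoment φ γ 0 0 τ x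
        - r 0 x * smearMoment φ γ 0 1 τ x
        - (-τ * r 2 x * smearMoment φ γ 1 0 τ x - τ * r 1 x * smearMoment φ γ 1 1 τ x
          + τ ^ 2 / 2 * r 3 x * smearMoment φ γ 2 0 τ x
          + τ ^ 2 / 2 * r 2 x * smearMoment φ γ 2 1 τ x
          - τ ^ 3 / 6 * r 3 x * smearMoment φ γ 3 1 τ x) := by
  have hφr := hφ.mul hD hr hC hB
  have hC' : 0 ≤ 2 ^ m * (C * B) := by positivity
  have i0 := integrable_smear hD hγ hφr hC' (show 0 < m by omega) (show 1 ≤ m by omega)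
    (show 0 ≤ m by omega) τ x
  have i := fun j k (hj : j ≤ 1) (hk : k ≤ 3) => integrable_smear hD hγ hφ hC
    (show 0 < m by omega) (show j ≤ m by omega) (show k ≤ m by omega) τ x
  simp only [pow_zero, one_mul] at i0
  have j0 := i 0 0 (by norm_num) (by norm_num)
  have j01 := i 1 0 (by norm_num) (by norm_num)
  have j10 := i 0 1 (by norm_num) (by norm_num)
  have j11 := i 1 1 (by norm_num) (by norm_num)
  have j20 := i 0 2 (by norm_num) (by norm_num)
  have j21 := i 1 2 (by norm_num) (by norm_num)
  have j31 := i 1 3 (by norm_num) (by norm_num)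
  simp only [pow_zero, one_mul, pow_one] at j0 j01 j10 j11
  have k1 := (j10.const_mul (-τ * r 2 x)).sub (j11.const_mul (τ * r 1 x))
  have k2 := k1.add (j20.const_mul (τ ^ 2 / 2 * r 3 x))
  have k3 := k2.add (j21.const_mul (τ ^ 2 / 2 * r 2 x))
  have k4 := j31.const_mul (τ ^ 3 / 6 * r 3 x)
  have k5 := i0.sub (j0.const_mul (r 1 x))
  have k6 := j01.const_mul (r 0 x)
  refine ⟨(k5.sub k6).sub (k3.sub k4), ?_⟩
  simp only [derivRem, smearMoment, pow_zero, one_mul, pow_one]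
  refine (integral_sub (k5.sub k6) (k3.sub k4)).trans ?_
  refine congrArg₂ (· - ·) ((integral_sub k5 k6).trans (congrArg₂ (· - ·)
    ((integral_sub i0 (j0.const_mul _)).trans ?_) ?_)) ((integral_sub k3 k4).trans
    (congrArg₂ (· - ·) ((integral_add k2 (j21.const_mul _)).trans (congrArg₂ (· + ·)
      ((integral_add k1 (j20.const_mul _)).trans (congrArg₂ (· + ·)
        ((integral_sub (j10.const_mul _) (j11.const_mul _)).trans ?_) ?_)) ?_)) ?_))
  all_goals simp only [integral_const_mul]

end

/-- The definition is suited to termwise integration, this factored form to bounds: off `D`, where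
the Taylor remainder of `r` is uncontrolled, the smeared density vanishes. -/
theorem regRem_eq (φ r : ℕ → ℝ → ℝ) (γ : ℕ → ℝ → ℝ → ℝ) (x τ u : ℝ) :
    regRem φ r γ x τ u =
      (r 0 (x - τ * u) - (r 0 x + ((x - τ * u) - x) * r 1 x + ((x - τ * u) - x) ^ 2 / 2 * r 2 x
        + ((x - τ * u) - x) ^ 3 / 6 * r 3 x)) * smear φ γ 0 u (x - τ * u) := by
  rw [regRem, smear_regTower_zero]
  ring

theorem derivRem_eq (φ r : ℕ → ℝ → ℝ) (γ : ℕ → ℝ → ℝ → ℝ) (x τ u : ℝ) :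
    derivRem φ r γ x τ u =
      (r 1 (x - τ * u) - (r 1 x + ((x - τ * u) - x) * r 2 x + ((x - τ * u) - x) ^ 2 / 2 * r 3 x))
        * smear φ γ 0 u (x - τ * u) +
      (r 0 (x - τ * u) - (r 0 x + ((x - τ * u) - x) * r 1 x + ((x - τ * u) - x) ^ 2 / 2 * r 2 x
        + ((x - τ * u) - x) ^ 3 / 6 * r 3 x)) * smear φ γ 1 u (x - τ * u) := by
  rw [derivRem, smear_regTower_one]
  ring

section

variable {p : ℕ} {r : ℕ → ℝ → ℝ} {B : ℝ} (hD : IsClosed D) (hDc : Convex ℝ D)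
  (hγ : KernelTower m D γ G) (hφ : DensityTower m D C φ) (hC : 0 ≤ C)
  (hr : DerivTower m D B r) (hB : 0 ≤ B) (hp : p = 3 ∨ p = 4) (hpm : p ≤ m) {x : ℝ} (hx : x ∈ D)

include hD hDc hγ hφ hC hr hB hp hpm hx

theorem abs_integral_regRem_le : ∃ K, ∀ τ, |∫ u, regRem φ r γ x τ u| ≤ K * |τ| ^ p := by
  refine ⟨2 * B * (2 ^ m * C) * ∫ u, |u| ^ p * G u, fun τ => ?_⟩
  have h := hγ.abs_integral_le (w := regRem φ r γ x τ) (K := 2 * B * (2 ^ m * C) * |τ| ^ p) hpm ?_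
  · exact h.trans (le_of_eq (by ring))
  intro u
  have hG := hγ.nonneg u
  rw [regRem_eq, abs_mul]
  by_cases hy : x - τ * u ∈ D
  · have h1 := hr.cubic_remainder hDc hp hpm hx hy
    have h2 := (hφ.smear hD hγ hC u).bound 0 (Nat.zero_le _) (x - τ * u) (Set.mem_univ _)
    calc _ ≤ _ := mul_le_mul h1 h2 (abs_nonneg _) (by positivity)
      _ = _ := by
        rw [show x - τ * u - x = -(τ * u) by ring, abs_neg, abs_mul, mul_pow]
        ring
  · rw [(hφ.smear hD hγ hC u).eq_zero 0 (Nat.zero_le _) _ hy, abs_zero, mul_zero]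
    positivity

/-- The expansion of `r 1` stops one order before that of `r 0`, which costs a power of `τ`. The
range `τ ≤ 1` absorbs the contribution of `r 0`, of order `τ ^ p`. -/
theorem abs_integral_derivRem_le :
    ∃ K, ∀ᶠ τ in 𝓝[>] (0 : ℝ), |∫ u, derivRem φ r γ x τ u| ≤ K * |τ| ^ (p - 1) := by
  have hE : ∀ τ ∈ Set.Ioc (0 : ℝ) 1, ∀ u, |derivRem φ r γ x τ u| ≤
      2 * B * (2 ^ m * C) * |τ| ^ (p - 1) * (|u| ^ (p - 1) * G u + |u| ^ p * G u) := by
    rintro τ ⟨hτ0, hτ1⟩ u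
    have hG := hγ.nonneg u
    rw [derivRem_eq]
    by_cases hy : x - τ * u ∈ D
    · have h1 := hr.cubic_remainder hDc hp hpm hx hy
      have h1' := hr.quadratic_remainder hDc hp hpm hx hy
      have h2 := (hφ.smear hD hγ hC u).bound 0 (Nat.zero_le _) (x - τ * u) (Set.mem_univ _)
      have h3 := (hφ.smear hD hγ hC u).bound 1 (by omega) (x - τ * u) (Set.mem_univ _)
      refine (abs_add_le _ _).trans ?_
      rw [abs_mul, abs_mul]
      calc _ ≤ _ := add_le_add (mul_le_mul h1' h2 (abs_nonneg _) (by positivity))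
            (mul_le_mul h1 h3 (abs_nonneg _) (by positivity))
        _ = 2 * B * (2 ^ m * C) * |τ| ^ (p - 1) *
            (|u| ^ (p - 1) * G u + |τ| * (|u| ^ p * G u)) := by
          rw [show x - τ * u - x = -(τ * u) by ring, abs_neg, abs_mul, mul_pow, mul_pow,
            show |τ| ^ p = |τ| ^ (p - 1) * |τ| by rw [← pow_succ]; congr 1; omega]
          ring
        _ ≤ _ := by
          have : |τ| ≤ 1 := by rwa [abs_of_pos hτ0]
          have h5 : |τ| * (|u| ^ p * G u) ≤ |u| ^ p * G u :=
            mul_le_of_le_one_left (by positivity) this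
          gcongr
    · rw [(hφ.smear hD hγ hC u).eq_zero 0 (Nat.zero_le _) _ hy,
        (hφ.smear hD hγ hC u).eq_zero 1 (by omega) _ hy, mul_zero, mul_zero, add_zero, abs_zero]
      positivity
  refine ⟨2 * B * (2 ^ m * C) * ∫ u, (|u| ^ (p - 1) * G u + |u| ^ p * G u), ?_⟩
  filter_upwards [Ioc_mem_nhdsGT (zero_lt_one' ℝ)] with τ hτ
  have h6 : 2 * B * (2 ^ m * C) * (∫ u, (|u| ^ (p - 1) * G u + |u| ^ p * G u)) * |τ| ^ (p - 1) =
      ∫ u, 2 * B * (2 ^ m * C) * |τ| ^ (p - 1) * (|u| ^ (p - 1) * G u + |u| ^ p * G u) := by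
    rw [integral_const_mul]; ring
  rw [h6, ← Real.norm_eq_abs]
  exact norm_integral_le_of_norm_le (((hγ.integrable (p - 1) (by omega)).add
    (hγ.integrable p hpm)).const_mul _) (Eventually.of_forall fun u => hE τ hτ u)

/-- The leading irregular terms of the remainders for two densities are proportional. -/
theorem abs_integral_derivRem_sub_le (hψ : DensityTower m D C ψ) :
    ∃ K, ∀ τ,
      |ψ 0 x * (∫ u, derivRem φ r γ x τ u) - φ 0 x * ∫ u, derivRem ψ r γ x τ u|
        ≤ K * |τ| ^ p := by
  -- At `y = x` both products equal `φ 0 x * ψ 0 x * γ 0 u x`, so the difference is `O(|y - x|)`.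
  -- This is the power of `τ` missing from the bound for a single density.
  have hcross : ∀ u y, |ψ 0 x * smear φ γ 0 u y - φ 0 x * smear ψ γ 0 u y|
      ≤ 2 * C * (2 ^ m * C * G u * |y - x|) := by
    intro u y
    have t1 := smear_taylor hD hγ hφ hC (show 0 + 1 ≤ m by omega) u x y
    have t2 := smear_taylor hD hγ hψ hC (show 0 + 1 ≤ m by omega) u x y
    have b1 := hφ.bound 0 (Nat.zero_le _) x (Set.mem_univ _)
    have b2 := hψ.bound 0 (Nat.zero_le _) x (Set.mem_univ _)
    simp only [Finset.range_one, Finset.sum_singleton, pow_zero, Nat.factorial_zero, Nat.cast_one,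
      div_one, one_mul, pow_one, add_zero] at t1 t2
    have e : ψ 0 x * smear φ γ 0 u y - φ 0 x * smear ψ γ 0 u y =
        ψ 0 x * (smear φ γ 0 u y - smear φ γ 0 u x)
          - φ 0 x * (smear ψ γ 0 u y - smear ψ γ 0 u x) := by
      simp only [smear, mulTower]; ring
    rw [e]
    refine (abs_sub _ _).trans ?_
    rw [abs_mul, abs_mul]
    calc _ ≤ _ := add_le_add (mul_le_mul b2 t1 (abs_nonneg _) hC)
          (mul_le_mul b1 t2 (abs_nonneg _) hC)
      _ = _ := by ring
  -- No cancellation is needed here: this factor multiplies the remainder of `r 0`, which already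
  -- has order `p`.
  have hcross1 : ∀ u y, |ψ 0 x * smear φ γ 1 u y - φ 0 x * smear ψ γ 1 u y|
      ≤ 2 * C * (2 ^ m * C * G u) := by
    intro u y
    have t1 := (hφ.smear hD hγ hC u).bound 1 (by omega) y (Set.mem_univ _)
    have t2 := (hψ.smear hD hγ hC u).bound 1 (by omega) y (Set.mem_univ _)
    have b1 := hφ.bound 0 (Nat.zero_le _) x (Set.mem_univ _)
    have b2 := hψ.bound 0 (Nat.zero_le _) x (Set.mem_univ _)
    refine (abs_sub _ _).trans ?_
    rw [abs_mul, abs_mul]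
    calc _ ≤ _ := add_le_add (mul_le_mul b2 t1 (abs_nonneg _) hC)
          (mul_le_mul b1 t2 (abs_nonneg _) hC)
      _ = _ := by ring
  -- Two products of a Taylor bound with constant `2 * B` and a cross bound with constant `2 * C *
  -- (2 ^ m * C)`.
  refine ⟨8 * B * C * (2 ^ m * C) * ∫ u, |u| ^ p * G u, fun τ => ?_⟩
  have i1 := (integral_derivRem hD hγ hφ hC hr hB hp hpm x τ).1
  have i2 := (integral_derivRem hD hγ hψ hC hr hB hp hpm x τ).1
  rw [← integral_const_mul, ← integral_const_mul, ← integral_sub (i1.const_mul _) (i2.const_mul _)]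
  have h := hγ.abs_integral_le
    (w := fun u => ψ 0 x * derivRem φ r γ x τ u - φ 0 x * derivRem ψ r γ x τ u)
    (K := 8 * B * C * (2 ^ m * C) * |τ| ^ p) hpm ?_
  · exact h.trans (le_of_eq (by ring))
  intro u
  have hG := hγ.nonneg u
  rw [derivRem_eq, derivRem_eq]
  by_cases hy : x - τ * u ∈ D
  · have h1 := hr.cubic_remainder hDc hp hpm hx hy
    have h1' := hr.quadratic_remainder hDc hp hpm hx hy
    have h2 := hcross u (x - τ * u)
    have h3 := hcross1 u (x - τ * u)
    set R0 := r 0 (x - τ * u) - (r 0 x + ((x - τ * u) - x) * r 1 x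
      + ((x - τ * u) - x) ^ 2 / 2 * r 2 x + ((x - τ * u) - x) ^ 3 / 6 * r 3 x)
    set R1 := r 1 (x - τ * u) - (r 1 x + ((x - τ * u) - x) * r 2 x
      + ((x - τ * u) - x) ^ 2 / 2 * r 3 x)
    have e : ψ 0 x * (R1 * smear φ γ 0 u (x - τ * u) + R0 * smear φ γ 1 u (x - τ * u))
        - φ 0 x * (R1 * smear ψ γ 0 u (x - τ * u) + R0 * smear ψ γ 1 u (x - τ * u)) =
        R1 * (ψ 0 x * smear φ γ 0 u (x - τ * u) - φ 0 x * smear ψ γ 0 u (x - τ * u))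
        + R0 * (ψ 0 x * smear φ γ 1 u (x - τ * u) - φ 0 x * smear ψ γ 1 u (x - τ * u)) := by
      ring
    rw [e]
    refine (abs_add_le _ _).trans ?_
    rw [abs_mul, abs_mul]
    calc _ ≤ _ := add_le_add (mul_le_mul h1' h2 (abs_nonneg _) (by positivity))
          (mul_le_mul h1 h3 (abs_nonneg _) (by positivity))
      _ = _ := by
        rw [show x - τ * u - x = -(τ * u) by ring, abs_neg, abs_mul, mul_pow, mul_pow,
          show |τ| ^ p = |τ| ^ (p - 1) * |τ| by rw [← pow_succ]; congr 1; omega,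
          show |u| ^ p = |u| ^ (p - 1) * |u| by rw [← pow_succ]; congr 1; omega]
        ring
  · rw [(hφ.smear hD hγ hC u).eq_zero 0 (Nat.zero_le _) _ hy,
      (hφ.smear hD hγ hC u).eq_zero 1 (by omega) _ hy,
      (hψ.smear hD hγ hC u).eq_zero 0 (Nat.zero_le _) _ hy,
      (hψ.smear hD hγ hC u).eq_zero 1 (by omega) _ hy]
    simp only [mul_zero, add_zero, sub_zero, abs_zero]
    positivity

end

end SmallME
end

/-! ### Limits of the regression, its derivatives and their remainders. -/

noncomputable section

namespace SmallME

variable {m : ℕ} {D : Set ℝ} {γ : ℕ → ℝ → ℝ → ℝ} {G : ℝ → ℝ} {φ ψ : ℕ → ℝ → ℝ} {C C' : ℝ}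

section SecondMoment

variable {x : ℝ} (hD : IsClosed D) (hγ : KernelTower m D γ G)
  (hφ : DensityTower m D C φ) (hC : 0 ≤ C) (hm : 2 ≤ m)

include hD hγ hφ hC hm

/-- The smeared second moments are integrable by domination; where the density is nonzero, the
Leibniz formulas can be solved successively for the kernel and its derivatives. -/
theorem integrable_sq_mul_kernel (hx : φ 0 x ≠ 0) {j : ℕ} (hj : j ≤ 2) :
    Integrable (fun u => u ^ 2 * γ j u x) := by
  have i := fun j (hj : j ≤ 2) => integrable_smear hD hγ hφ hC (show 0 < m by omega)
    (show j ≤ m by omega) hm 0 x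
  simp only [zero_mul, sub_zero] at i
  have h0 : Integrable (fun u => u ^ 2 * γ 0 u x) := by
    refine ((i 0 (by norm_num)).const_mul (φ 0 x)⁻¹).congr (Eventually.of_forall fun u => ?_)
    simp only [smear, mulTower]
    field_simp
  have h1 : Integrable (fun u => u ^ 2 * γ 1 u x) := by
    refine (((i 1 (by norm_num)).sub (h0.const_mul (φ 1 x))).const_mul (φ 0 x)⁻¹).congr
      (Eventually.of_forall fun u => ?_)
    simp only [smear, mulTower, Pi.sub_apply]
    field_simp
    ring
  have h2 : Integrable (fun u => u ^ 2 * γ 2 u x) := by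
    refine ((((i 2 (by norm_num)).sub (h0.const_mul (φ 2 x))).sub
      (h1.const_mul (2 * φ 1 x))).const_mul (φ 0 x)⁻¹).congr (Eventually.of_forall fun u => ?_)
    simp only [smear, mulTower, Pi.sub_apply]
    field_simp
    ring
  interval_cases j <;> assumption

end SecondMoment

/-- The Leibniz rule for the product of the density and the error variance, with the integrals of `u
^ 2 * γ j u x` in the role of derivatives of the variance. -/
theorem smearMoment_two_eq {x : ℝ} (hi : ∀ j ≤ 2, Integrable (fun u => u ^ 2 * γ j u x))
    (φ : ℕ → ℝ → ℝ) :
    smearMoment φ γ 2 0 0 x = φ 0 x * (∫ u, u ^ 2 * γ 0 u x) ∧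
    smearMoment φ γ 2 1 0 x = φ 1 x * (∫ u, u ^ 2 * γ 0 u x) + φ 0 x * (∫ u, u ^ 2 * γ 1 u x) ∧
    smearMoment φ γ 2 2 0 x = φ 2 x * (∫ u, u ^ 2 * γ 0 u x)
      + 2 * φ 1 x * (∫ u, u ^ 2 * γ 1 u x) + φ 0 x * (∫ u, u ^ 2 * γ 2 u x) := by
  have h0 := hi 0 (by norm_num)
  have h1 := hi 1 (by norm_num)
  have h2 := hi 2 (by norm_num)
  simp only [← integral_const_mul, smearMoment, zero_mul, sub_zero]
  refine ⟨?_, ?_, ?_⟩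
  · refine integral_congr_ae (Eventually.of_forall fun u => ?_)
    simp only [smear, mulTower]; ring
  · rw [← integral_add (h0.const_mul _) (h1.const_mul _)]
    refine integral_congr_ae (Eventually.of_forall fun u => ?_)
    simp only [smear, mulTower]; ring
  · rw [← integral_add (h0.const_mul _) (h1.const_mul _)]
    refine Eq.trans ?_
      (integral_add ((h0.const_mul (φ 2 x)).add (h1.const_mul (2 * φ 1 x))) (h2.const_mul _))
    refine integral_congr_ae (Eventually.of_forall fun u => ?_)
    simp only [smear, mulTower]; ring

theorem near_div_sq {p : ℕ} (hp : 3 ≤ p) {e : ℝ → ℝ} {K : ℝ}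
    (h : ∀ᶠ τ in 𝓝[>] (0 : ℝ), |e τ| ≤ K * |τ| ^ p) : Near (p - 2) (fun τ => e τ / τ ^ 2) 0 := by
  refine Near.of_abs_le (K := K) ?_
  filter_upwards [h, self_mem_nhdsWithin] with τ h1 hτ
  have hτ : 0 < τ := hτ
  rw [abs_of_pos hτ] at *
  rw [sub_zero, abs_div, abs_of_pos (show 0 < τ ^ 2 by positivity), div_le_iff₀ (by positivity),
    mul_assoc, ← pow_add]
  rwa [show p - 2 + 2 = p by omega]

/-- The value and the first two derivatives of a quotient of two functions, in terms of the
derivatives of numerator and denominator. -/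
def quotJet (N F : ℕ → ℝ) : ℕ → ℝ
  | 0 => N 0 / F 0
  | 1 => (N 1 * F 0 - N 0 * F 1) / F 0 ^ 2
  | _ => ((N 2 * F 0 - N 0 * F 2) * F 0 - 2 * F 1 * (N 1 * F 0 - N 0 * F 1)) / F 0 ^ 3

/-- The derivative of the score. -/
def scoreJet (F : ℕ → ℝ) : ℝ := (F 2 * F 0 - F 1 * F 1) / F 0 ^ 2

section Limits

variable {p : ℕ} {r : ℕ → ℝ → ℝ} {B : ℝ} (hD : IsClosed D) (hDc : Convex ℝ D)
  (hγ : KernelTower m D γ G) (hφ : DensityTower m D C φ) (hC : 0 ≤ C)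
  (hr : DerivTower m D B r) (hB : 0 ≤ B) (hpm : p ≤ m) (hmom : ErrorMoments p φ γ)
  {x : ℝ} (hx : x ∈ D)

include hD hDc hγ hφ hC hr hB hpm hmom hx

/-- The linear Taylor term of the regression meets the first smeared moment, itself of order `τ`;
this produces the `r 1` term at order `τ ^ 2`, next to the usual `r 2` term. -/
theorem near_regression :
    Near (p - 2) (fun τ => (smearMoment (regTower φ r) γ 0 0 τ x
        - r 0 x * smearMoment φ γ 0 0 τ x) / τ ^ 2)
      (r 1 x * smearMoment φ γ 2 1 0 x + r 2 x / 2 * smearMoment φ γ 2 0 0 x) := by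
  have hp := hmom.order
  obtain ⟨K, hK⟩ := abs_integral_regRem_le hD hDc hγ hφ hC hr hB hp hpm hx
  have e := near_div_sq (by omega) (Eventually.of_forall hK) (p := p)
  have v1 := near_smearMoment_one hD hγ hφ hC hpm hmom x (j := 0) (by norm_num)
  have v2 := near_smearMoment_two hD hγ hφ hC hpm hmom x (j := 0) (by norm_num)
  have v3 := near_smearMoment_three hD hγ hφ hC hpm hmom x (j := 0) (by norm_num)
  have key := (((v1.const_mul (-r 1 x)).add (v2.const_mul (r 2 x / 2))).sub
    (v3.const_mul (r 3 x / 6))).add e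
  refine (key.congr ?_).of_const_eq (by ring)
  filter_upwards [self_mem_nhdsWithin] with τ hτ
  have hτ : τ ≠ 0 := (show 0 < τ from hτ).ne'
  rw [integral_regRem hD hγ hφ hC hr hB hp hpm]
  field_simp
  ring

omit hDc hx in
theorem near_quotient {j : ℕ} (hj : j ≤ 2) (hf : φ 0 x ≠ 0) :
    Near (p - 2) (fun τ => quotJet (fun i => smearMoment (regTower φ r) γ 0 i τ x)
      (fun i => smearMoment φ γ 0 i τ x) j) (r j x) := by
  have hp := hmom.order
  have hr0 : p - 2 ≠ 0 := by omega
  have hφr := hφ.mul hD hr hC hB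
  have hC' : 0 ≤ 2 ^ m * (C * B) := by positivity
  have F := fun j (hj : j ≤ 2) => near_smearMoment_zero hD hγ hφ hC hpm hmom x hj
  have N := fun j (hj : j ≤ 2) => near_smearMoment_zero hD hγ hφr hC' hpm
    (hmom.regTower (r := r)) x hj
  have F0 := F 0 (by norm_num)
  have F1 := F 1 (by norm_num)
  have F2 := F 2 (by norm_num)
  have N0 := N 0 (by norm_num)
  have N1 := N 1 (by norm_num)
  have N2 := N 2 (by norm_num)
  interval_cases j
  · refine (N0.div hr0 F0 hf).of_const_eq ?_
    simp only [mulTower]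
    field_simp
  · have h := (((N1.mul F0).sub (N0.mul F1)).div hr0 (F0.mul F0) (mul_ne_zero hf hf))
    refine (h.congr (Eventually.of_forall fun τ => ?_)).of_const_eq ?_
    · simp only [quotJet, sq]
    · simp only [mulTower]
      field_simp
      ring
  · have h := ((((N2.mul F0).sub (N0.mul F2)).mul F0).sub ((F1.const_mul 2).mul
      ((N1.mul F0).sub (N0.mul F1)))).div hr0 ((F0.mul F0).mul F0)
        (mul_ne_zero (mul_ne_zero hf hf) hf)
    refine (h.congr (Eventually.of_forall fun τ => ?_)).of_const_eq ?_
    · simp only [quotJet, pow_succ, pow_zero, one_mul]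
    · simp only [mulTower]
      field_simp
      ring

/-- Only the difference between two densities has a limit with error `O(τ ^ (p - 2))`; each ratio
alone still contains `derivRem` divided by `τ ^ 2`, of order `τ ^ (p - 3)`. -/
theorem near_regression_deriv (hψ : DensityTower m D C ψ) (hmom' : ErrorMoments p ψ γ)
    (hf : φ 0 x ≠ 0) (hf' : ψ 0 x ≠ 0) :
    Near (p - 2) (fun τ => (smearMoment (regTower φ r) γ 0 1 τ x
        - r 1 x * smearMoment φ γ 0 0 τ x - r 0 x * smearMoment φ γ 0 1 τ x) / τ ^ 2
          / smearMoment φ γ 0 0 τ x -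
        (smearMoment (regTower ψ r) γ 0 1 τ x
        - r 1 x * smearMoment ψ γ 0 0 τ x - r 0 x * smearMoment ψ γ 0 1 τ x) / τ ^ 2
          / smearMoment ψ γ 0 0 τ x)
      ((3 / 2 * r 2 x * smearMoment φ γ 2 1 0 x + r 1 x * smearMoment φ γ 2 2 0 x
        + r 3 x / 2 * smearMoment φ γ 2 0 0 x) / φ 0 x -
       (3 / 2 * r 2 x * smearMoment ψ γ 2 1 0 x + r 1 x * smearMoment ψ γ 2 2 0 x
        + r 3 x / 2 * smearMoment ψ γ 2 0 0 x) / ψ 0 x) := by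
  have hp := hmom.order
  have hr0 : p - 2 ≠ 0 := by omega
  -- With `derivRem` removed, each density separately has the desired rate.
  have reg : ∀ φ : ℕ → ℝ → ℝ, DensityTower m D C φ → ErrorMoments p φ γ →
      Near (p - 2) (fun τ => (smearMoment (regTower φ r) γ 0 1 τ x
        - r 1 x * smearMoment φ γ 0 0 τ x - r 0 x * smearMoment φ γ 0 1 τ x) / τ ^ 2
        - (∫ u, derivRem φ r γ x τ u) / τ ^ 2)
        (3 / 2 * r 2 x * smearMoment φ γ 2 1 0 x + r 1 x * smearMoment φ γ 2 2 0 x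
          + r 3 x / 2 * smearMoment φ γ 2 0 0 x) := by
    intro φ hφ hmom
    have v10 := near_smearMoment_one hD hγ hφ hC hpm hmom x (j := 0) (by norm_num)
    have v11 := near_smearMoment_one hD hγ hφ hC hpm hmom x (j := 1) (by norm_num)
    have v20 := near_smearMoment_two hD hγ hφ hC hpm hmom x (j := 0) (by norm_num)
    have v21 := near_smearMoment_two hD hγ hφ hC hpm hmom x (j := 1) (by norm_num)
    have v31 := near_smearMoment_three hD hγ hφ hC hpm hmom x (j := 1) (by norm_num)
    have key := ((((v10.const_mul (-r 2 x)).sub (v11.const_mul (r 1 x))).add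
      (v20.const_mul (r 3 x / 2))).add (v21.const_mul (r 2 x / 2))).sub (v31.const_mul (r 3 x / 6))
    refine (key.congr ?_).of_const_eq (by ring)
    filter_upwards [self_mem_nhdsWithin] with τ hτ
    have hτ : τ ≠ 0 := (show 0 < τ from hτ).ne'
    rw [(integral_derivRem hD hγ hφ hC hr hB hp hpm x τ).2]
    field_simp
    ring
  have F := near_smearMoment_zero hD hγ hφ hC hpm hmom x (j := 0) (by norm_num)
  have H := near_smearMoment_zero hD hγ hψ hC hpm hmom' x (j := 0) (by norm_num)
  have bdd : ∀ φ : ℕ → ℝ → ℝ, DensityTower m D C φ →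
      (fun τ => (∫ u, derivRem φ r γ x τ u) / τ ^ 2) =O[𝓝[>] (0 : ℝ)] fun _ => (1 : ℝ) := by
    intro φ hφ
    obtain ⟨K, hK⟩ := abs_integral_derivRem_le hD hDc hγ hφ hC hr hB hp hpm hx
    refine (IsBigO.of_bound K (g := fun τ : ℝ => τ ^ (p - 3)) ?_).trans (Near.pow_isBigO_one _)
    filter_upwards [hK, self_mem_nhdsWithin] with τ h1 hτ
    have hτ : 0 < τ := hτ
    rw [abs_of_pos hτ] at h1
    rw [norm_div, norm_pow, norm_pow, Real.norm_eq_abs, Real.norm_eq_abs, abs_of_pos hτ,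
      div_le_iff₀ (by positivity), mul_assoc, ← pow_add, show p - 3 + 2 = p - 1 by omega]
    exact h1
  -- Over a common denominator, the numerator of the remaining difference splits into the cross
  -- difference with the densities frozen at `τ = 0` (`c0`) and two bounded terms times the errors
  -- of the smeared densities (`c1`, `c2`).
  obtain ⟨K, hK⟩ := abs_integral_derivRem_sub_le hD hDc hγ hφ hC hr hB hp hpm hx hψ
  have c0 := near_div_sq (by omega) (Eventually.of_forall hK) (p := p)
  have c1 : Near (p - 2) (fun τ => (∫ u, derivRem φ r γ x τ u) / τ ^ 2 *
      (smearMoment ψ γ 0 0 τ x - ψ 0 x)) 0 := by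
    have := (bdd φ hφ).mul H
    simp only [one_mul] at this
    exact this.congr_left fun τ => (sub_zero _).symm
  have c2 : Near (p - 2) (fun τ => (∫ u, derivRem ψ r γ x τ u) / τ ^ 2 *
      (smearMoment φ γ 0 0 τ x - φ 0 x)) 0 := by
    have := (bdd ψ hψ).mul F
    simp only [one_mul] at this
    exact this.congr_left fun τ => (sub_zero _).symm
  have key := (((reg φ hφ hmom).div hr0 F hf).sub ((reg ψ hψ hmom').div hr0 H hf')).add
    (((c0.add c1).sub c2).div hr0 (F.mul H) (mul_ne_zero hf hf'))
  refine (key.congr ?_).of_const_eq (by ring)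
  filter_upwards [self_mem_nhdsWithin, (F.tendsto hr0).eventually_ne hf,
    (H.tendsto hr0).eventually_ne hf'] with τ hτ h1 h2
  have hτ : τ ≠ 0 := (show 0 < τ from hτ).ne'
  field_simp
  ring

end Limits

/-- The denominator of the skedastic estimand and its derivative. -/
def relJet (Nb Fb F H : ℕ → ℝ) : ℕ → ℝ
  | 0 => quotJet Nb Fb 1 * (F 1 / F 0 - H 1 / H 0)
  | _ => quotJet Nb Fb 2 * (F 1 / F 0 - H 1 / H 0) + quotJet Nb Fb 1 * (scoreJet F - scoreJet H)

/-- The skedastic estimand and its derivative. -/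
def vJet (N F M H Nb Fb : ℕ → ℝ) : ℕ → ℝ
  | 0 => (quotJet N F 0 - quotJet M H 0) / relJet Nb Fb F H 0
  | _ => ((quotJet N F 1 - quotJet M H 1) * relJet Nb Fb F H 0
      - (quotJet N F 0 - quotJet M H 0) * relJet Nb Fb F H 1) / relJet Nb Fb F H 0 ^ 2

/-- The regression estimand. -/
def rhoJet (N F M H Nb Fb : ℕ → ℝ) : ℝ :=
  quotJet N F 0 - vJet N F M H Nb Fb 0 * (quotJet Nb Fb 1 * (F 1 / F 0) + 1 / 2 * quotJet Nb Fb 2)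
    - quotJet Nb Fb 1 * vJet N F M H Nb Fb 1

end SmallME
end

/-! ### Rates for the estimands built from smeared moments. -/

noncomputable section

namespace SmallME

/-- Here `b0` and `b1` stand for the variance of the standardized error and its derivative. The
numerators have been divided by `τ ^ 2`; in the limit the correction terms of ρ̃ reproduce exactly
the bias `r1 * b1 + r1 * b0 * s0 + 1 / 2 * r2 * b0`. -/
theorem near_estimands {k : ℕ} (hk : k ≠ 0) {n dn q q1 q2 s t s' t' : ℝ → ℝ}
    {r1 r2 b0 b1 s0 t0 s0' t0' : ℝ}
    (hn : Near k n (r1 * b0 * (s0 - t0)))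
    (hdn : Near k dn (r2 * b0 * (s0 - t0) + r1 * b1 * (s0 - t0) + r1 * b0 * (s0' - t0')))
    (hq : Near k q (r1 * b1 + r1 * b0 * s0 + 1 / 2 * r2 * b0))
    (hq1 : Near k q1 r1) (hq2 : Near k q2 r2) (hs : Near k s s0) (ht : Near k t t0)
    (hs' : Near k s' s0') (ht' : Near k t' t0') (hne : r1 * (s0 - t0) ≠ 0) :
    Near k (fun τ => n τ / (q1 τ * (s τ - t τ))) b0 ∧
    Near k (fun τ => q τ - n τ / (q1 τ * (s τ - t τ)) * (q1 τ * s τ + 1 / 2 * q2 τ)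
      - q1 τ * ((dn τ * (q1 τ * (s τ - t τ)) - n τ * (q2 τ * (s τ - t τ) + q1 τ * (s' τ - t' τ)))
        / (q1 τ * (s τ - t τ)) ^ 2)) 0 := by
  have hr1 : r1 ≠ 0 := left_ne_zero_of_mul hne
  have hst : s0 - t0 ≠ 0 := right_ne_zero_of_mul hne
  have hd := hq1.mul (hs.sub ht)
  have hv := (hn.div hk hd hne).of_const_eq (d := b0) (by field_simp)
  refine ⟨hv, ?_⟩
  have hd' := (hq2.mul (hs.sub ht)).add (hq1.mul (hs'.sub ht'))
  have h := (hq.sub (hv.mul ((hq1.mul hs).add (hq2.const_mul (1 / 2))))).sub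
    (hq1.mul (((hdn.mul hd).sub (hn.mul hd')).div hk (hd.mul hd) (mul_ne_zero hne hne)))
  refine (h.congr (Eventually.of_forall fun τ => ?_)).of_const_eq ?_
  · simp only [sq]
  · field_simp
    ring

variable {m : ℕ} {D : Set ℝ} {γ : ℕ → ℝ → ℝ → ℝ} {G : ℝ → ℝ} {φ ψ χ : ℕ → ℝ → ℝ} {C C' : ℝ}

/-- The derivatives at `x` of the smeared density. -/
abbrev densJet (φ : ℕ → ℝ → ℝ) (γ : ℕ → ℝ → ℝ → ℝ) (τ x : ℝ) (i : ℕ) : ℝ :=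
  smearMoment φ γ 0 i τ x

theorem smeared_asymptotics {p : ℕ} {r : ℕ → ℝ → ℝ} {B : ℝ} (hD : IsClosed D) (hDc : Convex ℝ D)
    (hγ : KernelTower m D γ G) (hφ : DensityTower m D C φ) (hψ : DensityTower m D C ψ)
    (hχ : DensityTower m D C χ) (hC : 0 ≤ C) (hr : DerivTower m D B r) (hB : 0 ≤ B) (hpm : p ≤ m)
    (hmφ : ErrorMoments p φ γ) (hmψ : ErrorMoments p ψ γ) (hmχ : ErrorMoments p χ γ)
    {x : ℝ} (hx : x ∈ D) (hfφ : φ 0 x ≠ 0) (hfψ : ψ 0 x ≠ 0) (hfχ : χ 0 x ≠ 0)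
    (hne : r 1 x * (φ 1 x / φ 0 x - ψ 1 x / ψ 0 x) ≠ 0) :
    (∀ᶠ τ in 𝓝[>] (0 : ℝ), relJet (densJet (regTower χ r) γ τ x) (densJet χ γ τ x)
      (densJet φ γ τ x) (densJet ψ γ τ x) 0 ≠ 0) ∧
    ((fun τ => vJet (densJet (regTower φ r) γ τ x) (densJet φ γ τ x)
        (densJet (regTower ψ r) γ τ x) (densJet ψ γ τ x)
        (densJet (regTower χ r) γ τ x) (densJet χ γ τ x) 0 - τ ^ 2 * ∫ u, u ^ 2 * γ 0 u x)
      =O[𝓝[>] (0 : ℝ)] fun τ => τ ^ p) ∧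
    ((fun τ => rhoJet (densJet (regTower φ r) γ τ x) (densJet φ γ τ x)
        (densJet (regTower ψ r) γ τ x) (densJet ψ γ τ x)
        (densJet (regTower χ r) γ τ x) (densJet χ γ τ x) - r 0 x)
      =O[𝓝[>] (0 : ℝ)] fun τ => τ ^ p) := by
  have hp := hmφ.order
  have hk : p - 2 ≠ 0 := by omega
  have hi : ∀ j ≤ 2, Integrable (fun u => u ^ 2 * γ j u x) := fun j hj =>
    integrable_sq_mul_kernel hD hγ hφ hC (by omega) hfφ hj
  set b0 := ∫ u, u ^ 2 * γ 0 u x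
  set b1 := ∫ u, u ^ 2 * γ 1 u x
  set b2 := ∫ u, u ^ 2 * γ 2 u x
  obtain ⟨jφ0, jφ1, jφ2⟩ := smearMoment_two_eq hi φ
  obtain ⟨jψ0, jψ1, jψ2⟩ := smearMoment_two_eq hi ψ
  have F := fun j (hj : j ≤ 2) => near_smearMoment_zero hD hγ hφ hC hpm hmφ x hj
  have H := fun j (hj : j ≤ 2) => near_smearMoment_zero hD hγ hψ hC hpm hmψ x hj
  have F0 := F 0 (by norm_num)
  have F1 := F 1 (by norm_num)
  have F2 := F 2 (by norm_num)
  have H0 := H 0 (by norm_num)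
  have H1 := H 1 (by norm_num)
  have H2 := H 2 (by norm_num)
  have hq1 := near_quotient hD hγ hχ hC hr hB hpm hmχ (x := x) (j := 1) (by norm_num) hfχ
  have hq2 := near_quotient hD hγ hχ hC hr hB hpm hmχ (x := x) (j := 2) (by norm_num) hfχ
  have Mφ := (near_regression hD hDc hγ hφ hC hr hB hpm hmφ hx).div hk F0 hfφ
  have Mψ := (near_regression hD hDc hγ hψ hC hr hB hpm hmψ hx).div hk H0 hfψ
  have Md := near_regression_deriv hD hDc hγ hφ hC hr hB hpm hmφ hx hψ hmψ hfφ hfψ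
  have hs := F1.div hk F0 hfφ
  have ht := H1.div hk H0 hfψ
  have hs' := ((F2.mul F0).sub (F1.mul F1)).div hk (F0.mul F0) (mul_ne_zero hfφ hfφ)
  have ht' := ((H2.mul H0).sub (H1.mul H1)).div hk (H0.mul H0) (mul_ne_zero hfψ hfψ)
  have hev : ∀ᶠ τ in 𝓝[>] (0 : ℝ), τ ≠ 0 ∧ densJet φ γ τ x 0 ≠ 0 ∧ densJet ψ γ τ x 0 ≠ 0 := by
    filter_upwards [self_mem_nhdsWithin, (F0.tendsto hk).eventually_ne hfφ,
      (H0.tendsto hk).eventually_ne hfψ] with τ hτ h1 h2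
    exact ⟨(show 0 < τ from hτ).ne', h1, h2⟩
  have hq : Near (p - 2) (fun τ => (quotJet (densJet (regTower φ r) γ τ x) (densJet φ γ τ x) 0
      - r 0 x) / τ ^ 2) (r 1 x * b1 + r 1 x * b0 * (φ 1 x / φ 0 x) + 1 / 2 * r 2 x * b0) := by
    refine (Mφ.congr ?_).of_const_eq ?_
    · filter_upwards [hev] with τ ⟨h0, h1, h2⟩
      simp only [quotJet, densJet] at *
      field_simp
    · rw [jφ0, jφ1]
      field_simp
      ring
  have hq' : Near (p - 2) (fun τ => (quotJet (densJet (regTower ψ r) γ τ x) (densJet ψ γ τ x) 0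
      - r 0 x) / τ ^ 2) (r 1 x * b1 + r 1 x * b0 * (ψ 1 x / ψ 0 x) + 1 / 2 * r 2 x * b0) := by
    refine (Mψ.congr ?_).of_const_eq ?_
    · filter_upwards [hev] with τ ⟨h0, h1, h2⟩
      simp only [quotJet, densJet] at *
      field_simp
    · rw [jψ0, jψ1]
      field_simp
      ring
  have hn : Near (p - 2) (fun τ => (quotJet (densJet (regTower φ r) γ τ x) (densJet φ γ τ x) 0
      - quotJet (densJet (regTower ψ r) γ τ x) (densJet ψ γ τ x) 0) / τ ^ 2)
      (r 1 x * b0 * (φ 1 x / φ 0 x - ψ 1 x / ψ 0 x)) :=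
    ((hq.sub hq').congr (Eventually.of_forall fun τ => by ring)).of_const_eq (by ring)
  -- With numerator jet N and density jet F, (N/F)' equals r₁ + (N₁ - r₁F₀ - r₀F₁)/F₀ - (N₀/F₀ - r₀)
  -- F₁/F₀. The term r₁ is common to both densities, `Md` covers the second term and `hq`, `hq'` the
  -- third.
  have hdn : Near (p - 2) (fun τ => (quotJet (densJet (regTower φ r) γ τ x) (densJet φ γ τ x) 1
      - quotJet (densJet (regTower ψ r) γ τ x) (densJet ψ γ τ x) 1) / τ ^ 2)
      (r 2 x * b0 * (φ 1 x / φ 0 x - ψ 1 x / ψ 0 x) + r 1 x * b1 * (φ 1 x / φ 0 x - ψ 1 x / ψ 0 x)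
        + r 1 x * b0 * ((φ 2 x * φ 0 x - φ 1 x * φ 1 x) / (φ 0 x * φ 0 x)
          - (ψ 2 x * ψ 0 x - ψ 1 x * ψ 1 x) / (ψ 0 x * ψ 0 x))) := by
    refine (((Md.sub (hq.mul hs)).add (hq'.mul ht)).congr ?_).of_const_eq ?_
    · filter_upwards [hev] with τ ⟨h0, h1, h2⟩
      simp only [quotJet, densJet] at *
      field_simp
      ring
    -- The integral `b2` enters both quotients as `r 1 x * b2` and cancels, as does the term with `r
    -- 3 x`.
    · rw [jφ0, jφ1, jφ2, jψ0, jψ1, jψ2]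
      field_simp
      ring
  obtain ⟨e1, e2⟩ := near_estimands hk hn hdn hq hq1 hq2 hs ht hs' ht' hne
  -- Multiplying back by `τ ^ 2` raises the rate from `p - 2` to `p`.
  have scale : ∀ {a b : ℝ → ℝ} {c : ℝ}, Near (p - 2) a c →
      (∀ᶠ τ in 𝓝[>] (0 : ℝ), b τ = τ ^ 2 * (a τ - c)) →
      b =O[𝓝[>] (0 : ℝ)] fun τ => τ ^ p := by
    intro a b c h hb
    have h1 := (isBigO_refl (fun τ : ℝ => τ ^ 2) (𝓝[>] (0 : ℝ))).mul h
    refine h1.congr' (hb.mono fun τ hτ => hτ.symm) (Eventually.of_forall fun τ => ?_)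
    simp only [← pow_add]
    congr 1
    omega
  refine ⟨?_, scale e1 ?_, scale e2 ?_⟩
  · filter_upwards [((hq1.mul (hs.sub ht)).tendsto hk).eventually_ne hne] with τ hτ using hτ
  · filter_upwards [hev] with τ ⟨h0, h1, h2⟩
    simp only [vJet, relJet]
    field_simp
  · filter_upwards [hev, ((hq1.mul (hs.sub ht)).tendsto hk).eventually_ne hne] with
      τ ⟨h0, h1, h2⟩ hτ
    simp only [rhoJet, vJet, relJet, scoreJet]
    simp only [← sq]
    generalize quotJet (densJet (regTower χ r) γ τ x) (densJet χ γ τ x) 1 *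
      (densJet φ γ τ x 1 / densJet φ γ τ x 0 - densJet ψ γ τ x 1 / densJet ψ γ τ x 0) = d
    field_simp
    ring

end SmallME
end

/-! ### Identification of the estimands with formulas in derivatives of numerators and densities. -/

noncomputable section

namespace SmallME

/-- `F 0`, `F 1`, `F 2` are successive derivatives on `ℝ`. -/
def IsJet (F : ℕ → ℝ → ℝ) : Prop := ∀ i < 2, ∀ y, HasDerivAt (F i) (F (i + 1) y) y

/-- The values at `y` of a sequence of functions. -/
abbrev jetAt (F : ℕ → ℝ → ℝ) (y : ℝ) (i : ℕ) : ℝ := F i y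

section

variable {N F M H Nb Fb : ℕ → ℝ → ℝ} {y : ℝ}

theorem IsJet.hasDerivAt_quot_zero (hN : IsJet N) (hF : IsJet F) (hy : F 0 y ≠ 0) :
    HasDerivAt (fun y => quotJet (jetAt N y) (jetAt F y) 0)
      (quotJet (jetAt N y) (jetAt F y) 1) y :=
  (hN 0 (by norm_num) y).div (hF 0 (by norm_num) y) hy

theorem IsJet.hasDerivAt_quot_one (hN : IsJet N) (hF : IsJet F) (hy : F 0 y ≠ 0) :
    HasDerivAt (fun y => quotJet (jetAt N y) (jetAt F y) 1)
      (quotJet (jetAt N y) (jetAt F y) 2) y := by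
  have n0 := hN 0 (by norm_num) y
  have n1 := hN 1 (by norm_num) y
  have f0 := hF 0 (by norm_num) y
  have f1 := hF 1 (by norm_num) y
  have h := ((n1.mul f0).sub (n0.mul f1)).div (f0.mul f0) (mul_ne_zero hy hy)
  refine (h.congr_of_eventuallyEq (Eventually.of_forall fun z => ?_)).congr_deriv ?_
  · simp only [quotJet, sq]
    rfl
  · simp only [quotJet, Pi.mul_apply, Pi.sub_apply]
    field_simp
    ring

theorem IsJet.hasDerivAt_score (hF : IsJet F) (hy : F 0 y ≠ 0) :
    HasDerivAt (fun y => F 1 y / F 0 y) (scoreJet (jetAt F y)) y := by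
  refine ((hF 1 (by norm_num) y).div (hF 0 (by norm_num) y) hy).congr_deriv ?_
  simp only [scoreJet]

theorem hasDerivAt_relJet (hNb : IsJet Nb) (hFb : IsJet Fb) (hF : IsJet F) (hH : IsJet H)
    (h1 : Fb 0 y ≠ 0) (h2 : F 0 y ≠ 0) (h3 : H 0 y ≠ 0) :
    HasDerivAt (fun y => relJet (jetAt Nb y) (jetAt Fb y) (jetAt F y) (jetAt H y) 0)
      (relJet (jetAt Nb y) (jetAt Fb y) (jetAt F y) (jetAt H y) 1) y :=
  (hNb.hasDerivAt_quot_one hFb h1).mul ((hF.hasDerivAt_score h2).sub (hH.hasDerivAt_score h3))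

theorem hasDerivAt_vJet (hN : IsJet N) (hF : IsJet F) (hM : IsJet M) (hH : IsJet H)
    (hNb : IsJet Nb) (hFb : IsJet Fb) (h1 : Fb 0 y ≠ 0) (h2 : F 0 y ≠ 0) (h3 : H 0 y ≠ 0)
    (h4 : relJet (jetAt Nb y) (jetAt Fb y) (jetAt F y) (jetAt H y) 0 ≠ 0) :
    HasDerivAt (fun y => vJet (jetAt N y) (jetAt F y) (jetAt M y) (jetAt H y) (jetAt Nb y)
      (jetAt Fb y) 0)
      (vJet (jetAt N y) (jetAt F y) (jetAt M y) (jetAt H y) (jetAt Nb y) (jetAt Fb y) 1) y :=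
  ((hN.hasDerivAt_quot_zero hF h2).sub (hM.hasDerivAt_quot_zero hH h3)).div
    (hasDerivAt_relJet hNb hFb hF hH h1 h2 h3) h4

theorem IsJet.continuousAt (hF : IsJet F) : ContinuousAt (F 0) y :=
  (hF 0 (by norm_num) y).continuousAt

variable {𝒵 : Type*} {fX qXZ : 𝒵 → ℝ → ℝ} {qX : ℝ → ℝ} {z₁ z₂ : 𝒵} {x : ℝ}

theorem score_eq_of_eventuallyEq {h : ℝ → ℝ} (hF : IsJet F) (e : h =ᶠ[𝓝 x] F 0) :
    score h =ᶠ[𝓝 x] fun y => F 1 y / F 0 y := by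
  filter_upwards [e, e.deriv] with y h1 h2
  rw [score, h1, h2, (hF 0 (by norm_num) y).deriv]

/-- The hypotheses are equalities near `x`, not just at `x`, because the estimands differentiate
scores, regressions and ṽ itself. -/
theorem estimands_eq_jets (hN : IsJet N) (hF : IsJet F) (hM : IsJet M) (hH : IsJet H)
    (hNb : IsJet Nb) (hFb : IsJet Fb) (h1 : Fb 0 x ≠ 0) (h2 : F 0 x ≠ 0) (h3 : H 0 x ≠ 0)
    (h4 : relJet (jetAt Nb x) (jetAt Fb x) (jetAt F x) (jetAt H x) 0 ≠ 0)
    (e1 : fX z₁ =ᶠ[𝓝 x] F 0) (e2 : fX z₂ =ᶠ[𝓝 x] H 0)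
    (e3 : qXZ z₁ =ᶠ[𝓝 x] fun y => N 0 y / F 0 y) (e4 : qXZ z₂ =ᶠ[𝓝 x] fun y => M 0 y / H 0 y)
    (e5 : qX =ᶠ[𝓝 x] fun y => Nb 0 y / Fb 0 y) :
    relevance fX qX z₁ z₂ x = relJet (jetAt Nb x) (jetAt Fb x) (jetAt F x) (jetAt H x) 0 ∧
    vTilde fX qXZ qX z₁ z₂ x = vJet (jetAt N x) (jetAt F x) (jetAt M x) (jetAt H x)
      (jetAt Nb x) (jetAt Fb x) 0 ∧
    rhoTilde fX qXZ qX z₁ z₂ x z₁ = rhoJet (jetAt N x) (jetAt F x) (jetAt M x) (jetAt H x)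
      (jetAt Nb x) (jetAt Fb x) := by
  have s1 := score_eq_of_eventuallyEq hF e1
  have s2 := score_eq_of_eventuallyEq hH e2
  have ne1 : ∀ᶠ y in 𝓝 x, Fb 0 y ≠ 0 := hFb.continuousAt.eventually_ne h1
  have d1 : deriv qX =ᶠ[𝓝 x] fun y => quotJet (jetAt Nb y) (jetAt Fb y) 1 := by
    filter_upwards [e5.deriv, ne1] with y hy hy1
    rw [hy]
    exact (hNb.hasDerivAt_quot_zero hFb hy1).deriv
  have d2 : iteratedDeriv 2 qX x = quotJet (jetAt Nb x) (jetAt Fb x) 2 := by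
    rw [iteratedDeriv_succ, iteratedDeriv_one, d1.deriv_eq]
    exact (hNb.hasDerivAt_quot_one hFb h1).deriv
  have hrel : relevance fX qX z₁ z₂ =ᶠ[𝓝 x]
      fun y => relJet (jetAt Nb y) (jetAt Fb y) (jetAt F y) (jetAt H y) 0 := by
    filter_upwards [s1, s2, d1] with y hy1 hy2 hy3
    rw [relevance, hy1, hy2, hy3]
    rfl
  have hv : vTilde fX qXZ qX z₁ z₂ =ᶠ[𝓝 x] fun y => vJet (jetAt N y) (jetAt F y) (jetAt M y)
      (jetAt H y) (jetAt Nb y) (jetAt Fb y) 0 := by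
    filter_upwards [hrel, e3, e4] with y hy1 hy2 hy3
    rw [vTilde, hy1, hy2, hy3]
    rfl
  refine ⟨hrel.eq_of_nhds, hv.eq_of_nhds, ?_⟩
  rw [rhoTilde, hv.deriv_eq, (hasDerivAt_vJet hN hF hM hH hNb hFb h1 h2 h3 h4).deriv,
    hv.eq_of_nhds, d2, d1.eq_of_nhds, s1.eq_of_nhds, e3.eq_of_nhds]
  rfl

end

theorem IsJet.contDiff {F : ℕ → ℝ → ℝ} (hF : IsJet F) (hc : Continuous (F 2)) :
    ContDiff ℝ 2 (F 0) := by
  have d0 : deriv (F 0) = F 1 := funext fun y => (hF 0 (by norm_num) y).deriv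
  have d1 : deriv (F 1) = F 2 := funext fun y => (hF 1 (by norm_num) y).deriv
  rw [show (2 : WithTop ℕ∞) = 1 + 1 by norm_num, contDiff_succ_iff_deriv]
  refine ⟨fun y => (hF 0 (by norm_num) y).differentiableAt, by simp, ?_⟩
  rw [d0, contDiff_one_iff_deriv]
  exact ⟨fun y => (hF 1 (by norm_num) y).differentiableAt, by rwa [d1]⟩

theorem isJet_smearMoment {m : ℕ} {D : Set ℝ} {γ : ℕ → ℝ → ℝ → ℝ} {G : ℝ → ℝ} {φ : ℕ → ℝ → ℝ}
    {C : ℝ} (hD : IsClosed D) (hγ : KernelTower m D γ G) (hφ : DensityTower m D C φ) (hC : 0 ≤ C)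
    (hm : 3 ≤ m) (τ : ℝ) :
    IsJet (fun i => smearMoment φ γ 0 i τ) ∧ ContDiff ℝ 2 (smearMoment φ γ 0 0 τ) := by
  have h : IsJet (fun i => smearMoment φ γ 0 i τ) := fun i hi y =>
    hasDerivAt_smearMoment hD hγ hφ hC (by omega) (Nat.zero_le m) τ y
  refine ⟨h, h.contDiff ?_⟩
  exact continuous_iff_continuousAt.2 fun y =>
    (hasDerivAt_smearMoment hD hγ hφ hC (show 2 < m by omega) (Nat.zero_le m) τ y).continuousAt

end SmallME
end

/-! ### The law of the mismeasured covariate. -/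

noncomputable section

namespace SmallME

variable {Ω : Type*} [MeasurableSpace Ω]

/-- The random variable `Xs` has density `φ 0` under `ν`, and the error has the conditional
density `γ 0 · y` given `Xs = y`. -/
structure ErrorLaw (ν : Measure Ω) (Xs ξ : Ω → ℝ) (φ : ℕ → ℝ → ℝ) (γ : ℕ → ℝ → ℝ → ℝ) :
    Prop where
  nonneg : ∀ y, 0 ≤ φ 0 y
  smear_nonneg : ∀ u y, 0 ≤ smear φ γ 0 u y
  density : ν.map Xs = volume.withDensity fun y => ENNReal.ofReal (φ 0 y)
  joint : ν.map (fun ω => (ξ ω, Xs ω)) =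
    (volume : Measure (ℝ × ℝ)).withDensity fun w => ENNReal.ofReal (smear φ γ 0 w.1 w.2)

variable {m : ℕ} {D : Set ℝ} {γ : ℕ → ℝ → ℝ → ℝ} {G : ℝ → ℝ} {φ ψ : ℕ → ℝ → ℝ} {C C' : ℝ}
  {ν : Measure Ω} [IsFiniteMeasure ν] {Xs ξ : Ω → ℝ}

theorem ErrorLaw.integrable_density (h : ErrorLaw ν Xs ξ φ γ)
    (hφ : Measurable (φ 0)) : Integrable (φ 0) := by
  refine ⟨hφ.aestronglyMeasurable, ?_⟩
  rw [hasFiniteIntegral_iff_ofReal (Eventually.of_forall h.nonneg)]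
  have h1 : (ν.map Xs) Set.univ = ∫⁻ y, ENNReal.ofReal (φ 0 y) := by
    rw [h.density, withDensity_apply _ MeasurableSet.univ, Measure.restrict_univ]
  rw [← h1]
  exact measure_lt_top _ _

/-- The change of variables from (ξ, X*) to (ξ, X). -/
theorem measurePreserving_shear (τ : ℝ) :
    MeasurePreserving (fun w : ℝ × ℝ => (w.1, w.2 + τ * w.1)) volume volume := by
  refine (MeasurePreserving.id volume).skew_product (g := fun u y => y + τ * u) ?_ ?_
  · fun_prop
  · exact Eventually.of_forall fun u => map_add_right_eq_self volume (τ * u)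

section

variable (hD : IsClosed D) (hγ : KernelTower m D γ G) (hφ : DensityTower m D C φ) (hC : 0 ≤ C)
  (hm : 0 < m) (hXs : Measurable Xs) (hξ : Measurable ξ) (hlaw : ErrorLaw ν Xs ξ φ γ)
  (hψ : DensityTower m D C' ψ) (hC' : 0 ≤ C') (hψi : Integrable (ψ 0)) {κ : ℝ → ℝ}
  (hκ : Measurable κ) (hκψ : ∀ y, ψ 0 y = κ y * φ 0 y)

include hD hγ hψ hC' hm hψi in
theorem integrable_pow_mul_smear {k : ℕ} (hk : k ≤ m) :
    Integrable (fun w : ℝ × ℝ => w.1 ^ k * smear ψ γ 0 w.1 w.2) := by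
  have h1 := (hγ.integrable k hk).mul_prod hψi.norm
  refine h1.mono' ?_ (Eventually.of_forall fun w => ?_)
  · exact ((measurable_fst.pow_const k).mul
      (measurable_smear hD hγ hψ hC' hm (Nat.zero_le m))).aestronglyMeasurable
  · rw [norm_mul, norm_pow, Real.norm_eq_abs, mul_assoc]
    refine mul_le_mul_of_nonneg_left ?_ (by positivity)
    by_cases hy : w.2 ∈ D
    · have := (hγ.tower w.1).bound 0 (Nat.zero_le _) w.2 hy
      simp only [smear, mulTower, norm_mul, Real.norm_eq_abs]
      rw [mul_comm]
      exact mul_le_mul_of_nonneg_right this (abs_nonneg _)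
    · simp only [smear, mulTower]
      rw [hψ.eq_zero 0 (Nat.zero_le _) _ hy, zero_mul]
      simp

include hD hγ hφ hC hψ hC' hm hψi hXs hξ hlaw hκ hκψ

omit [IsFiniteMeasure ν] in
theorem ErrorLaw.integrable_mul_pow {k : ℕ} (hk : k ≤ m) :
    Integrable (fun ω => κ (Xs ω) * ξ ω ^ k) ν := by
  have hpair : Measurable fun ω => (ξ ω, Xs ω) := hξ.prodMk hXs
  have hf : Measurable fun w : ℝ × ℝ => κ w.2 * w.1 ^ k :=
    (hκ.comp measurable_snd).mul (measurable_fst.pow_const k)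
  have hs := measurable_smear hD hγ hφ hC hm (Nat.zero_le m)
  suffices h : Integrable (fun w : ℝ × ℝ => κ w.2 * w.1 ^ k) (ν.map fun ω => (ξ ω, Xs ω)) from
    (integrable_map_measure hf.aestronglyMeasurable hpair.aemeasurable).1 h
  rw [hlaw.joint, integrable_withDensity_iff hs.ennreal_ofReal
    (Eventually.of_forall fun _ => ENNReal.ofReal_lt_top)]
  refine (integrable_pow_mul_smear hD hγ hm hψ hC' hψi hk).congr
    (Eventually.of_forall fun w => ?_)
  simp only [ENNReal.toReal_ofReal (hlaw.smear_nonneg _ _)]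
  simp only [smear, mulTower, hκψ]
  ring

-- One identity with several uses: `κ = 1`, `k = 0` gives the density of X; `κ` the regression gives
-- the numerator of `E[Y | X]`; `κ = 1`, `τ = 0` gives the moments of the error weighted by the
-- density of X*.
omit [IsFiniteMeasure ν] in
theorem ErrorLaw.setIntegral_eq {k : ℕ} (hk : k ≤ m) (τ : ℝ) {A : Set ℝ} (hA : MeasurableSet A) :
    Integrable (smearMoment ψ γ k 0 τ) ∧
    ∫ ω in mismeasured Xs ξ τ ⁻¹' A, κ (Xs ω) * ξ ω ^ k ∂ν = ∫ y in A, smearMoment ψ γ k 0 τ y := by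
  have hpair : Measurable fun ω => (ξ ω, Xs ω) := hξ.prodMk hXs
  have hf : Measurable fun w : ℝ × ℝ => κ w.2 * w.1 ^ k :=
    (hκ.comp measurable_snd).mul (measurable_fst.pow_const k)
  have hs := measurable_smear hD hγ hφ hC hm (Nat.zero_le m)
  have hsψ := measurable_smear hD hγ hψ hC' hm (Nat.zero_le m)
  set Ψ : ℝ × ℝ → ℝ := fun w => w.1 ^ k * smear ψ γ 0 w.1 (w.2 - τ * w.1) with hΨ
  have hΨm : Measurable Ψ := (measurable_fst.pow_const k).mul
    (hsψ.comp (measurable_fst.prodMk (measurable_snd.sub (measurable_fst.const_mul τ))))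
  have hΨi : Integrable Ψ := by
    refine ((measurePreserving_shear τ).integrable_comp hΨm.aestronglyMeasurable).1 ?_
    refine (integrable_pow_mul_smear hD hγ hm hψ hC' hψi hk).congr
      (Eventually.of_forall fun w => ?_)
    simp [hΨ]
  have hT : MeasurableSet {w : ℝ × ℝ | w.2 + τ * w.1 ∈ A} :=
    (measurable_snd.add (measurable_fst.const_mul τ)) hA
  have hA2 : MeasurableSet {w : ℝ × ℝ | w.2 ∈ A} := measurable_snd hA
  constructor
  · exact hΨi.integral_prod_right
  calc ∫ ω in mismeasured Xs ξ τ ⁻¹' A, κ (Xs ω) * ξ ω ^ k ∂ν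
      = ∫ w in {w : ℝ × ℝ | w.2 + τ * w.1 ∈ A}, κ w.2 * w.1 ^ k ∂(ν.map fun ω => (ξ ω, Xs ω)) := by
        rw [setIntegral_map hT hf.aestronglyMeasurable hpair.aemeasurable]
        rfl
    _ = ∫ w in {w : ℝ × ℝ | w.2 + τ * w.1 ∈ A}, w.1 ^ k * smear ψ γ 0 w.1 w.2 := by
        rw [hlaw.joint, setIntegral_withDensity_eq_setIntegral_toReal_smul₀
          hs.ennreal_ofReal.aemeasurable
          (Eventually.of_forall fun _ => ENNReal.ofReal_lt_top) _ hT]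
        refine integral_congr_ae (Eventually.of_forall fun w => ?_)
        simp only [ENNReal.toReal_ofReal (hlaw.smear_nonneg _ _), smul_eq_mul]
        simp only [smear, mulTower, hκψ]
        ring
    _ = ∫ w : ℝ × ℝ, {w : ℝ × ℝ | w.2 ∈ A}.indicator Ψ (w.1, w.2 + τ * w.1) := by
        rw [← integral_indicator hT]
        refine integral_congr_ae (Eventually.of_forall fun w => ?_)
        simp [Set.indicator, hΨ]
    _ = ∫ w : ℝ × ℝ, {w : ℝ × ℝ | w.2 ∈ A}.indicator Ψ w := by
        have h := (measurePreserving_shear τ).map_eq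
        conv_rhs => rw [← h]
        rw [integral_map (measurePreserving_shear τ).measurable.aemeasurable
          (hΨm.indicator hA2).aestronglyMeasurable]
    _ = ∫ y, ∫ u, {w : ℝ × ℝ | w.2 ∈ A}.indicator Ψ (u, y) :=
        integral_prod_symm _ (hΨi.indicator hA2)
    _ = ∫ y in A, smearMoment ψ γ k 0 τ y := by
        rw [← integral_indicator hA]
        refine integral_congr_ae (Eventually.of_forall fun y => ?_)
        by_cases hy : y ∈ A
        · simp [Set.indicator, hy, hΨ, smearMoment]
        · simp [Set.indicator, hy]

end

section

variable (hD : IsClosed D) (hγ : KernelTower m D γ G) (hφ : DensityTower m D C φ) (hC : 0 ≤ C)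
  (hm : 0 < m) (hXs : Measurable Xs) (hξ : Measurable ξ) (hlaw : ErrorLaw ν Xs ξ φ γ)

include hD hγ hφ hC hm

theorem continuous_smearMoment {k : ℕ} (hk : k ≤ m) (τ : ℝ) :
    Continuous (smearMoment φ γ k 0 τ) :=
  continuous_iff_continuousAt.2 fun y => (hasDerivAt_smearMoment hD hγ hφ hC hm hk τ y).continuousAt

include hXs hξ hlaw

omit [IsFiniteMeasure ν] hD hγ hφ hC hm hXs hξ in
theorem ErrorLaw.smearMoment_nonneg (τ y : ℝ) : 0 ≤ smearMoment φ γ 0 0 τ y :=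
  integral_nonneg fun u => by simpa using hlaw.smear_nonneg u (y - τ * u)

theorem ErrorLaw.map_mismeasured (τ : ℝ) : ν.map (mismeasured Xs ξ τ) =
    volume.withDensity fun y => ENNReal.ofReal (smearMoment φ γ 0 0 τ y) := by
  have hX : Measurable (mismeasured Xs ξ τ) := hXs.add (hξ.const_mul τ)
  ext A hA
  obtain ⟨hi, he⟩ := hlaw.setIntegral_eq hD hγ hφ hC hm hXs hξ hφ hC
    (hlaw.integrable_density (hφ.measurable hm)) (κ := fun _ => 1) measurable_const (by simp)
    (Nat.zero_le m) τ hA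
  rw [Measure.map_apply hX hA, withDensity_apply _ hA,
    ← ofReal_integral_eq_lintegral_ofReal hi.integrableOn
      (Eventually.of_forall fun y => hlaw.smearMoment_nonneg τ y), ← he]
  simp [Measure.real]

/-- For `τ = 0` both sides are continuous densities of X*, so they agree almost everywhere and hence
everywhere. Normalization of the error density is thereby obtained at every point where `φ 0` is
positive. -/
theorem ErrorLaw.zeroth (y : ℝ) : smearMoment φ γ 0 0 0 y = φ 0 y := by
  have h := hlaw.map_mismeasured hD hγ hφ hC hm hXs hξ 0
  have e : mismeasured Xs ξ 0 = Xs := by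
    funext ω; simp [mismeasured]
  rw [e, hlaw.density] at h
  have hc := continuous_smearMoment hD hγ hφ hC hm (Nat.zero_le m) 0
  have hcφ : Continuous (φ 0) :=
    continuous_iff_continuousAt.2 fun y => (hφ.hasDerivAt hm y).continuousAt
  have hae := (withDensity_eq_iff hcφ.measurable.ennreal_ofReal.aemeasurable
    hc.measurable.ennreal_ofReal.aemeasurable ?_).1 h
  · have hae2 : smearMoment φ γ 0 0 0 =ᵐ[volume] φ 0 := by
      filter_upwards [hae] with y hy
      exact ((ENNReal.ofReal_eq_ofReal_iff (hlaw.nonneg y)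
        (hlaw.smearMoment_nonneg 0 y)).1 hy).symm
    exact congrFun ((Continuous.ae_eq_iff_eq _ hc hcφ).1 hae2) y
  · have := (hlaw.integrable_density hcφ.measurable)
    rw [← ofReal_integral_eq_lintegral_ofReal this (Eventually.of_forall hlaw.nonneg)]
    exact ENNReal.ofReal_ne_top

theorem ErrorLaw.moment_eq_zero {k : ℕ} (hk : k ≤ m)
    (h0 : ∀ A : Set ℝ, MeasurableSet A → ∫ ω in Xs ⁻¹' A, ξ ω ^ k ∂ν = 0) (y : ℝ) :
    smearMoment φ γ k 0 0 y = 0 := by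
  have e : mismeasured Xs ξ 0 = Xs := by
    funext ω; simp [mismeasured]
  have hs := fun A (hA : MeasurableSet A) => hlaw.setIntegral_eq hD hγ hφ hC hm hXs hξ hφ hC
    (hlaw.integrable_density (hφ.measurable hm)) (κ := fun _ => 1) measurable_const (by simp)
    hk 0 hA
  simp only [e, one_mul] at hs
  have hae : smearMoment φ γ k 0 0 =ᵐ[volume] fun _ => 0 := by
    refine Integrable.ae_eq_of_forall_setIntegral_eq _ _ (hs _ MeasurableSet.univ).1
      (integrable_zero _ _ _) fun A hA _ => ?_
    rw [← (hs A hA).2, h0 A hA]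
    simp
  exact congrFun ((Continuous.ae_eq_iff_eq _ (continuous_smearMoment hD hγ hφ hC hm hk 0)
    continuous_const).1 hae) y

/-- A regression on the mismeasured covariate is the ratio of the smeared weighted regression
and the smeared density. -/
theorem ErrorLaw.regression_mul_density (hψ : DensityTower m D C' ψ) (hC' : 0 ≤ C')
    (hψi : Integrable (ψ 0)) {κ : ℝ → ℝ} (hκ : Measurable κ) (hκψ : ∀ y, ψ 0 y = κ y * φ 0 y)
    (τ : ℝ) {q : ℝ → ℝ} (hq : Measurable q)
    (hqi : Integrable (fun ω => q (mismeasured Xs ξ τ ω)) ν)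
    (h : ∀ A : Set ℝ, MeasurableSet A → ∫ ω in mismeasured Xs ξ τ ⁻¹' A, q (mismeasured Xs ξ τ ω) ∂ν
      = ∫ ω in mismeasured Xs ξ τ ⁻¹' A, κ (Xs ω) ∂ν) :
    (fun y => q y * smearMoment φ γ 0 0 τ y) =ᵐ[volume] smearMoment ψ γ 0 0 τ := by
  have hX : Measurable (mismeasured Xs ξ τ) := hXs.add (hξ.const_mul τ)
  have hs := fun A (hA : MeasurableSet A) => hlaw.setIntegral_eq hD hγ hφ hC hm hXs hξ hψ hC'
    hψi hκ hκψ (Nat.zero_le m) τ hA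
  have hFm := (continuous_smearMoment hD hγ hφ hC hm (Nat.zero_le m) τ).measurable
  have hnn := hlaw.smearMoment_nonneg τ
  have hmap := hlaw.map_mismeasured hD hγ hφ hC hm hXs hξ τ
  have hint : Integrable (fun y => q y * smearMoment φ γ 0 0 τ y) := by
    have h1 := (integrable_map_measure hq.aestronglyMeasurable hX.aemeasurable).2 hqi
    rw [hmap, integrable_withDensity_iff hFm.ennreal_ofReal
      (Eventually.of_forall fun _ => ENNReal.ofReal_lt_top)] at h1
    refine h1.congr (Eventually.of_forall fun y => ?_)
    simp only [ENNReal.toReal_ofReal (hnn y)]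
  -- Both functions have the same integral over every measurable set.
  refine Integrable.ae_eq_of_forall_setIntegral_eq _ _ hint (hs _ MeasurableSet.univ).1
    fun A hA _ => ?_
  rw [← (hs A hA).2]
  simp only [pow_zero, mul_one]
  rw [← h A hA, ← setIntegral_map hA hq.aestronglyMeasurable hX.aemeasurable, hmap,
    setIntegral_withDensity_eq_setIntegral_toReal_smul₀ hFm.ennreal_ofReal.aemeasurable
      (Eventually.of_forall fun _ => ENNReal.ofReal_lt_top) _ hA]
  refine integral_congr_ae (Eventually.of_forall fun y => ?_)
  simp only [ENNReal.toReal_ofReal (hnn y), smul_eq_mul, mul_comm]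

end

end SmallME
end

/-! ### From the model to density and kernel towers. -/

noncomputable section

namespace SmallME

/-- The derivatives in the second variable of a conditional density. -/
def kernelDerivs (g : ℝ → ℝ → ℝ) (D : Set ℝ) (j : ℕ) (u y : ℝ) : ℝ :=
  iteratedDerivWithin j (g u) D y

/-- A bound for the derivatives of a conditional density, uniform in the second variable. -/
def envelope (g : ℝ → ℝ → ℝ) (D : Set ℝ) (m : ℕ) (u : ℝ) : ℝ :=
  ∑ l ∈ Finset.range (m + 1), ⨆ x : D, |iteratedDerivWithin l (g u) D (x : ℝ)|

/-- The derivatives of a function on `ℝ`. -/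
def lineDerivs (h : ℝ → ℝ) (k : ℕ) (y : ℝ) : ℝ := iteratedDerivWithin k h Set.univ y

theorem lineDerivs_zero (h : ℝ → ℝ) : lineDerivs h 0 = h :=
  funext fun y => by simp [lineDerivs]

theorem kernelDerivs_zero (g : ℝ → ℝ → ℝ) (D : Set ℝ) : kernelDerivs g D 0 = g :=
  funext fun u => funext fun y => by simp [kernelDerivs]

variable {Ω 𝒵 : Type*} [MeasurableSpace Ω] [MeasurableSpace 𝒵] {μ : Measure Ω}

/-- The derivatives of the mixture of the conditional densities. -/
def mixDerivs (μ : Measure Ω) (Z : Ω → 𝒵) (f : 𝒵 → ℝ → ℝ) (k : ℕ) (y : ℝ) : ℝ :=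
  ∑' z, (μ (Z ⁻¹' {z})).toReal * lineDerivs (f z) k y

/-- Lower moments follow from the `m`-th: for `|u| ≤ 1` the bound `C` is used, elsewhere `|u| ^ k ≤
|u| ^ m`. -/
theorem integrable_pow_mul_of_bounded {m k : ℕ} (hk : k ≤ m) {s : ℝ → ℝ} {C : ℝ}
    (h0 : ∀ u, 0 ≤ s u) (hC : ∀ u, s u ≤ C) (h : Integrable (fun u => |u| ^ m * s u)) :
    Integrable (fun u => |u| ^ k * s u) := by
  have hC0 : 0 ≤ C := (h0 0).trans (hC 0)
  -- Measurability of `s`, which may be a supremum over an uncountable set, is recovered from the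
  -- integrable product by dividing by `|u| ^ m` off `u = 0`.
  have hsm : AEStronglyMeasurable s volume := by
    have h1 : AEStronglyMeasurable (fun u : ℝ => (|u| ^ m)⁻¹ * (|u| ^ m * s u)) volume :=
      ((measurable_id.abs.pow_const m).inv.aestronglyMeasurable).mul h.aestronglyMeasurable
    refine h1.congr ?_
    have : ∀ᵐ u : ℝ, u ≠ 0 := by simp [ae_iff]
    filter_upwards [this] with u hu
    have : |u| ^ m ≠ 0 := by positivity
    field_simp
  have hind : Integrable ((Set.Icc (-1 : ℝ) 1).indicator fun _ => C) :=
    (integrable_indicator_iff measurableSet_Icc).2 (integrableOn_const (by simp))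
  refine (hind.add h).mono' ?_ (Eventually.of_forall fun u => ?_)
  · exact ((measurable_id.abs.pow_const k).aestronglyMeasurable).mul hsm
  · have hs := h0 u
    rw [Real.norm_eq_abs, abs_of_nonneg (by positivity)]
    by_cases hu : u ∈ Set.Icc (-1 : ℝ) 1
    · simp only [Pi.add_apply, Set.indicator_of_mem hu]
      have hu1 : |u| ≤ 1 := abs_le.2 hu
      have : |u| ^ k ≤ 1 := pow_le_one₀ (abs_nonneg u) hu1
      have h3 : |u| ^ k * s u ≤ 1 * C := mul_le_mul this (hC u) hs zero_le_one
      have : 0 ≤ |u| ^ m * s u := by positivity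
      linarith
    · simp only [Pi.add_apply, Set.indicator_of_notMem hu, zero_add]
      have hu1 : 1 ≤ |u| := by
        by_contra hlt
        exact hu (abs_le.1 (not_le.1 hlt).le)
      exact mul_le_mul_of_nonneg_right (pow_le_pow_right₀ hu1 hk) hs

theorem DensityTower.of_le {m : ℕ} {D : Set ℝ} {C C' : ℝ} {a : ℕ → ℝ → ℝ}
    (h : DensityTower m D C a) (hC : C ≤ C') : DensityTower m D C' a :=
  ⟨⟨h.hasDeriv, fun k hk y hy => (h.bound k hk y hy).trans hC⟩, h.eq_zero⟩

theorem summable_prob [IsProbabilityMeasure μ] [Countable 𝒵] [MeasurableSingletonClass 𝒵]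
    {Z : Ω → 𝒵} (hZ : Measurable Z) : Summable fun z => (μ (Z ⁻¹' {z})).toReal := by
  refine ENNReal.summable_toReal ?_
  have h := tsum_measure_preimage_singleton (μ := μ) (f := Z) Set.countable_univ
    (fun z _ => hZ (measurableSet_singleton z))
  rw [tsum_univ (f := fun z => μ (Z ⁻¹' {z}))] at h
  rw [h]
  exact measure_ne_top _ _

/-- The law of a random element is the mixture of its conditional laws. -/
theorem map_eq_withDensity_tsum [IsProbabilityMeasure μ] [Countable 𝒵]
    [MeasurableSingletonClass 𝒵] {Z : Ω → 𝒵} (hZ : Measurable Z) {E : Type*} [MeasurableSpace E]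
    {V : Ω → E} (hV : Measurable V) {l : Measure E} {d : 𝒵 → E → ℝ≥0∞} {d' : E → ℝ≥0∞}
    (hd : ∀ z, μ (Z ⁻¹' {z}) ≠ 0 → Measurable (d z))
    (h : ∀ z, μ (Z ⁻¹' {z}) ≠ 0 → (cond μ (Z ⁻¹' {z})).map V = l.withDensity (d z))
    (hd' : ∀ e, d' e = ∑' z, μ (Z ⁻¹' {z}) * d z e) : μ.map V = l.withDensity d' := by
  ext S hS
  rw [Measure.map_apply hV hS, withDensity_apply _ hS]
  have hsum := tsum_measure_preimage_singleton (μ := μ.restrict (V ⁻¹' S)) (f := Z)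
    Set.countable_univ (fun z _ => hZ (measurableSet_singleton z))
  rw [tsum_univ (f := fun z => μ.restrict (V ⁻¹' S) (Z ⁻¹' {z}))] at hsum
  rw [Set.preimage_univ, Measure.restrict_apply_univ] at hsum
  rw [← hsum]
  simp_rw [hd']
  rw [lintegral_tsum]
  · congr 1
    funext z
    by_cases hz : μ (Z ⁻¹' {z}) = 0
    · simp only [hz, zero_mul, lintegral_zero]
      exact le_antisymm ((Measure.restrict_apply_le _ _).trans hz.le) bot_le
    · rw [lintegral_const_mul _ (hd z hz), ← withDensity_apply _ hS, ← h z hz,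
        Measure.map_apply hV hS, cond_apply (hZ (measurableSet_singleton z)),
        ← mul_assoc, ENNReal.mul_inv_cancel hz (measure_ne_top _ _), one_mul,
        Measure.restrict_apply (hZ (measurableSet_singleton z))]
  · intro z
    by_cases hz : μ (Z ⁻¹' {z}) = 0
    · simp [hz]
    · exact ((hd z hz).const_mul _).aemeasurable

namespace WCMEModel

variable [IsProbabilityMeasure μ] {Y Xs ξ : Ω → ℝ} {Z : Ω → 𝒵} {ρ : ℝ → ℝ} {f : 𝒵 → ℝ → ℝ}
  {g : ℝ → ℝ → ℝ} {m : ℕ} {D : Set ℝ}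

theorem kernelTower (h : WCMEModel μ Y Xs ξ Z ρ f g m D) :
    KernelTower m D (kernelDerivs g D) (envelope g D m) := by
  obtain ⟨C, hC⟩ := h.smooth_g
  have hnn : ∀ l u, 0 ≤ ⨆ x : D, |iteratedDerivWithin l (g u) D (x : ℝ)| := fun l u =>
    Real.iSup_nonneg fun x => abs_nonneg _
  refine ⟨fun u => ⟨(hC u).tower.hasDeriv, fun k hk y hy => ?_⟩, fun u => ?_, fun k hk => ?_, ?_⟩
  · refine (le_ciSup (f := fun x : D => |iteratedDerivWithin k (g u) D (x : ℝ)|)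
      ⟨C, ?_⟩ ⟨y, hy⟩).trans ?_
    · rintro _ ⟨x, rfl⟩
      exact (hC u).2 k hk x x.2
    · exact Finset.single_le_sum
        (f := fun l => ⨆ x : D, |iteratedDerivWithin l (g u) D (x : ℝ)|)
        (fun l _ => hnn l u) (Finset.mem_range.2 (by omega))
  · exact Finset.sum_nonneg fun l _ => hnn l u
  · simp only [envelope, Finset.mul_sum]
    refine integrable_finsetSum _ fun l hl => ?_
    have hl : l ≤ m := by
      have := Finset.mem_range.1 hl
      omega
    refine integrable_pow_mul_of_bounded hk (hnn l) (C := |C|) (fun u => ?_) (h.dominance l hl)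
    exact Real.iSup_le (fun x => ((hC u).2 l hl x x.2).trans (le_abs_self C)) (abs_nonneg C)
  · simpa [kernelDerivs] using h.measurable_g

variable [MeasurableSingletonClass 𝒵]

/-- The two alternatives serve two uses: the complement of `D`, null for X*, and the exceptional set
of the conditional law of ξ, null only jointly with `Z = z`. -/
theorem cond_density (h : WCMEModel μ Y Xs ξ Z ρ f g m D) {z : 𝒵} (hz : μ (Z ⁻¹' {z}) ≠ 0)
    (S : Set ℝ) (hS : MeasurableSet S) (h0 : μ.map Xs S = 0 ∨ μ (Xs ⁻¹' S ∩ Z ⁻¹' {z}) = 0) :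
    ∀ᵐ y, y ∈ S → f z y = 0 := by
  obtain ⟨hm, hnn, hlaw⟩ := h.density_Xs z hz
  have hX := h.measurable_Xs
  have h1 : μ (Xs ⁻¹' S ∩ Z ⁻¹' {z}) = 0 := by
    rcases h0 with h0 | h0
    · rw [Measure.map_apply hX hS] at h0
      exact measure_mono_null Set.inter_subset_left h0
    · exact h0
  have h2 : (cond μ (Z ⁻¹' {z})).map Xs S = 0 := by
    rw [Measure.map_apply hX hS, cond_apply (h.measurable_Z (measurableSet_singleton z)),
      Set.inter_comm, h1, mul_zero]
  rw [hlaw, withDensity_apply _ hS, lintegral_eq_zero_iff hm.ennreal_ofReal,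
    Filter.EventuallyEq, ae_restrict_iff' hS] at h2
  filter_upwards [h2] with y hy hyS
  have := hy hyS
  simp only [Pi.zero_apply, ENNReal.ofReal_eq_zero] at this
  exact le_antisymm this (hnn y)

/-- The density vanishes almost everywhere on the open set `Dᶜ`, hence everywhere there by
continuity. -/
theorem densityTower (h : WCMEModel μ Y Xs ξ Z ρ f g m D) (hm : 0 < m) {C : ℝ} {z : 𝒵}
    (hz : μ (Z ⁻¹' {z}) ≠ 0) (hC : BoundedDerivsOn m Set.univ C (f z)) :
    DensityTower m D C (lineDerivs (f z)) := by
  have ht := hC.tower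
  refine ht.densityTower h.closed_D fun y hy => ?_
  have hcont : Continuous (f z) := by
    have := continuous_iff_continuousAt.2 fun y => (ht.hasDerivAt hm y).continuousAt
    simpa using this
  have hae := h.cond_density hz Dᶜ h.closed_D.measurableSet.compl
    (Or.inl (measure_mono_null (Set.compl_subset_compl.2 h.support_Xs)
      Measure.measure_compl_support))
  have hden : Dense {y | y ∈ Dᶜ → f z y = 0} := Measure.dense_of_ae hae
  simp only [iteratedDerivWithin_zero]
  by_contra hne
  have hopen : IsOpen (Dᶜ ∩ {y | f z y ≠ 0}) :=
    h.closed_D.isOpen_compl.inter (isOpen_ne_fun hcont continuous_const)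
  obtain ⟨y', h1, h2⟩ := hden.inter_open_nonempty _ hopen ⟨y, hy, hne⟩
  exact h1.2 (h2 h1.1)

/-- A bound uniform in `z` and summable probabilities allow termwise differentiation of the mixture.
Values of `Z` of probability zero, where `f z` is arbitrary, have weight zero. -/
theorem exists_densityTower [Countable 𝒵] (h : WCMEModel μ Y Xs ξ Z ρ f g m D) (hm : 0 < m) :
    ∃ C, 0 ≤ C ∧ (∀ z, μ (Z ⁻¹' {z}) ≠ 0 → DensityTower m D C (lineDerivs (f z))) ∧
      DensityTower m D C (mixDerivs μ Z f) := by
  obtain ⟨C₀, hC₀⟩ := h.smooth_f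
  have hw := summable_prob (μ := μ) h.measurable_Z
  have hw0 : ∀ z, 0 ≤ (μ (Z ⁻¹' {z})).toReal := fun z => ENNReal.toReal_nonneg
  have hz' : ∀ z, μ (Z ⁻¹' {z}) ≠ 0 → DensityTower m D |C₀| (lineDerivs (f z)) := by
    intro z hz
    exact (h.densityTower hm hz (hC₀ z hz)).of_le (le_abs_self _)
  have hterm : ∀ z, ∀ k ≤ m, ∀ y,
      |(μ (Z ⁻¹' {z})).toReal * lineDerivs (f z) k y| ≤ (μ (Z ⁻¹' {z})).toReal * |C₀| := by
    intro z k hk y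
    rw [abs_mul, abs_of_nonneg (hw0 z)]
    by_cases hz : μ (Z ⁻¹' {z}) = 0
    · simp [hz]
    · exact mul_le_mul_of_nonneg_left ((hz' z hz).bound k hk y (Set.mem_univ y)) (hw0 z)
  have hsum : ∀ k ≤ m, ∀ y,
      Summable fun z => (μ (Z ⁻¹' {z})).toReal * lineDerivs (f z) k y := fun k hk y =>
    Summable.of_norm_bounded (hw.mul_right |C₀|) fun z => hterm z k hk y
  set S := ∑' z, (μ (Z ⁻¹' {z})).toReal with hS
  have hS0 : 0 ≤ S := tsum_nonneg hw0
  refine ⟨max |C₀| (S * |C₀|), le_max_of_le_left (abs_nonneg _), fun z hz => ?_, ?_⟩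
  · exact (hz' z hz).of_le (le_max_left _ _)
  · refine ⟨⟨fun k hk y _ => ?_, fun k hk y _ => ?_⟩, fun k hk y hy => ?_⟩
    · refine HasDerivAt.hasDerivWithinAt ?_
      have hd : ∀ z y, HasDerivAt (fun y => (μ (Z ⁻¹' {z})).toReal * lineDerivs (f z) k y)
          ((μ (Z ⁻¹' {z})).toReal * lineDerivs (f z) (k + 1) y) y := by
        intro z y
        by_cases hz : μ (Z ⁻¹' {z}) = 0
        · simp only [hz, ENNReal.toReal_zero, zero_mul]
          exact hasDerivAt_const y (0 : ℝ)
        · exact ((hz' z hz).hasDerivAt hk y).const_mul _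
      exact hasDerivAt_tsum (hw.mul_right |C₀|) hd (fun z y => hterm z (k + 1) hk y)
        (hsum k hk.le 0) y
    · refine le_trans ?_ (le_max_right _ _)
      rw [hS, ← tsum_mul_right, ← Real.norm_eq_abs]
      exact tsum_of_norm_bounded (hw.mul_right |C₀|).hasSum fun z => hterm z k hk y
    · rw [mixDerivs]
      convert tsum_zero with z
      by_cases hz : μ (Z ⁻¹' {z}) = 0
      · simp [hz]
      · rw [(hz' z hz).eq_zero k hk y hy, mul_zero]

end WCMEModel

end SmallME
end

/-! ### Error laws given `Z = z` and unconditionally. -/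

noncomputable section

namespace SmallME

namespace WCMEModel

variable {Ω 𝒵 : Type*} [MeasurableSpace Ω] [MeasurableSpace 𝒵] {μ : Measure Ω}
  [IsProbabilityMeasure μ] {Y Xs ξ : Ω → ℝ} {Z : Ω → 𝒵} {ρ : ℝ → ℝ} {f : 𝒵 → ℝ → ℝ}
  {g : ℝ → ℝ → ℝ} {m : ℕ} {D : Set ℝ} [MeasurableSingletonClass 𝒵]

/-- The kernel is nonnegative only for almost every value of X*. On the exceptional set the density
vanishes almost everywhere, so the product is nonnegative on a dense set, and everywhere by
continuity. -/
theorem mul_kernel_nonneg (h : WCMEModel μ Y Xs ξ Z ρ f g m D) (hm : 0 < m) {z : 𝒵}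
    (hz : μ (Z ⁻¹' {z}) ≠ 0) (u y : ℝ) : 0 ≤ smear (lineDerivs (f z)) (kernelDerivs g D) 0 u y := by
  obtain ⟨C, hC⟩ := h.smooth_f
  have hφ := (h.densityTower hm hz (hC z hz)).of_le (le_abs_self C)
  have hcont : Continuous (smear (lineDerivs (f z)) (kernelDerivs g D) 0 u) :=
    continuous_iff_continuousAt.2 fun y =>
      ((hφ.smear h.closed_D h.kernelTower (abs_nonneg C) u).hasDerivAt hm y).continuousAt
  have hW : Measurable fun ω => (Xs ω, Z ω) := h.measurable_Xs.prodMk h.measurable_Z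
  set B := {w : ℝ × 𝒵 | ¬ ∀ u, 0 ≤ g u w.1} with hB
  have hB0 : μ.map (fun ω => (Xs ω, Z ω)) B = 0 := by
    have := h.density_ξ.mono fun w hw => hw.1
    exact this
  obtain ⟨N, hBN, hN, hN0⟩ := exists_measurable_superset_of_null hB0
  have hS : MeasurableSet {y | (y, z) ∈ N} := measurable_prodMk_right hN
  have h1 : μ (Xs ⁻¹' {y | (y, z) ∈ N} ∩ Z ⁻¹' {z}) = 0 := by
    rw [Measure.map_apply hW hN] at hN0
    refine measure_mono_null ?_ hN0
    rintro ω ⟨hω1, hω2⟩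
    have hω2 : Z ω = z := hω2
    simp only [Set.mem_preimage, Set.mem_ofPred_eq] at hω1 ⊢
    rwa [hω2]
  have hae := h.cond_density hz _ hS (Or.inr h1)
  have hden : Dense {y | y ∈ {y | (y, z) ∈ N} → f z y = 0} := Measure.dense_of_ae hae
  have hsub : {y | y ∈ {y | (y, z) ∈ N} → f z y = 0} ⊆
      {y | 0 ≤ smear (lineDerivs (f z)) (kernelDerivs g D) 0 u y} := by
    intro y hy
    simp only [smear, mulTower, lineDerivs_zero, kernelDerivs_zero, Set.mem_ofPred_eq] at hy ⊢
    by_cases hyN : (y, z) ∈ N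
    · rw [hy hyN, zero_mul]
    · have : ∀ u, 0 ≤ g u y := by
        by_contra hcon
        exact hyN (hBN hcon)
      exact mul_nonneg ((h.density_Xs z hz).2.1 y) (this u)
  have hcl : IsClosed {y | 0 ≤ smear (lineDerivs (f z)) (kernelDerivs g D) 0 u y} :=
    isClosed_le continuous_const hcont
  exact closure_minimal hsub hcl (hden y)

/-- Disintegration of ξ over (X*, Z), restricted to `Z = z`, followed by Tonelli; the kernel being
free of `z`, the same `g` serves every conditional law. -/
theorem errorLaw_cond (h : WCMEModel μ Y Xs ξ Z ρ f g m D) (hm : 0 < m) {z : 𝒵}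
    (hz : μ (Z ⁻¹' {z}) ≠ 0) :
    ErrorLaw (cond μ (Z ⁻¹' {z})) Xs ξ (lineDerivs (f z)) (kernelDerivs g D) := by
  obtain ⟨hfm, hfn, hlaw⟩ := h.density_Xs z hz
  refine ⟨by simpa only [lineDerivs_zero] using hfn, h.mul_kernel_nonneg hm hz, by simpa only [lineDerivs_zero] using hlaw, ?_⟩
  have hZz := h.measurable_Z (measurableSet_singleton z)
  have hW : Measurable fun ω => (Xs ω, Z ω) := h.measurable_Xs.prodMk h.measurable_Z
  have hg : Measurable fun w : ℝ × ℝ => ENNReal.ofReal (g w.1 w.2) := h.measurable_g.ennreal_ofReal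
  ext S hS
  set I : ℝ → ℝ≥0∞ := fun y => ∫⁻ u, S.indicator (fun w => ENNReal.ofReal (g w.1 w.2)) (u, y)
    with hI
  have hSg : Measurable (S.indicator fun w : ℝ × ℝ => ENNReal.ofReal (g w.1 w.2)) := hg.indicator hS
  have hIm : Measurable I := hSg.lintegral_prod_left'
  have key : μ ((fun ω => (ξ ω, Xs ω)) ⁻¹' S ∩ Z ⁻¹' {z}) = ∫⁻ ω in Z ⁻¹' {z}, I (Xs ω) ∂μ := by
    set T : Set ((ℝ × 𝒵) × ℝ) := {w | (w.2, w.1.1) ∈ S ∧ w.1.2 = z} with hT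
    have hTm : MeasurableSet T :=
      (hS.preimage (measurable_snd.prodMk (measurable_fst.comp measurable_fst))).inter
        ((measurable_snd.comp measurable_fst) (measurableSet_singleton z))
    have e1 : (fun ω => (ξ ω, Xs ω)) ⁻¹' S ∩ Z ⁻¹' {z} =
        (fun ω => ((Xs ω, Z ω), ξ ω)) ⁻¹' T := by
      ext ω; simp [hT]
    have e3 : MeasurableSet {w : ℝ × 𝒵 | w.2 = z} := measurable_snd (measurableSet_singleton z)
    rw [e1, ← Measure.map_apply (hW.prodMk h.measurable_ξ) hTm,
      ← compProd_map_condDistrib h.measurable_ξ.aemeasurable, Measure.compProd_apply hTm]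
    have e2 : ∀ᵐ w ∂μ.map (fun ω => (Xs ω, Z ω)),
        condDistrib ξ (fun ω => (Xs ω, Z ω)) μ w (Prod.mk w ⁻¹' T) =
          {w : ℝ × 𝒵 | w.2 = z}.indicator (fun w => I w.1) w := by
      filter_upwards [h.density_ξ] with w hw
      rw [hw.2, withDensity_apply _ (measurable_prodMk_left hTm),
        ← lintegral_indicator (measurable_prodMk_left hTm)]
      by_cases hwz : w.2 = z
      · rw [Set.indicator_of_mem (show w ∈ {w : ℝ × 𝒵 | w.2 = z} from hwz)]
        refine lintegral_congr fun u => ?_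
        by_cases hu : (u, w.1) ∈ S
        · rw [Set.indicator_of_mem (show u ∈ Prod.mk w ⁻¹' T from ⟨hu, hwz⟩),
            Set.indicator_of_mem hu]
        · rw [Set.indicator_of_notMem (show u ∉ Prod.mk w ⁻¹' T from fun hc => hu hc.1),
            Set.indicator_of_notMem hu]
      · rw [Set.indicator_of_notMem (show w ∉ {w : ℝ × 𝒵 | w.2 = z} from hwz)]
        refine (lintegral_congr fun u => ?_).trans lintegral_zero
        exact Set.indicator_of_notMem (show u ∉ Prod.mk w ⁻¹' T from fun hc => hwz hc.2) _
    have hIf : Measurable fun w : ℝ × 𝒵 => I w.1 := hIm.comp measurable_fst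
    rw [lintegral_congr_ae e2, lintegral_map (hIf.indicator e3) hW, ← lintegral_indicator hZz]
    rfl
  rw [Measure.map_apply (h.measurable_ξ.prodMk h.measurable_Xs) hS, withDensity_apply _ hS,
    cond_apply hZz, Set.inter_comm, key, ← lintegral_indicator hS]
  have e4 : (μ (Z ⁻¹' {z}))⁻¹ * ∫⁻ ω in Z ⁻¹' {z}, I (Xs ω) ∂μ
      = ∫⁻ ω, I (Xs ω) ∂(cond μ (Z ⁻¹' {z})) := by
    rw [ProbabilityTheory.cond, lintegral_smul_measure]
    rfl
  have hsm : Measurable fun w : ℝ × ℝ =>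
      ENNReal.ofReal (smear (lineDerivs (f z)) (kernelDerivs g D) 0 w.1 w.2) := by
    simp only [smear, mulTower, lineDerivs_zero, kernelDerivs_zero]
    exact ((hfm.comp measurable_snd).mul h.measurable_g).ennreal_ofReal
  rw [e4, ← lintegral_map hIm h.measurable_Xs, hlaw,
    lintegral_withDensity_eq_lintegral_mul _ hfm.ennreal_ofReal hIm, Measure.volume_eq_prod,
    lintegral_prod_symm' _ (hsm.indicator hS)]
  refine lintegral_congr fun y => ?_
  simp only [Pi.mul_apply, hI]
  have hSy : Measurable fun u => S.indicator (fun w => ENNReal.ofReal (g w.1 w.2)) (u, y) :=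
    hSg.comp measurable_prodMk_right
  rw [← lintegral_const_mul _ hSy]
  refine lintegral_congr fun u => ?_
  by_cases hw : (u, y) ∈ S
  · simp only [Set.indicator_of_mem hw, smear, mulTower, lineDerivs_zero, kernelDerivs_zero]
    rw [ENNReal.ofReal_mul (hfn y)]
  · simp only [Set.indicator_of_notMem hw, mul_zero]

theorem errorLaw_mix [Countable 𝒵] (h : WCMEModel μ Y Xs ξ Z ρ f g m D) (hm : 0 < m) :
    ErrorLaw μ Xs ξ (mixDerivs μ Z f) (kernelDerivs g D) := by
  obtain ⟨C, hC0, hC, hCm⟩ := h.exists_densityTower hm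
  have hγ := h.kernelTower
  have hw := summable_prob (μ := μ) h.measurable_Z
  have hterm : ∀ z y, ‖(μ (Z ⁻¹' {z})).toReal * lineDerivs (f z) 0 y‖
      ≤ (μ (Z ⁻¹' {z})).toReal * C := by
    intro z y
    rw [norm_mul, Real.norm_of_nonneg ENNReal.toReal_nonneg]
    by_cases hz : μ (Z ⁻¹' {z}) = 0
    · simp [hz]
    · exact mul_le_mul_of_nonneg_left ((hC z hz).bound 0 (Nat.zero_le m) y (Set.mem_univ y))
        ENNReal.toReal_nonneg
  have hsum : ∀ y, Summable fun z => (μ (Z ⁻¹' {z})).toReal * lineDerivs (f z) 0 y := fun y =>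
    Summable.of_norm_bounded (hw.mul_right C) fun z => hterm z y
  have hnn : ∀ z y, 0 ≤ (μ (Z ⁻¹' {z})).toReal * lineDerivs (f z) 0 y := by
    intro z y
    by_cases hz : μ (Z ⁻¹' {z}) = 0
    · simp [hz]
    · exact mul_nonneg ENNReal.toReal_nonneg ((h.errorLaw_cond hm hz).nonneg y)
  have hsm : ∀ u y, smear (mixDerivs μ Z f) (kernelDerivs g D) 0 u y =
      ∑' z, (μ (Z ⁻¹' {z})).toReal * smear (lineDerivs (f z)) (kernelDerivs g D) 0 u y := by
    intro u y
    simp only [smear, mulTower, mixDerivs]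
    rw [← tsum_mul_right]
    simp only [mul_assoc]
  have hnn2 : ∀ z u y, 0 ≤ (μ (Z ⁻¹' {z})).toReal *
      smear (lineDerivs (f z)) (kernelDerivs g D) 0 u y := by
    intro z u y
    by_cases hz : μ (Z ⁻¹' {z}) = 0
    · simp [hz]
    · exact mul_nonneg ENNReal.toReal_nonneg ((h.errorLaw_cond hm hz).smear_nonneg u y)
  have hsum2 : ∀ u y, Summable fun z => (μ (Z ⁻¹' {z})).toReal *
      smear (lineDerivs (f z)) (kernelDerivs g D) 0 u y := by
    intro u y
    simp only [smear, mulTower, ← mul_assoc]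
    exact (hsum y).mul_right _
  refine ⟨fun y => tsum_nonneg fun z => hnn z y, fun u y => ?_, ?_, ?_⟩
  · rw [hsm]
    exact tsum_nonneg fun z => hnn2 z u y
  · refine map_eq_withDensity_tsum h.measurable_Z h.measurable_Xs
      (d := fun z y => ENNReal.ofReal (lineDerivs (f z) 0 y))
      (fun z hz => ((hC z hz).measurable hm).ennreal_ofReal)
      (fun z hz => (h.errorLaw_cond hm hz).density) fun y => ?_
    rw [mixDerivs, ENNReal.ofReal_tsum_of_nonneg (fun z => hnn z y) (hsum y)]
    congr 1
    funext z
    rw [ENNReal.ofReal_mul ENNReal.toReal_nonneg, ENNReal.ofReal_toReal (measure_ne_top _ _)]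
  · refine map_eq_withDensity_tsum h.measurable_Z (h.measurable_ξ.prodMk h.measurable_Xs)
      (d := fun z w => ENNReal.ofReal (smear (lineDerivs (f z)) (kernelDerivs g D) 0 w.1 w.2))
      (fun z hz => (measurable_smear h.closed_D hγ (hC z hz) hC0 hm (Nat.zero_le m)).ennreal_ofReal)
      (fun z hz => (h.errorLaw_cond hm hz).joint) fun w => ?_
    rw [hsm, ENNReal.ofReal_tsum_of_nonneg (fun z => hnn2 z _ _) (hsum2 _ _)]
    congr 1
    funext z
    rw [ENNReal.ofReal_mul ENNReal.toReal_nonneg, ENNReal.ofReal_toReal (measure_ne_top _ _)]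

theorem mixDerivs_zero_pos [Countable 𝒵] (h : WCMEModel μ Y Xs ξ Z ρ f g m D) (hm : 0 < m) {z : 𝒵}
    (hz : μ (Z ⁻¹' {z}) ≠ 0) {y : ℝ} (hy : f z y ≠ 0) : 0 < mixDerivs μ Z f 0 y := by
  obtain ⟨C, hC0, hC, hCm⟩ := h.exists_densityTower hm
  have hw := summable_prob (μ := μ) h.measurable_Z
  have hterm : ∀ z y, ‖(μ (Z ⁻¹' {z})).toReal * lineDerivs (f z) 0 y‖
      ≤ (μ (Z ⁻¹' {z})).toReal * C := by
    intro z y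
    rw [norm_mul, Real.norm_of_nonneg ENNReal.toReal_nonneg]
    by_cases hz : μ (Z ⁻¹' {z}) = 0
    · simp [hz]
    · exact mul_le_mul_of_nonneg_left ((hC z hz).bound 0 (Nat.zero_le m) y (Set.mem_univ y))
        ENNReal.toReal_nonneg
  have hsum : Summable fun z => (μ (Z ⁻¹' {z})).toReal * lineDerivs (f z) 0 y :=
    Summable.of_norm_bounded (hw.mul_right C) fun z => hterm z y
  refine hsum.tsum_pos (fun z => ?_) z ?_
  · by_cases hz : μ (Z ⁻¹' {z}) = 0
    · simp [hz]
    · exact mul_nonneg ENNReal.toReal_nonneg ((h.errorLaw_cond hm hz).nonneg y)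
  · refine mul_pos (ENNReal.toReal_pos hz (measure_ne_top _ _)) ?_
    simp only [lineDerivs_zero]
    exact lt_of_le_of_ne ((h.density_Xs z hz).2.1 y) hy.symm

end WCMEModel

end SmallME
end

/-! ### Versions of the observable regressions, and the moment conditions. -/

noncomputable section

namespace SmallME

/-- Two functions continuous on an open set and equal almost everywhere agree throughout it. -/
theorem eventuallyEq_of_ae_eq {h k : ℝ → ℝ} {x : ℝ} (hk : h =ᵐ[volume] k)
    (ch : ∀ᶠ y in 𝓝 x, ContinuousAt h y) (ck : ∀ᶠ y in 𝓝 x, ContinuousAt k y) : h =ᶠ[𝓝 x] k := by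
  obtain ⟨U, hU, hUo, hxU⟩ := eventually_nhds_iff.1 (ch.and ck)
  have h1 : Set.EqOn h k U := Measure.eqOn_open_of_ae_eq (ae_restrict_of_ae hk) hUo
    (fun y hy => (hU y hy).1.continuousWithinAt) (fun y hy => (hU y hy).2.continuousWithinAt)
  filter_upwards [hUo.mem_nhds hxU] with y hy using h1 hy

theorem smearMoment_zero_zero (φ : ℕ → ℝ → ℝ) (γ : ℕ → ℝ → ℝ → ℝ) (k : ℕ) (y : ℝ) :
    smearMoment φ γ k 0 0 y = φ 0 y * ∫ u, u ^ k * γ 0 u y := by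
  rw [smearMoment, ← integral_const_mul]
  refine integral_congr_ae (Eventually.of_forall fun u => ?_)
  simp only [zero_mul, sub_zero, smear, mulTower]
  ring

theorem setIntegral_cond_eq {Ω : Type*} [MeasurableSpace Ω] {μ : Measure Ω} {s T : Set Ω}
    (hT : MeasurableSet T) (F : Ω → ℝ) :
    ∫ ω in T, F ω ∂(cond μ s) = ((μ s)⁻¹).toReal * ∫ ω in T ∩ s, F ω ∂μ := by
  rw [ProbabilityTheory.cond, Measure.restrict_smul, integral_smul_measure,
    Measure.restrict_restrict hT, smul_eq_mul]

theorem ae_cond_iff {Ω : Type*} [MeasurableSpace Ω] {μ : Measure Ω} [IsFiniteMeasure μ] {s : Set Ω}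
    (hs : MeasurableSet s) {P : Ω → Prop} :
    (∀ᵐ ω ∂(cond μ s), P ω) ↔ ∀ᵐ ω ∂μ, ω ∈ s → P ω := by
  rw [ProbabilityTheory.cond, Measure.ae_ennreal_smul_measure_iff, ae_restrict_iff' hs]
  exact ENNReal.inv_ne_zero.2 (measure_ne_top _ _)

namespace WCMEModel

variable {Ω 𝒵 : Type*} [MeasurableSpace Ω] [MeasurableSpace 𝒵] {μ : Measure Ω}
  [IsProbabilityMeasure μ] {Y Xs ξ : Ω → ℝ} {Z : Ω → 𝒵} {ρ : ℝ → ℝ} {f : 𝒵 → ℝ → ℝ}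
  {g : ℝ → ℝ → ℝ} {m : ℕ} {D : Set ℝ}

/-- The regression function, made to vanish off `D`. -/
def regOn (D : Set ℝ) (ρ : ℝ → ℝ) : ℝ → ℝ := D.indicator ρ

theorem regOn_of_mem {y : ℝ} (hy : y ∈ D) : regOn D ρ y = ρ y := Set.indicator_of_mem hy _

theorem regOn_of_notMem {y : ℝ} (hy : y ∉ D) : regOn D ρ y = 0 := Set.indicator_of_notMem hy _

/-- The derivatives of the regression function on `D`. -/
def regDerivs (D : Set ℝ) (ρ : ℝ → ℝ) (k : ℕ) (y : ℝ) : ℝ := iteratedDerivWithin k ρ D y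

/-- Off `D` the function `ρ` is unconstrained, even as to measurability; its truncation has the same
values along X* almost surely. -/
theorem measurable_regOn (h : WCMEModel μ Y Xs ξ Z ρ f g m D) (hm : 0 < m) :
    Measurable (regOn D ρ) := by
  obtain ⟨B, hB⟩ := h.smooth_ρ
  have hc : ContinuousOn ρ D := by
    have := hB.tower.continuousOn hm
    simpa using this
  classical
  have := hc.measurable_piecewise (g := 0) continuousOn_const h.closed_D.measurableSet
  rwa [Set.piecewise_eq_indicator] at this

theorem ae_regOn (h : WCMEModel μ Y Xs ξ Z ρ f g m D) :
    (fun ω => regOn D ρ (Xs ω)) =ᵐ[μ] fun ω => ρ (Xs ω) := by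
  have h1 : ∀ᵐ y ∂μ.map Xs, y ∈ D := by
    rw [ae_iff]
    exact measure_mono_null (Set.compl_subset_compl.2 h.support_Xs) Measure.measure_compl_support
  filter_upwards [ae_of_ae_map h.measurable_Xs.aemeasurable h1] with ω hω
  exact regOn_of_mem hω

theorem measurable_mismeasured (h : WCMEModel μ Y Xs ξ Z ρ f g m D) (τ : ℝ) :
    Measurable (mismeasured Xs ξ τ) := h.measurable_Xs.add (h.measurable_ξ.const_mul τ)

/-- On events determined by the covariates and the instrument, the outcome may be replaced by the
regression function. -/
theorem setIntegral_outcome (h : WCMEModel μ Y Xs ξ Z ρ f g m D) {τ : ℝ} (hτ : 0 < τ)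
    {S : Set Ω} (hS : MeasurableSet[sigmaOf (fun ω => (Xs ω, Z ω, mismeasured Xs ξ τ ω))] S) :
    ∫ ω in S, Y ω ∂μ = ∫ ω in S, regOn D ρ (Xs ω) ∂μ := by
  have hle : sigmaOf (fun ω => (Xs ω, Z ω, mismeasured Xs ξ τ ω)) ≤ ‹MeasurableSpace Ω› :=
    (h.measurable_Xs.prodMk (h.measurable_Z.prodMk (h.measurable_mismeasured τ))).comap_le
  rw [← setIntegral_condExp hle h.integrable_Y hS]
  refine integral_congr_ae (ae_restrict_of_ae ?_)
  exact (h.nondifferential τ hτ).trans (h.exclusion.trans (h.regression.trans h.ae_regOn.symm))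

/-- Conditioning on less than (X*, Z, X) preserves integrals over events of the smaller σ-algebra,
so every version of the observable regression inherits the replacement of `Y` by the true
regression. -/
theorem setIntegral_version (h : WCMEModel μ Y Xs ξ Z ρ f g m D) {τ : ℝ} (hτ : 0 < τ)
    {E : Type*} [MeasurableSpace E] {V : Ω → E} (hV : sigmaOf V ≤ sigmaOf (fun ω => (Xs ω, Z ω, mismeasured Xs ξ τ ω)))
    {Q : Ω → ℝ} (hQ : μ[Y | sigmaOf V] =ᵐ[μ] Q) {S : Set Ω} (hS : MeasurableSet[sigmaOf V] S) :
    ∫ ω in S, Q ω ∂μ = ∫ ω in S, regOn D ρ (Xs ω) ∂μ := by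
  have hle : sigmaOf (fun ω => (Xs ω, Z ω, mismeasured Xs ξ τ ω)) ≤ ‹MeasurableSpace Ω› :=
    (h.measurable_Xs.prodMk (h.measurable_Z.prodMk (h.measurable_mismeasured τ))).comap_le
  rw [← h.setIntegral_outcome hτ (hV S hS), ← setIntegral_condExp (hV.trans hle) h.integrable_Y hS]
  exact integral_congr_ae (ae_restrict_of_ae hQ.symm)

omit [MeasurableSpace Ω] in
theorem sigmaOf_X_le (τ : ℝ) : sigmaOf (mismeasured Xs ξ τ) ≤
    sigmaOf (fun ω => (Xs ω, Z ω, mismeasured Xs ξ τ ω)) := by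
  have : mismeasured Xs ξ τ =
      (fun w : ℝ × 𝒵 × ℝ => w.2.2) ∘ fun ω => (Xs ω, Z ω, mismeasured Xs ξ τ ω) := rfl
  rw [sigmaOf, this, ← MeasurableSpace.comap_comp]
  exact MeasurableSpace.comap_mono (measurable_snd.comp measurable_snd).comap_le

omit [MeasurableSpace Ω] in
theorem sigmaOf_XZ_le (τ : ℝ) : sigmaOf (fun ω => (mismeasured Xs ξ τ ω, Z ω)) ≤
    sigmaOf (fun ω => (Xs ω, Z ω, mismeasured Xs ξ τ ω)) := by
  have : (fun ω => (mismeasured Xs ξ τ ω, Z ω)) =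
      (fun w : ℝ × 𝒵 × ℝ => (w.2.2, w.2.1)) ∘ fun ω => (Xs ω, Z ω, mismeasured Xs ξ τ ω) := rfl
  rw [sigmaOf, this, ← MeasurableSpace.comap_comp]
  exact MeasurableSpace.comap_mono
    ((measurable_snd.comp measurable_snd).prodMk (measurable_fst.comp measurable_snd)).comap_le

theorem regTower_density (h : WCMEModel μ Y Xs ξ Z ρ f g m D) (hm : 0 < m) {φ : ℕ → ℝ → ℝ} {C : ℝ}
    (hφ : DensityTower m D C φ) (hC : 0 ≤ C) (hφi : Integrable (φ 0)) :
    (∃ C', 0 ≤ C' ∧ DensityTower m D C' (regTower φ (regDerivs D ρ))) ∧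
      Integrable (regTower φ (regDerivs D ρ) 0) ∧
      ∀ y, regTower φ (regDerivs D ρ) 0 y = regOn D ρ y * φ 0 y := by
  obtain ⟨B, hB⟩ := h.smooth_ρ
  have ht : DerivTower m D |B| (regDerivs D ρ) :=
    ⟨hB.tower.hasDeriv, fun k hk y hy => (hB.tower.bound k hk y hy).trans (le_abs_self B)⟩
  have hmul := hφ.mul h.closed_D ht hC (abs_nonneg B)
  have he : ∀ y, regTower φ (regDerivs D ρ) 0 y = regOn D ρ y * φ 0 y := by
    intro y
    simp only [mulTower, regDerivs, iteratedDerivWithin_zero]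
    by_cases hy : y ∈ D
    · rw [regOn_of_mem hy, mul_comm]
    · rw [hφ.eq_zero 0 (Nat.zero_le _) y hy, mul_zero, zero_mul]
  refine ⟨⟨_, by positivity, hmul⟩, ?_, he⟩
  refine (hφi.norm.const_mul |B|).mono' (hmul.measurable hm).aestronglyMeasurable
    (Eventually.of_forall fun y => ?_)
  rw [he, norm_mul]
  refine mul_le_mul_of_nonneg_right ?_ (norm_nonneg _)
  by_cases hy : y ∈ D
  · rw [regOn_of_mem hy]
    have := ht.bound 0 (Nat.zero_le _) y hy
    simpa only [regDerivs, iteratedDerivWithin_zero, Real.norm_eq_abs] using this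
  · rw [regOn_of_notMem hy, norm_zero]
    exact abs_nonneg _

variable [MeasurableSingletonClass 𝒵] [Countable 𝒵]

/-- Every version of `E[Y | X]` is the ratio of the smeared functions. -/
theorem version_X (h : WCMEModel μ Y Xs ξ Z ρ f g m D) (hm : 0 < m) {τ : ℝ} (hτ : 0 < τ)
    {q : ℝ → ℝ} (hq : Measurable q)
    (hreg : μ[Y | sigmaOf (mismeasured Xs ξ τ)] =ᵐ[μ] fun ω => q (mismeasured Xs ξ τ ω)) :
    (fun y => q y * smearMoment (mixDerivs μ Z f) (kernelDerivs g D) 0 0 τ y) =ᵐ[volume]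
      smearMoment (regTower (mixDerivs μ Z f) (regDerivs D ρ)) (kernelDerivs g D) 0 0 τ := by
  obtain ⟨C, hC0, hC, hCm⟩ := h.exists_densityTower hm
  have hlaw := h.errorLaw_mix hm
  obtain ⟨⟨C', hC', ht⟩, hi, he⟩ := h.regTower_density hm hCm hC0
    (hlaw.integrable_density (hCm.measurable hm))
  refine hlaw.regression_mul_density h.closed_D h.kernelTower hCm hC0 hm h.measurable_Xs
    h.measurable_ξ ht hC' hi (h.measurable_regOn hm) he τ hq ?_ fun A hA => ?_
  · exact integrable_condExp.congr hreg
  · exact h.setIntegral_version hτ (sigmaOf_X_le τ) hreg ⟨A, hA, rfl⟩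

/-- Every version of `E[Y | X, Z = z]` is the ratio of the smeared functions. -/
theorem version_XZ (h : WCMEModel μ Y Xs ξ Z ρ f g m D) (hm : 0 < m) {τ : ℝ} (hτ : 0 < τ)
    {q : 𝒵 → ℝ → ℝ} (hq : ∀ z, Measurable (q z))
    (hreg : μ[Y | sigmaOf (fun ω => (mismeasured Xs ξ τ ω, Z ω))] =ᵐ[μ]
      fun ω => q (Z ω) (mismeasured Xs ξ τ ω)) {z : 𝒵} (hz : μ (Z ⁻¹' {z}) ≠ 0) :
    (fun y => q z y * smearMoment (lineDerivs (f z)) (kernelDerivs g D) 0 0 τ y) =ᵐ[volume]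
      smearMoment (regTower (lineDerivs (f z)) (regDerivs D ρ)) (kernelDerivs g D) 0 0 τ := by
  obtain ⟨C, hC0, hC, hCm⟩ := h.exists_densityTower hm
  have hlaw := h.errorLaw_cond hm hz
  have hZz : MeasurableSet (Z ⁻¹' {z}) := h.measurable_Z (measurableSet_singleton z)
  have hX := h.measurable_mismeasured τ
  obtain ⟨⟨C', hC', ht⟩, hi, he⟩ := h.regTower_density hm (hC z hz) hC0
    (hlaw.integrable_density ((hC z hz).measurable hm))
  have hqz : ∀ ω ∈ Z ⁻¹' {z}, q (Z ω) (mismeasured Xs ξ τ ω) = q z (mismeasured Xs ξ τ ω) := by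
    intro ω hω
    rw [show Z ω = z from hω]
  refine hlaw.regression_mul_density h.closed_D h.kernelTower (hC z hz) hC0 hm h.measurable_Xs
    h.measurable_ξ ht hC' hi (h.measurable_regOn hm) he τ (hq z) ?_ fun A hA => ?_
  · have h1 : Integrable (fun ω => q (Z ω) (mismeasured Xs ξ τ ω)) μ :=
      integrable_condExp.congr hreg
    have h2 : IntegrableOn (fun ω => q z (mismeasured Xs ξ τ ω)) (Z ⁻¹' {z}) μ :=
      h1.integrableOn.congr_fun hqz hZz
    rw [ProbabilityTheory.cond]
    exact Integrable.smul_measure h2 (ENNReal.inv_ne_top.2 hz)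
  · rw [setIntegral_cond_eq (hX hA), setIntegral_cond_eq (hX hA)]
    congr 1
    -- The event `X ∈ A`, `Z = z` is the preimage of `A ×ˢ {z}` under (X, Z).
    refine Eq.trans ?_ (h.setIntegral_version hτ (sigmaOf_XZ_le τ) hreg
      ⟨A ×ˢ {z}, hA.prod (measurableSet_singleton z), rfl⟩)
    refine setIntegral_congr_fun ((hX hA).inter hZz) fun ω hω => ?_
    exact (hqz ω hω.2).symm

theorem mix_moment_eq_zero (h : WCMEModel μ Y Xs ξ Z ρ f g m D) (hm : 0 < m) {k : ℕ} (hk : k ≤ m)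
    (hcond : μ[(fun ω => ξ ω ^ k) | sigmaOf Xs] =ᵐ[μ] 0) (y : ℝ) :
    smearMoment (mixDerivs μ Z f) (kernelDerivs g D) k 0 0 y = 0 := by
  obtain ⟨C, hC0, hC, hCm⟩ := h.exists_densityTower hm
  have hlaw := h.errorLaw_mix hm
  have hi : Integrable (fun ω => ξ ω ^ k) μ := by
    have := hlaw.integrable_mul_pow h.closed_D h.kernelTower hCm hC0 hm h.measurable_Xs
      h.measurable_ξ hCm hC0 (hlaw.integrable_density (hCm.measurable hm)) (κ := fun _ => 1)
      measurable_const (by simp) hk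
    simpa using this
  refine hlaw.moment_eq_zero h.closed_D h.kernelTower hCm hC0 hm h.measurable_Xs h.measurable_ξ hk
    (fun A hA => ?_) y
  rw [← setIntegral_condExp h.measurable_Xs.comap_le hi ⟨A, hA, rfl⟩,
    integral_congr_ae (ae_restrict_of_ae hcond)]
  simp

theorem errorMoments_mix (h : WCMEModel μ Y Xs ξ Z ρ f g m D) {p : ℕ} (hpm : p ≤ m)
    (hp : p = 3 ∨ (p = 4 ∧ μ[(fun ω => ξ ω ^ 3) | sigmaOf Xs] =ᵐ[μ] 0)) :
    ErrorMoments p (mixDerivs μ Z f) (kernelDerivs g D) := by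
  have hm : 0 < m := by rcases hp with rfl | ⟨rfl, -⟩ <;> omega
  obtain ⟨C, hC0, hC, hCm⟩ := h.exists_densityTower hm
  refine ⟨hp.imp_right And.left, ?_, ?_, fun hp4 => ?_⟩
  · exact (h.errorLaw_mix hm).zeroth h.closed_D h.kernelTower hCm hC0 hm h.measurable_Xs
      h.measurable_ξ
  · exact h.mix_moment_eq_zero hm hm (by simpa using h.mean_zero)
  · rcases hp with rfl | ⟨-, h3⟩
    · omega
    · exact h.mix_moment_eq_zero hm (by omega) h3

/-- Moment conditions given X* alone yield those weighted by the density given `Z = z`: where that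
density is nonzero so is the mixture, and the integral of `u ^ k` against the common kernel must
vanish. -/
theorem errorMoments_cond (h : WCMEModel μ Y Xs ξ Z ρ f g m D) {p : ℕ} (hpm : p ≤ m)
    (hp : p = 3 ∨ (p = 4 ∧ μ[(fun ω => ξ ω ^ 3) | sigmaOf Xs] =ᵐ[μ] 0)) {z : 𝒵}
    (hz : μ (Z ⁻¹' {z}) ≠ 0) :
    ErrorMoments p (lineDerivs (f z)) (kernelDerivs g D) := by
  have hm : 0 < m := by rcases hp with rfl | ⟨rfl, -⟩ <;> omega
  obtain ⟨C, hC0, hC, hCm⟩ := h.exists_densityTower hm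
  have hmix := h.errorMoments_mix hpm hp
  have key : ∀ k, (∀ y, smearMoment (mixDerivs μ Z f) (kernelDerivs g D) k 0 0 y = 0) →
      ∀ y, smearMoment (lineDerivs (f z)) (kernelDerivs g D) k 0 0 y = 0 := by
    intro k hk y
    have h1 := hk y
    rw [smearMoment_zero_zero] at h1 ⊢
    by_cases hy : f z y = 0
    · rw [lineDerivs_zero, hy, zero_mul]
    · rw [(mul_eq_zero.1 h1).resolve_left (h.mixDerivs_zero_pos hm hz hy).ne', mul_zero]
  exact ⟨hmix.order, (h.errorLaw_cond hm hz).zeroth h.closed_D h.kernelTower (hC z hz) hC0 hm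
    h.measurable_Xs h.measurable_ξ, key 1 hmix.first, fun hp4 => key 3 (hmix.third hp4)⟩

end WCMEModel

end SmallME
end

/-! ### Existence and local uniqueness of continuous versions. -/

noncomputable section

namespace SmallME

namespace WCMEModel

variable {Ω 𝒵 : Type*} [MeasurableSpace Ω] [MeasurableSpace 𝒵] {μ : Measure Ω}
  [IsProbabilityMeasure μ] {Y Xs ξ : Ω → ℝ} {Z : Ω → 𝒵} {ρ : ℝ → ℝ} {f : 𝒵 → ℝ → ℝ}
  {g : ℝ → ℝ → ℝ} {m : ℕ} {D : Set ℝ} [MeasurableSingletonClass 𝒵] [Countable 𝒵]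

theorem smear_density_cond (h : WCMEModel μ Y Xs ξ Z ρ f g m D) (hm : 0 < m) (τ : ℝ) {z : 𝒵}
    (hz : μ (Z ⁻¹' {z}) ≠ 0) :
    IsCondDensity μ (mismeasured Xs ξ τ) Z z
      (smearMoment (lineDerivs (f z)) (kernelDerivs g D) 0 0 τ) := by
  obtain ⟨C, hC0, hC, -⟩ := h.exists_densityTower hm
  have hlaw := h.errorLaw_cond hm hz
  exact ⟨(continuous_smearMoment h.closed_D h.kernelTower (hC z hz) hC0 hm (Nat.zero_le m)
      τ).measurable, hlaw.smearMoment_nonneg τ, hlaw.map_mismeasured h.closed_D h.kernelTower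
      (hC z hz) hC0 hm h.measurable_Xs h.measurable_ξ τ⟩

theorem continuous_smear_cond (h : WCMEModel μ Y Xs ξ Z ρ f g m D) (hm : 0 < m) (τ : ℝ) {z : 𝒵}
    (hz : μ (Z ⁻¹' {z}) ≠ 0) :
    Continuous (smearMoment (lineDerivs (f z)) (kernelDerivs g D) 0 0 τ) ∧
    Continuous (smearMoment (regTower (lineDerivs (f z)) (regDerivs D ρ))
      (kernelDerivs g D) 0 0 τ) := by
  obtain ⟨C, hC0, hC, -⟩ := h.exists_densityTower hm
  obtain ⟨⟨C', hC', ht⟩, -⟩ := h.regTower_density hm (hC z hz) hC0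
    ((h.errorLaw_cond hm hz).integrable_density ((hC z hz).measurable hm))
  exact ⟨continuous_smearMoment h.closed_D h.kernelTower (hC z hz) hC0 hm (Nat.zero_le m) τ,
    continuous_smearMoment h.closed_D h.kernelTower ht hC' hm (Nat.zero_le m) τ⟩

theorem continuous_smear_mix (h : WCMEModel μ Y Xs ξ Z ρ f g m D) (hm : 0 < m) (τ : ℝ) :
    Continuous (smearMoment (mixDerivs μ Z f) (kernelDerivs g D) 0 0 τ) ∧
    Continuous (smearMoment (regTower (mixDerivs μ Z f) (regDerivs D ρ))
      (kernelDerivs g D) 0 0 τ) := by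
  obtain ⟨C, hC0, -, hC⟩ := h.exists_densityTower hm
  obtain ⟨⟨C', hC', ht⟩, -⟩ := h.regTower_density hm hC hC0
    ((h.errorLaw_mix hm).integrable_density (hC.measurable hm))
  exact ⟨continuous_smearMoment h.closed_D h.kernelTower hC hC0 hm (Nat.zero_le m) τ,
    continuous_smearMoment h.closed_D h.kernelTower ht hC' hm (Nat.zero_le m) τ⟩

/-- Division is legitimate because X falls almost surely where its density is nonzero. -/
theorem ae_eq_div_of_mul {Ω' : Type*} [MeasurableSpace Ω'] {ν : Measure Ω'} {X : Ω' → ℝ}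
    (hX : Measurable X) {F N q : ℝ → ℝ} (hF : Measurable F)
    (hmap : ν.map X = volume.withDensity fun y => ENNReal.ofReal (F y))
    (hq : (fun y => q y * F y) =ᵐ[volume] N) : ∀ᵐ ω ∂ν, q (X ω) = N (X ω) / F (X ω) := by
  refine ae_of_ae_map hX.aemeasurable (p := fun y => q y = N y / F y) ?_
  rw [hmap, ae_withDensity_iff hF.ennreal_ofReal]
  filter_upwards [hq] with y hy hFy
  have : F y ≠ 0 := by
    intro h0
    simp [h0] at hFy
  rw [← hy, mul_div_cancel_right₀ _ this]

open Classical in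
/-- The versions given by the smeared functions. -/
theorem isVersionNear_smear (h : WCMEModel μ Y Xs ξ Z ρ f g m D) (hm : 0 < m) {τ : ℝ} (hτ : 0 < τ)
    {z₁ z₂ : 𝒵} (hz₁ : μ (Z ⁻¹' {z₁}) ≠ 0) (hz₂ : μ (Z ⁻¹' {z₂}) ≠ 0) {x : ℝ}
    (h₁ : smearMoment (lineDerivs (f z₁)) (kernelDerivs g D) 0 0 τ x ≠ 0)
    (h₂ : smearMoment (lineDerivs (f z₂)) (kernelDerivs g D) 0 0 τ x ≠ 0)
    (h₃ : smearMoment (mixDerivs μ Z f) (kernelDerivs g D) 0 0 τ x ≠ 0) :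
    IsVersionNear μ Y (mismeasured Xs ξ τ) Z z₁ z₂ x
      (fun z => smearMoment (lineDerivs (f z)) (kernelDerivs g D) 0 0 τ)
      -- The default value 0 secures measurability at null values of `Z`, for which `f z` is
      -- arbitrary.
      (fun z y => if μ (Z ⁻¹' {z}) = 0 then 0 else
        smearMoment (regTower (lineDerivs (f z)) (regDerivs D ρ)) (kernelDerivs g D) 0 0 τ y /
          smearMoment (lineDerivs (f z)) (kernelDerivs g D) 0 0 τ y)
      (fun y => smearMoment (regTower (mixDerivs μ Z f) (regDerivs D ρ)) (kernelDerivs g D) 0 0 τ y /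
          smearMoment (mixDerivs μ Z f) (kernelDerivs g D) 0 0 τ y) := by
  have hX := h.measurable_mismeasured τ
  have hcz : ∀ z, z = z₁ ∨ z = z₂ → μ (Z ⁻¹' {z}) ≠ 0 ∧
      smearMoment (lineDerivs (f z)) (kernelDerivs g D) 0 0 τ x ≠ 0 := by
    rintro z (rfl | rfl)
    · exact ⟨hz₁, h₁⟩
    · exact ⟨hz₂, h₂⟩
  refine ⟨fun z hz => h.smear_density_cond hm τ hz, fun z => ?_, ?_, ?_, ?_, fun z hz => ?_,
    fun z hz => ?_, ?_⟩
  · by_cases hz : μ (Z ⁻¹' {z}) = 0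
    · simp [hz]
    · simp only [hz, if_false]
      obtain ⟨c1, c2⟩ := h.continuous_smear_cond hm τ hz
      exact c2.measurable.div c1.measurable
  · obtain ⟨c1, c2⟩ := h.continuous_smear_mix hm τ
    exact c2.measurable.div c1.measurable
  · have hle : sigmaOf (fun ω => (mismeasured Xs ξ τ ω, Z ω)) ≤ ‹MeasurableSpace Ω› :=
      (hX.prodMk h.measurable_Z).comap_le
    -- The conditional expectation factors through (X, Z); the factor is a version, so the
    -- characterization of versions forces it to be the quotient.
    obtain ⟨q, hq, hq2⟩ := StronglyMeasurable.exists_eq_measurable_comp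
      (stronglyMeasurable_condExp (m := sigmaOf (fun ω => (mismeasured Xs ξ τ ω, Z ω)))
        (f := Y) (μ := μ))
    have hqm := hq.measurable
    have hv := fun z (hz : μ (Z ⁻¹' {z}) ≠ 0) => h.version_XZ hm hτ
      (q := fun z y => q (y, z)) (fun z => hqm.comp measurable_prodMk_right)
      (Eventually.of_forall fun ω => congrFun hq2 ω) hz
    -- Countability of the instrument's values merges the almost sure statements for each `z` into
    -- one.
    have hall : ∀ᵐ ω ∂μ, ∀ z, ω ∈ Z ⁻¹' {z} → μ (Z ⁻¹' {z}) ≠ 0 ∧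
        q (mismeasured Xs ξ τ ω, z) =
        smearMoment (regTower (lineDerivs (f z)) (regDerivs D ρ)) (kernelDerivs g D) 0 0 τ
          (mismeasured Xs ξ τ ω) /
        smearMoment (lineDerivs (f z)) (kernelDerivs g D) 0 0 τ (mismeasured Xs ξ τ ω) := by
      rw [ae_all_iff]
      intro z
      by_cases hz : μ (Z ⁻¹' {z}) = 0
      · have : ∀ᵐ ω ∂μ, ω ∉ Z ⁻¹' {z} := measure_eq_zero_iff_ae_notMem.1 hz
        filter_upwards [this] with ω hω hω2 using absurd hω2 hω
      · have hd := h.smear_density_cond hm τ hz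
        have := ae_eq_div_of_mul hX hd.1 hd.2.2 (hv z hz)
        rw [ae_cond_iff (h.measurable_Z (measurableSet_singleton z))] at this
        filter_upwards [this] with ω hω hω2 using ⟨hz, hω hω2⟩
    rw [hq2]
    filter_upwards [hall] with ω hω
    obtain ⟨hz, he⟩ := hω (Z ω) rfl
    simp only [Function.comp_apply, he, hz, if_false]
  · obtain ⟨q, hq, hq2⟩ := StronglyMeasurable.exists_eq_measurable_comp
      (stronglyMeasurable_condExp (m := sigmaOf (mismeasured Xs ξ τ)) (f := Y) (μ := μ))
    obtain ⟨C, hC0, -, hC⟩ := h.exists_densityTower hm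
    have hv := h.version_X hm hτ hq.measurable (Eventually.of_forall fun ω => congrFun hq2 ω)
    rw [hq2]
    exact ae_eq_div_of_mul hX (h.continuous_smear_mix hm τ).1.measurable
      ((h.errorLaw_mix hm).map_mismeasured h.closed_D h.kernelTower hC hC0 hm h.measurable_Xs
        h.measurable_ξ τ) hv
  · exact Eventually.of_forall fun y => (h.continuous_smear_cond hm τ (hcz z hz).1).1.continuousAt
  · obtain ⟨c1, c2⟩ := h.continuous_smear_cond hm τ (hcz z hz).1
    simp only [(hcz z hz).1, if_false]
    filter_upwards [c1.continuousAt.eventually_ne (hcz z hz).2] with y hy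
    exact c2.continuousAt.div c1.continuousAt hy
  · obtain ⟨c1, c2⟩ := h.continuous_smear_mix hm τ
    filter_upwards [c1.continuousAt.eventually_ne h₃] with y hy
    exact c2.continuousAt.div c1.continuousAt hy

theorem eventuallyEq_div {q F N : ℝ → ℝ} {x : ℝ} (hq : (fun y => q y * F y) =ᵐ[volume] N)
    (cq : ∀ᶠ y in 𝓝 x, ContinuousAt q y) (cF : Continuous F) (cN : Continuous N) (hx : F x ≠ 0) :
    q =ᶠ[𝓝 x] fun y => N y / F y := by
  have h1 := eventuallyEq_of_ae_eq hq (cq.mono fun y hy => hy.mul cF.continuousAt)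
    (Eventually.of_forall fun y => cN.continuousAt)
  filter_upwards [h1, cF.continuousAt.eventually_ne hx] with y hy hFy
  rw [← hy, mul_div_cancel_right₀ _ hFy]

/-- Versions that are continuous near `x` coincide there with the smeared functions. -/
theorem eventuallyEq_of_isVersionNear (h : WCMEModel μ Y Xs ξ Z ρ f g m D) (hm : 0 < m) {τ : ℝ}
    (hτ : 0 < τ) {z₁ z₂ : 𝒵} {x : ℝ} {fX qXZ : 𝒵 → ℝ → ℝ} {qX : ℝ → ℝ}
    (hv : IsVersionNear μ Y (mismeasured Xs ξ τ) Z z₁ z₂ x fX qXZ qX) :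
    (∀ z, (z = z₁ ∨ z = z₂) → μ (Z ⁻¹' {z}) ≠ 0 →
      smearMoment (lineDerivs (f z)) (kernelDerivs g D) 0 0 τ x ≠ 0 →
      fX z =ᶠ[𝓝 x] smearMoment (lineDerivs (f z)) (kernelDerivs g D) 0 0 τ ∧
      qXZ z =ᶠ[𝓝 x] fun y =>
        smearMoment (regTower (lineDerivs (f z)) (regDerivs D ρ)) (kernelDerivs g D) 0 0 τ y /
          smearMoment (lineDerivs (f z)) (kernelDerivs g D) 0 0 τ y) ∧
    (smearMoment (mixDerivs μ Z f) (kernelDerivs g D) 0 0 τ x ≠ 0 → qX =ᶠ[𝓝 x] fun y =>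
      smearMoment (regTower (mixDerivs μ Z f) (regDerivs D ρ)) (kernelDerivs g D) 0 0 τ y /
          smearMoment (mixDerivs μ Z f) (kernelDerivs g D) 0 0 τ y) := by
  refine ⟨fun z hzz hz hne => ⟨?_, ?_⟩, fun hne => ?_⟩
  · have hd := h.smear_density_cond hm τ hz
    obtain ⟨m1, n1, l1⟩ := hv.density z hz
    obtain ⟨m2, n2, l2⟩ := hd
    rw [l1] at l2
    have hfin : ∫⁻ y, ENNReal.ofReal (fX z y) ≠ ∞ := by
      have h1 := congrArg (fun ν => ν Set.univ) l1
      simp only [withDensity_apply _ MeasurableSet.univ, Measure.restrict_univ] at h1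
      rw [← h1]
      exact measure_ne_top _ _
    have hae := (withDensity_eq_iff m1.ennreal_ofReal.aemeasurable m2.ennreal_ofReal.aemeasurable
      hfin).1 l2
    refine eventuallyEq_of_ae_eq ?_ (hv.continuous_fX z hzz)
      (Eventually.of_forall fun y => (h.continuous_smear_cond hm τ hz).1.continuousAt)
    filter_upwards [hae] with y hy
    exact (ENNReal.ofReal_eq_ofReal_iff (n1 y) (n2 y)).1 hy
  · obtain ⟨c1, c2⟩ := h.continuous_smear_cond hm τ hz
    exact eventuallyEq_div (h.version_XZ hm hτ hv.measurable_qXZ hv.regression_XZ hz)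
      (hv.continuous_qXZ z hzz) c1 c2 hne
  · obtain ⟨c1, c2⟩ := h.continuous_smear_mix hm τ
    exact eventuallyEq_div (h.version_X hm hτ hv.measurable_qX hv.regression_X)
      hv.continuous_qX c1 c2 hne

end WCMEModel

end SmallME
end

/-! ### The main theorem. -/

theorem theorem1 {Ω 𝒵 : Type*} [MeasurableSpace Ω] [MeasurableSpace 𝒵]
    [Countable 𝒵] [MeasurableSingletonClass 𝒵]
    (μ : Measure Ω) [IsProbabilityMeasure μ]
    (Y Xs ξ : Ω → ℝ) (Z : Ω → 𝒵)
    (ρ : ℝ → ℝ) (f : 𝒵 → ℝ → ℝ) (g : ℝ → ℝ → ℝ) (m p : ℕ) (D : Set ℝ)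
    (hmodel : SmallME.WCMEModel μ Y Xs ξ Z ρ f g m D)
    (hpm : p ≤ m)
    (hp : p = 3 ∨
      (p = 4 ∧ μ[(fun ω => ξ ω ^ 3) | SmallME.sigmaOf Xs] =ᵐ[μ] 0))
    (z₁ z₂ : 𝒵) (hz₁ : μ (Z ⁻¹' {z₁}) ≠ 0) (hz₂ : μ (Z ⁻¹' {z₂}) ≠ 0)
    (x : ℝ) (hx₁ : 0 < f z₁ x) (hx₂ : 0 < f z₂ x)
    (hrank : deriv ρ x * (SmallME.score (f z₁) x - SmallME.score (f z₂) x) ≠ 0) :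
    -- continuous versions of the observable functions exist for small `τ`
    (∃ (fX qXZ : ℝ → 𝒵 → ℝ → ℝ) (qX : ℝ → ℝ → ℝ),
      ∀ᶠ τ in 𝓝[>] (0 : ℝ),
        SmallME.IsVersionNear μ Y (SmallME.mismeasured Xs ξ τ) Z z₁ z₂ x
          (fX τ) (qXZ τ) (qX τ)) ∧
    -- and any such versions are smooth near `x` and satisfy the approximations
    ∀ (fX qXZ : ℝ → 𝒵 → ℝ → ℝ) (qX : ℝ → ℝ → ℝ),
      (∀ᶠ τ in 𝓝[>] (0 : ℝ),
        SmallME.IsVersionNear μ Y (SmallME.mismeasured Xs ξ τ) Z z₁ z₂ x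
          (fX τ) (qXZ τ) (qX τ)) →
      (∀ᶠ τ in 𝓝[>] (0 : ℝ),
        (∀ z, z = z₁ ∨ z = z₂ →
          0 < fX τ z x ∧ ContDiffAt ℝ 2 (fX τ z) x ∧ ContDiffAt ℝ 2 (qXZ τ z) x) ∧
        ContDiffAt ℝ 2 (qX τ) x ∧
        SmallME.relevance (fX τ) (qX τ) z₁ z₂ x ≠ 0) ∧
      ((fun τ => SmallME.vTilde (fX τ) (qXZ τ) (qX τ) z₁ z₂ x - SmallME.skedastic g τ x)
        =O[𝓝[>] (0 : ℝ)] fun τ => τ ^ p) ∧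
      ((fun τ => SmallME.rhoTilde (fX τ) (qXZ τ) (qX τ) z₁ z₂ x z₁ - ρ x)
        =O[𝓝[>] (0 : ℝ)] fun τ => τ ^ p) := by
  have hm3 : 3 ≤ m := by rcases hp with rfl | ⟨rfl, -⟩ <;> omega
  have hm : 0 < m := by omega
  have hp3 : p - 2 ≠ 0 := by rcases hp with rfl | ⟨rfl, -⟩ <;> omega
  obtain ⟨C, hC0, hC, hCm⟩ := hmodel.exists_densityTower hm
  obtain ⟨B, hB⟩ := hmodel.smooth_ρ
  have hγ := hmodel.kernelTower
  have hD := hmodel.closed_D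
  have hr : SmallME.DerivTower m D |B| (SmallME.WCMEModel.regDerivs D ρ) :=
    ⟨hB.tower.hasDeriv, fun k hk y hy => (hB.tower.bound k hk y hy).trans (le_abs_self B)⟩
  set γ := SmallME.kernelDerivs g D with hγ_def
  set r := SmallME.WCMEModel.regDerivs D ρ with hr_def
  set φ := SmallME.lineDerivs (f z₁) with hφ_def
  set ψ := SmallME.lineDerivs (f z₂) with hψ_def
  set χ := SmallME.mixDerivs μ Z f with hχ_def
  have hφ0 : φ 0 = f z₁ := SmallME.lineDerivs_zero _
  have hψ0 : ψ 0 = f z₂ := SmallME.lineDerivs_zero _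
  have hφ := hC z₁ hz₁
  have hψ := hC z₂ hz₂
  have hmφ := hmodel.errorMoments_cond hpm hp hz₁
  have hmψ := hmodel.errorMoments_cond hpm hp hz₂
  have hmχ := hmodel.errorMoments_mix hpm hp
  have pφ : 0 < φ 0 x := by rwa [hφ0]
  have pψ : 0 < ψ 0 x := by rwa [hψ0]
  have pχ : 0 < χ 0 x := hmodel.mixDerivs_zero_pos hm hz₁ hx₁.ne'
  have hxD : x ∈ D := by
    by_contra hx
    exact pφ.ne' (hφ.eq_zero 0 (Nat.zero_le m) x hx)
  -- A positive density at `x` excludes the frontier of `D`, where the density vanishes; hence the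
  -- derivative of `ρ` within `D` at `x` is the ordinary one.
  have hDn : D ∈ 𝓝 x := by
    rw [← mem_interior_iff_mem_nhds]
    by_contra hx
    exact pφ.ne' (hφ.eq_zero_frontier ⟨subset_closure hxD, hx⟩ hxD hm).1
  have hr0 : r 0 x = ρ x := by simp [hr_def, SmallME.WCMEModel.regDerivs]
  have hr1 : r 1 x = deriv ρ x := by
    rw [hr_def, SmallME.WCMEModel.regDerivs, iteratedDerivWithin_one, derivWithin_of_mem_nhds hDn]
  have hs : ∀ z, μ (Z ⁻¹' {z}) ≠ 0 → SmallME.score (f z) x =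
      SmallME.lineDerivs (f z) 1 x / SmallME.lineDerivs (f z) 0 x := by
    intro z hz
    have := (hC z hz).hasDerivAt hm x
    rw [SmallME.lineDerivs_zero] at this ⊢
    rw [SmallME.score, this.deriv]
  have hne : r 1 x * (φ 1 x / φ 0 x - ψ 1 x / ψ 0 x) ≠ 0 := by
    rw [hr1, ← hs z₁ hz₁, ← hs z₂ hz₂]
    exact hrank
  obtain ⟨arel, av, aρ⟩ := SmallME.smeared_asymptotics hD hmodel.convex_D hγ hφ hψ hCm hC0 hr
    (abs_nonneg B) hpm hmφ hmψ hmχ hxD pφ.ne' pψ.ne' pχ.ne' hne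
  have hsmall : ∀ᶠ τ in 𝓝[>] (0 : ℝ), 0 < τ ∧ 0 < SmallME.smearMoment φ γ 0 0 τ x ∧
      0 < SmallME.smearMoment ψ γ 0 0 τ x ∧ 0 < SmallME.smearMoment χ γ 0 0 τ x := by
    have t1 := (SmallME.near_smearMoment_zero hD hγ hφ hC0 hpm hmφ x (j := 0)
      (by norm_num)).tendsto hp3
    have t2 := (SmallME.near_smearMoment_zero hD hγ hψ hC0 hpm hmψ x (j := 0)
      (by norm_num)).tendsto hp3
    have t3 := (SmallME.near_smearMoment_zero hD hγ hCm hC0 hpm hmχ x (j := 0)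
      (by norm_num)).tendsto hp3
    filter_upwards [self_mem_nhdsWithin, t1.eventually_const_lt pφ, t2.eventually_const_lt pψ,
      t3.eventually_const_lt pχ] with τ h0 h1 h2 h3 using ⟨h0, h1, h2, h3⟩
  constructor
  · classical
    refine ⟨fun τ z => SmallME.smearMoment (SmallME.lineDerivs (f z)) γ 0 0 τ,
      fun τ z y => if μ (Z ⁻¹' {z}) = 0 then 0 else
        SmallME.smearMoment (SmallME.regTower (SmallME.lineDerivs (f z)) r) γ 0 0 τ y /
          SmallME.smearMoment (SmallME.lineDerivs (f z)) γ 0 0 τ y,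
      fun τ y => SmallME.smearMoment (SmallME.regTower χ r) γ 0 0 τ y /
          SmallME.smearMoment χ γ 0 0 τ y, ?_⟩
    filter_upwards [hsmall] with τ ⟨h0, h1, h2, h3⟩
    convert hmodel.isVersionNear_smear hm h0 hz₁ hz₂ h1.ne' h2.ne' h3.ne'
  intro fX qXZ qX hver
  have hφr := hφ.mul hD hr hC0 (abs_nonneg B)
  have hψr := hψ.mul hD hr hC0 (abs_nonneg B)
  have hχr := hCm.mul hD hr hC0 (abs_nonneg B)
  have hC1 : 0 ≤ 2 ^ m * (C * |B|) := by positivity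
  have jets := fun τ (hτ : SmallME.IsVersionNear μ Y (SmallME.mismeasured Xs ξ τ) Z z₁ z₂ x
      (fX τ) (qXZ τ) (qX τ)) (h : 0 < τ ∧ 0 < SmallME.smearMoment φ γ 0 0 τ x ∧
      0 < SmallME.smearMoment ψ γ 0 0 τ x ∧ 0 < SmallME.smearMoment χ γ 0 0 τ x) => by
    obtain ⟨e1, e2⟩ := hmodel.eventuallyEq_of_isVersionNear hm h.1 hτ
    exact And.intro (e1 z₁ (Or.inl rfl) hz₁ h.2.1.ne')
      (And.intro (e1 z₂ (Or.inr rfl) hz₂ h.2.2.1.ne') (e2 h.2.2.2.ne'))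
  have J := fun τ => SmallME.isJet_smearMoment hD hγ hφ hC0 hm3 τ
  have J' := fun τ => SmallME.isJet_smearMoment hD hγ hψ hC0 hm3 τ
  have Jb := fun τ => SmallME.isJet_smearMoment hD hγ hCm hC0 hm3 τ
  have K := fun τ => SmallME.isJet_smearMoment hD hγ hφr hC1 hm3 τ
  have K' := fun τ => SmallME.isJet_smearMoment hD hγ hψr hC1 hm3 τ
  have Kb := fun τ => SmallME.isJet_smearMoment hD hγ hχr hC1 hm3 τ
  have hest :
      ∀ᶠ τ in 𝓝[>] (0 : ℝ),
      SmallME.relevance (fX τ) (qX τ) z₁ z₂ x = SmallME.relJet (SmallME.densJet (SmallME.regTower χ r) γ τ x)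
        (SmallME.densJet χ γ τ x) (SmallME.densJet φ γ τ x) (SmallME.densJet ψ γ τ x) 0 ∧
      SmallME.vTilde (fX τ) (qXZ τ) (qX τ) z₁ z₂ x = SmallME.vJet
        (SmallME.densJet (SmallME.regTower φ r) γ τ x) (SmallME.densJet φ γ τ x)
        (SmallME.densJet (SmallME.regTower ψ r) γ τ x) (SmallME.densJet ψ γ τ x)
        (SmallME.densJet (SmallME.regTower χ r) γ τ x) (SmallME.densJet χ γ τ x) 0 ∧
      SmallME.rhoTilde (fX τ) (qXZ τ) (qX τ) z₁ z₂ x z₁ = SmallME.rhoJet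
        (SmallME.densJet (SmallME.regTower φ r) γ τ x) (SmallME.densJet φ γ τ x)
        (SmallME.densJet (SmallME.regTower ψ r) γ τ x) (SmallME.densJet ψ γ τ x)
        (SmallME.densJet (SmallME.regTower χ r) γ τ x) (SmallME.densJet χ γ τ x) := by
    filter_upwards [hver, hsmall, arel] with τ hv hs ha
    obtain ⟨⟨e1, e3⟩, ⟨e2, e4⟩, e5⟩ := jets τ hv hs
    exact SmallME.estimands_eq_jets (K τ).1 (J τ).1 (K' τ).1 (J' τ).1 (Kb τ).1 (Jb τ).1
      hs.2.2.2.ne' hs.2.1.ne' hs.2.2.1.ne' ha e1 e2 e3 e4 e5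
  refine ⟨?_, ?_, ?_⟩
  · filter_upwards [hver, hsmall, arel, hest] with τ hv hs ha he
    obtain ⟨⟨e1, e3⟩, ⟨e2, e4⟩, e5⟩ := jets τ hv hs
    refine ⟨?_, ?_, ?_⟩
    · rintro z (rfl | rfl)
      · exact ⟨by rw [e1.eq_of_nhds]; exact hs.2.1, (J τ).2.contDiffAt.congr_of_eventuallyEq e1,
          ((K τ).2.contDiffAt.div (J τ).2.contDiffAt hs.2.1.ne').congr_of_eventuallyEq e3⟩
      · exact ⟨by rw [e2.eq_of_nhds]; exact hs.2.2.1,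
          (J' τ).2.contDiffAt.congr_of_eventuallyEq e2,
          ((K' τ).2.contDiffAt.div (J' τ).2.contDiffAt hs.2.2.1.ne').congr_of_eventuallyEq e4⟩
    · exact ((Kb τ).2.contDiffAt.div (Jb τ).2.contDiffAt
        hs.2.2.2.ne').congr_of_eventuallyEq e5
    · rw [he.1]
      exact ha
  · refine av.congr' ?_ EventuallyEq.rfl
    filter_upwards [hest] with τ he
    rw [he.2.1]
    -- The weighted first moment vanishes at every point, and at `x` the positive density can be
    -- divided out; the mean is thus zero at this very `x`, and v(x) reduces to `τ ^ 2` times the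
    -- second moment.
    have hm1 : ∫ u, u * g u x = 0 := by
      have h1 := hmφ.first x
      rw [SmallME.smearMoment_zero_zero] at h1
      have := (mul_eq_zero.1 h1).resolve_left pφ.ne'
      simpa [SmallME.kernelDerivs_zero] using this
    have hsk : SmallME.skedastic g τ x = τ ^ 2 * ∫ u, u ^ 2 * γ 0 u x := by
      simp only [SmallME.skedastic, mul_assoc, integral_const_mul, hm1, mul_zero, sub_zero, hγ_def,
        SmallME.kernelDerivs_zero, mul_pow]
    rw [hsk]
  · refine aρ.congr' ?_ EventuallyEq.rfl
    filter_upwards [hest] with τ he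
    rw [he.2.2, hr0]
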